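/- **Theorem (Derdziński).** Let $(M,g)$ be an oriented smooth Riemannian $4$-manifold, and let $W^+$ be the self-dual part of its Weyl curvature, regarded as the symmetric endomorphism $(W^+\varphi)_{\mu\nu}=\tfrac12 W^+_{\mu\nu\rho\sigma}\varphi^{\rho\sigma}$ of the rank-three bundle $\Lambda^+$ of self-dual $2$-forms. Suppose that $W^+$ is of type D at every point, that is, exactly two of its three eigenvalues coincide; let $\alpha:M\to\mathbb R$ be the repeated eigenvalue. Suppose moreover that $W^+$ is divergence-free, $\nabla^\mu W^+_{\mu\nu\rho\sigma}=0$. Then: 1. $\alpha$ is smooth and vanishes nowhere, so that $g_K=\alpha^{2/3}g$, with $\alpha^{2/3}=|\alpha|^{2/3}$, is a smooth Riemannian metric on $M$ conformal to $g$. 2. Every point of $M$ has an open neighbourhood on which there is a smooth self-dual $2$-form $\Sigma$ with $\tfrac12\Sigma_{\mu\nu}\Sigma^{\mu\nu}=2$ and $W^+\Sigma=-2\alpha\,\Sigma$, i.e. a normalised eigenform for the non-repeated eigenvalue $-2\alpha$. 3. Let $U\subseteq M$ be any open set and $\Sigma$ any such $2$-form on $U$. Then the endomorphism field $J$ of $TU$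 defined by $g(Ju,v)=\Sigma(u,v)$ is a smooth almost complex structure that is orthogonal with respect to $g_K$ and integrable (its Nijenhuis tensor vanishes), and the $2$-form $\omega(u,v)=g_K(Ju,v)$, which equals $\alpha^{2/3}\Sigma$, is closed. Thus $(U,g_K,J)$ is Kähler with Kähler form $\omega=\alpha^{2/3}\Sigma$. In particular $g_K$ is Kähler near every point of $M$, and $(M,g_K)$ is globally Kähler whenever the line bundle of eigenforms for $-2\alpha$ is trivial on $M$ (take $U=M$ in 3). -/

import Mathlib

open scoped Manifold ContDiff

noncomputable section

namespace FourGeom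

/-! ### Local coordinate expressions on (subsets of) four-dimensional space

Below, `G` is the matrix-valued function of the components of a metric in a coordinate system,
and indices run over `Fin 4`. -/

/-- The coordinate space `ℝ⁴`. -/
abbrev R4 : Type := EuclideanSpace ℝ (Fin 4)

/-- Components of a tensor with four lower indices at a point. -/
abbrev Tensor4 : Type := Fin 4 → Fin 4 → Fin 4 → Fin 4 → ℝ

/-- The partial derivative `∂ᵢ f` at `z`. -/
def pd (i : Fin 4) (f : R4 → ℝ) (z : R4) : ℝ :=
  fderiv ℝ f z (EuclideanSpace.single i (1 : ℝ))

/-- The Christoffel symbols of the Levi-Civita connection: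
`Γᵏᵢⱼ = ½ gᵏˡ (∂ᵢ gₗⱼ + ∂ⱼ gₗᵢ - ∂ₗ gᵢⱼ)`. -/
def christoffel (G : R4 → Matrix (Fin 4) (Fin 4) ℝ) (z : R4) (k i j : Fin 4) : ℝ :=
  (1 / 2) * ∑ l, (G z)⁻¹ k l *
    (pd i (fun y => G y l j) z + pd j (fun y => G y l i) z - pd l (fun y => G y i j) z)

/-- The Riemann tensor `Rᵏₗᵢⱼ`, with `R(∂ᵢ, ∂ⱼ) ∂ₗ = Rᵏₗᵢⱼ ∂ₖ` and
`R(X, Y) = ∇_X ∇_Y - ∇_Y ∇_X - ∇_[X, Y]`. -/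
def riemannUp (G : R4 → Matrix (Fin 4) (Fin 4) ℝ) (z : R4) (k l i j : Fin 4) : ℝ :=
  pd i (fun y => christoffel G y k j l) z - pd j (fun y => christoffel G y k i l) z
    + ∑ m, (christoffel G z k i m * christoffel G z m j l
      - christoffel G z k j m * christoffel G z m i l)

/-- The Riemann tensor with all indices lowered, `Rₖₗᵢⱼ = gₖₘ Rᵐₗᵢⱼ`. With this convention the
unit sphere has `Rₖₗᵢⱼ = gₖᵢ gₗⱼ - gₖⱼ gₗᵢ`. -/
def riemann (G : R4 → Matrix (Fin 4) (Fin 4) ℝ) (z : R4) : Tensor4 := fun k l i j =>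
  ∑ m, G z k m * riemannUp G z m l i j

/-- The Ricci tensor `Ricₗⱼ = Rᵏₗₖⱼ`. -/
def ricci (G : R4 → Matrix (Fin 4) (Fin 4) ℝ) (z : R4) (l j : Fin 4) : ℝ :=
  ∑ k, riemannUp G z k l k j

/-- The scalar curvature `gˡʲ Ricₗⱼ`. -/
def scalarCurv (G : R4 → Matrix (Fin 4) (Fin 4) ℝ) (z : R4) : ℝ :=
  ∑ l, ∑ j, (G z)⁻¹ l j * ricci G z l j

/-- The Weyl tensor in dimension four. -/
def weyl (G : R4 → Matrix (Fin 4) (Fin 4) ℝ) (z : R4) : Tensor4 := fun k l i j =>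
  riemann G z k l i j
    - (1 / 2) * (G z k i * ricci G z l j - G z k j * ricci G z l i
      + G z l j * ricci G z k i - G z l i * ricci G z k j)
    + scalarCurv G z / 6 * (G z k i * G z l j - G z k j * G z l i)

/-- The totally antisymmetric symbol `[i j k l]` with `[0 1 2 3] = 1`. -/
def leviCivitaSymbol (i j k l : Fin 4) : ℝ :=
  Matrix.det (Matrix.of fun a b : Fin 4 => if ![i, j, k, l] a = b then (1 : ℝ) else 0)

/-- The components `εᵢⱼₖₗ = ± √(det g) [i j k l]` of the volume form of the metric `g` (a matrix),
`s = ±1` being the orientation of the coordinate system. -/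
def volumeTensor (g : Matrix (Fin 4) (Fin 4) ℝ) (s : ℝ) : Tensor4 := fun i j k l =>
  s * √g.det * leviCivitaSymbol i j k l

/-- The action of `T` on two-forms, `(T φ)ᵢⱼ = ½ Tᵢⱼₖₗ φᵏˡ`, indices being raised by `g`. -/
def twoFormOp (g : Matrix (Fin 4) (Fin 4) ℝ) (T : Tensor4) :
    Matrix (Fin 4) (Fin 4) ℝ →ₗ[ℝ] Matrix (Fin 4) (Fin 4) ℝ where
  toFun φ := Matrix.of fun i j =>
    (1 / 2) * ∑ k, ∑ l, ∑ a, ∑ b, T i j k l * g⁻¹ k a * g⁻¹ l b * φ a b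
  map_add' φ ψ := by
    ext i j
    simp [mul_add, Finset.sum_add_distrib]
  map_smul' c φ := by
    ext i j
    simp only [Matrix.of_apply, Matrix.smul_apply, smul_eq_mul, RingHom.id_apply, Finset.mul_sum]
    refine Finset.sum_congr rfl fun k _ => Finset.sum_congr rfl fun l _ =>
      Finset.sum_congr rfl fun a _ => Finset.sum_congr rfl fun b _ => ?_
    ring

/-- The Hodge star on two-forms, `(⋆φ)ᵢⱼ = ½ εᵢⱼₖₗ φᵏˡ`. -/
def hodgeStar (g : Matrix (Fin 4) (Fin 4) ℝ) (s : ℝ) :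
    Matrix (Fin 4) (Fin 4) ℝ →ₗ[ℝ] Matrix (Fin 4) (Fin 4) ℝ :=
  twoFormOp g (volumeTensor g s)

/-- The self-dual two-forms `Λ⁺`: antisymmetric `φ` with `⋆φ = φ`. -/
def selfDual (g : Matrix (Fin 4) (Fin 4) ℝ) (s : ℝ) : Submodule ℝ (Matrix (Fin 4) (Fin 4) ℝ) where
  carrier := {φ | φ.transpose = -φ ∧ hodgeStar g s φ = φ}
  add_mem' := by
    rintro φ ψ ⟨h1, h2⟩ ⟨h3, h4⟩
    exact ⟨by rw [Matrix.transpose_add, h1, h3, neg_add], by rw [map_add, h2, h4]⟩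
  zero_mem' := ⟨by simp, by simp⟩
  smul_mem' := by
    rintro c φ ⟨h1, h2⟩
    exact ⟨by rw [Matrix.transpose_smul, h1, smul_neg], by rw [map_smul, h2]⟩

/-- The tensor that acts on two-forms as the projection `½ (1 + ⋆)` onto `Λ⁺`. -/
def selfDualProj (g : Matrix (Fin 4) (Fin 4) ℝ) (s : ℝ) : Tensor4 := fun i j k l =>
  (1 / 2) * ((g i k * g j l - g i l * g j k) + volumeTensor g s i j k l)

/-- Composition of operators on two-forms, `(S T)ᵢⱼₖₗ = ½ Sᵢⱼᵃᵇ Tₐᵦₖₗ`. -/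
def compTwo (g : Matrix (Fin 4) (Fin 4) ℝ) (S T : Tensor4) : Tensor4 := fun i j k l =>
  (1 / 2) * ∑ a, ∑ b, ∑ c, ∑ d, S i j a b * g⁻¹ a c * g⁻¹ b d * T c d k l

/-- The self-dual Weyl tensor `W⁺`: the `Λ⁺`-`Λ⁺` block of the Weyl tensor. -/
def weylPlus (G : R4 → Matrix (Fin 4) (Fin 4) ℝ) (s : R4 → ℝ) (z : R4) : Tensor4 :=
  compTwo (G z) (selfDualProj (G z) (s z))
    (compTwo (G z) (weyl G z) (selfDualProj (G z) (s z)))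

/-- The eigenspace, inside the three-dimensional space `Λ⁺`, of `W⁺` for the eigenvalue `a`. -/
def weylPlusEigenspace (G : R4 → Matrix (Fin 4) (Fin 4) ℝ) (s : R4 → ℝ) (z : R4) (a : ℝ) :
    Submodule ℝ (Matrix (Fin 4) (Fin 4) ℝ) :=
  selfDual (G z) (s z) ⊓ Module.End.eigenspace (twoFormOp (G z) (weylPlus G s z)) a

/-- The Levi-Civita covariant derivative `∇ₘ Tᵢⱼₖₗ` of a tensor field with four lower indices. -/
def covDeriv (G : R4 → Matrix (Fin 4) (Fin 4) ℝ) (T : R4 → Tensor4) (z : R4)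
    (m i j k l : Fin 4) : ℝ :=
  pd m (fun y => T y i j k l) z
    - ∑ a, (christoffel G z a m i * T z a j k l + christoffel G z a m j * T z i a k l
      + christoffel G z a m k * T z i j a l + christoffel G z a m l * T z i j k a)

/-- The divergence `∇ⁱ Tᵢⱼₖₗ = gᵐⁱ ∇ₘ Tᵢⱼₖₗ`. -/
def divergence (G : R4 → Matrix (Fin 4) (Fin 4) ℝ) (T : R4 → Tensor4) (z : R4)
    (j k l : Fin 4) : ℝ :=
  ∑ m, ∑ i, (G z)⁻¹ m i * covDeriv G T z m i j k l

/-- The components `(dω)ᵢⱼₖ = ∂ᵢ ωⱼₖ + ∂ⱼ ωₖᵢ + ∂ₖ ωᵢⱼ` of the exterior derivative of a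
two-form. -/
def extDerivTwo (w : R4 → Matrix (Fin 4) (Fin 4) ℝ) (z : R4) (i j k : Fin 4) : ℝ :=
  pd i (fun y => w y j k) z + pd j (fun y => w y k i) z + pd k (fun y => w y i j) z

/-- The components `Nⁱⱼₖ` of the Nijenhuis tensor `[JX, JY] - J[JX, Y] - J[X, JY] + J²[X, Y]` of a
field of endomorphisms `Jⁱⱼ` (row index up). -/
def nijenhuis (J : R4 → Matrix (Fin 4) (Fin 4) ℝ) (z : R4) (i j k : Fin 4) : ℝ :=
  ∑ l, (J z l j * pd l (fun y => J y i k) z - J z l k * pd l (fun y => J y i j) z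
    - J z i l * (pd j (fun y => J y l k) z - pd k (fun y => J y l j) z))

/-! ### Four-manifolds -/

section Manifold

variable (M : Type*) [TopologicalSpace M] [ChartedSpace R4 M]

/-- The charts of the maximal smooth atlas of the four-manifold `M`. -/
abbrev charts : Set (OpenPartialHomeomorph M R4) := IsManifold.maximalAtlas (𝓡 4) ∞ M

/-- The smooth Riemannian metrics on `M`. -/
abbrev Metric4 [IsManifold (𝓡 4) ∞ M] : Type _ :=
  Bundle.ContMDiffRiemannianMetric (𝓡 4) ∞ R4 (fun x : M => TangentSpace (𝓡 4) x)

/-- Fields of bilinear forms on the tangent spaces (no regularity is included). -/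
abbrev BilinField : Type _ :=
  (x : M) → TangentSpace (𝓡 4) x →L[ℝ] TangentSpace (𝓡 4) x →L[ℝ] ℝ

/-- Fields of endomorphisms of the tangent spaces (no regularity is included). -/
abbrev EndField : Type _ :=
  (x : M) → TangentSpace (𝓡 4) x →L[ℝ] TangentSpace (𝓡 4) x

variable {M}

/-- The coordinate vector `∂ᵢ` of the chart `e`, at the point with coordinates `z`. -/
def frame (e : OpenPartialHomeomorph M R4) (z : R4) (i : Fin 4) :
    TangentSpace (𝓡 4) (e.symm z) :=
  mfderiv (𝓡 4) (𝓡 4) e.symm z (EuclideanSpace.single i (1 : ℝ) : R4)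

/-- The components `Bᵢⱼ = B(∂ᵢ, ∂ⱼ)` in the chart `e`. -/
def bilinComp (e : OpenPartialHomeomorph M R4) (B : BilinField M) (z : R4) :
    Matrix (Fin 4) (Fin 4) ℝ :=
  Matrix.of fun i j => B (e.symm z) (frame e z i) (frame e z j)

/-- The components `Jⁱⱼ` in the chart `e`: `J ∂ⱼ = Jⁱⱼ ∂ᵢ`. -/
def endComp (e : OpenPartialHomeomorph M R4) (J : EndField M) (z : R4) :
    Matrix (Fin 4) (Fin 4) ℝ :=
  Matrix.of fun i j =>
    let v : R4 := mfderiv (𝓡 4) (𝓡 4) e (e.symm z) (J (e.symm z) (frame e z j))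
    v i

/-- The sign, with respect to orientations `o` of the tangent spaces, of the coordinate frame of
the chart `e` at the point with coordinates `z`. -/
def frameSign (o : (x : M) → Orientation ℝ (TangentSpace (𝓡 4) x) (Fin 4))
    (e : OpenPartialHomeomorph M R4) (z : R4) : ℝ :=
  (SignType.sign ((o (e.symm z)).someVector (frame e z)) : ℝ)

variable (M) in
/-- An orientation of `M`: orientations of the tangent spaces that vary continuously, i.e. the sign
of each coordinate frame is locally constant. -/
structure ManifoldOrientation where
  /-- The orientations of the tangent spaces. -/
  at' : (x : M) → Orientation ℝ (TangentSpace (𝓡 4) x) (Fin 4)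
  continuous' : ∀ e ∈ charts M, ContinuousOn (frameSign at' e) e.target

variable [IsManifold (𝓡 4) ∞ M]

/-- The components of the metric `g` in the chart `e`. -/
abbrev metricComp (g : Metric4 M) (e : OpenPartialHomeomorph M R4) :
    R4 → Matrix (Fin 4) (Fin 4) ℝ :=
  bilinComp e g.inner

/-- `W⁺` is of type D at every point with repeated eigenvalue `α`: at every point `x`, the
eigenvalue `α x` of `W⁺` acting on `Λ⁺` has multiplicity exactly two. -/
def IsTypeDWith (g : Metric4 M) (o : ManifoldOrientation M) (α : M → ℝ) : Prop :=
  ∀ e ∈ charts M, ∀ z ∈ e.target,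
    Module.finrank ℝ
      (weylPlusEigenspace (metricComp g e) (frameSign o.at' e) z (α (e.symm z))) = 2

/-- `W⁺` is divergence-free: `∇ⁱ W⁺ᵢⱼₖₗ = 0`. -/
def DivFreeWeylPlus (g : Metric4 M) (o : ManifoldOrientation M) : Prop :=
  ∀ e ∈ charts M, ∀ z ∈ e.target, ∀ j k l : Fin 4,
    divergence (metricComp g e) (weylPlus (metricComp g e) (frameSign o.at' e)) z j k l = 0

/-- `S` is, on `U`, a smooth self-dual two-form of norm `√2` (that is, `½ Sᵢⱼ Sⁱʲ = 2`) and an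
eigenform of `W⁺` with eigenvalue `lam`. -/
structure IsNormalizedEigenformOn (g : Metric4 M) (o : ManifoldOrientation M) (lam : M → ℝ)
    (S : BilinField M) (U : Set M) : Prop where
  smooth : ∀ e ∈ charts M, ∀ i j : Fin 4,
    ContDiffOn ℝ ∞ (fun z => bilinComp e S z i j) (e.target ∩ e.symm ⁻¹' U)
  eigen : ∀ e ∈ charts M, ∀ z ∈ e.target, e.symm z ∈ U →
    bilinComp e S z ∈
      weylPlusEigenspace (metricComp g e) (frameSign o.at' e) z (lam (e.symm z))
  norm_sq : ∀ e ∈ charts M, ∀ z ∈ e.target, e.symm z ∈ U →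
    (1 / 2) * ∑ i, ∑ j, ∑ k, ∑ l, (metricComp g e z)⁻¹ i k * (metricComp g e z)⁻¹ j l
      * bilinComp e S z i j * bilinComp e S z k l = 2

/-- `(U, g, J)` is Kähler: on the open set `U`, `J` is a smooth `g`-orthogonal almost complex
structure which is integrable (its Nijenhuis tensor vanishes), and the two-form
`ω(u, v) = g(J u, v)` is closed. -/
structure IsKahlerOn (g : Metric4 M) (J : EndField M) (U : Set M) : Prop where
  smooth : ∀ e ∈ charts M, ∀ i j : Fin 4,
    ContDiffOn ℝ ∞ (fun z => endComp e J z i j) (e.target ∩ e.symm ⁻¹' U)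
  sq : ∀ x ∈ U, ∀ u : TangentSpace (𝓡 4) x, J x (J x u) = -u
  orthogonal : ∀ x ∈ U, ∀ u v : TangentSpace (𝓡 4) x,
    g.inner x (J x u) (J x v) = g.inner x u v
  integrable : ∀ e ∈ charts M, ∀ z ∈ e.target, e.symm z ∈ U → ∀ i j k : Fin 4,
    nijenhuis (endComp e J) z i j k = 0
  closed : ∀ e ∈ charts M, ∀ z ∈ e.target, e.symm z ∈ U → ∀ i j k : Fin 4,
    extDerivTwo (bilinComp e fun x => (g.inner x).comp (J x)) z i j k = 0

end Manifold

end FourGeom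

end

noncomputable section

/-! ### Frame covariance of contractions, of the volume tensor and of the self-dual Weyl tensor -/

namespace FourGeom

/-! ### Change of frame for tensors at a point -/

/-! Let P be the tensor of the projection onto Λ⁺. At a point, W⁺ is a symmetric trace-free operator
on a three-dimensional Euclidean space. If α has multiplicity exactly two, W⁺ − α is symmetric of
rank one with trace −3α. Hence α ≠ 0, since a symmetric operator of rank one has nonzero trace, and
W⁺ = αP − (3α/2) Σ ⊗ Σ with Σ of norm √2, unique up to sign (`eq_of_double_eigenvalue`,
`IsCoframe.structure_of_finrank`, `exists_adapted_coframe`). Smoothness needs no perturbation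
theory. The eigenvalue is a quotient of traces of powers of W⁺ (`IsTypeDOn.smooth_eigenvalue`); the
normal form then exhibits Σ ⊗ Σ as a smooth tensor, and dividing a slice of it by the square root of
a positive diagonal entry gives Σ locally (`IsTypeDOn.exists_eigenform`).

For the differential part, complete Σ = Σ₀ at a point to the standard triple Σ₀, Σ₁, Σ₂ of an
oriented orthonormal coframe; these satisfy the quaternion relations. Let xₐ be the contraction of
grad α with Σₐ. The projection P is parallel (`IsMetricOn.covDeriv_selfDualProj`), and ∇Σ is
orthogonal to Σ because the norm is constant (`IsTypeDOn.pair_covTwo`). In div W⁺ = 0 the component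
along Σ therefore only fixes the divergence of Σ, while the components along Σ₁ and Σ₂ give the
contraction of Σ with ∇Σ. That contraction is undone by J² = −1, and the result is 3α ∇Σ = x₁ ⊗ Σ₂ −
x₂ ⊗ Σ₁ (`IsCoframe.covariant_derivative_eq`).

Both conclusions are read off this formula. Alternating it and using x₁ ∧ Σ₂ − x₂ ∧ Σ₁ = −2 dα ∧ Σ
(`frameForm_cyclic`) gives 3α dΣ = −2 dα ∧ Σ, which says that |α|^(2/3) Σ is closed. The quaternion
relations also make x₁, x₂ rotate into each other under the almost complex structure, and then the
terms of the Nijenhuis tensor cancel (`IsCoframe.nijenhuis_algebra`). Orthogonality and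
integrability of J do not see the conformal factor.

All computations take place in charts, where the hypotheses are available. Only the existence of Σ
needs a comparison of charts: a form built in one chart must be an eigenform in all of them. This
follows from the tensorial transformation of curvature (`IsPullback.riemann_eq`) and the pointwise
covariance of W⁺ (`weylPlusOf_pull`). -/

abbrev Mat : Type := Matrix (Fin 4) (Fin 4) ℝ

open Matrix Kronecker

/-- A four-tensor as a matrix indexed by pairs of indices. -/
def asMat (T : Tensor4) : Matrix (Fin 4 × Fin 4) (Fin 4 × Fin 4) ℝ :=
  Matrix.of fun p q => T p.1 p.2 q.1 q.2

/-- A two-tensor as a vector indexed by pairs of indices. -/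
def asVec (φ : Mat) : Fin 4 × Fin 4 → ℝ := fun p => φ p.1 p.2

/-- The components of `T` in the frame given by the columns of `A`. -/
def pull4 (A : Mat) (T : Tensor4) : Tensor4 := fun i j k l =>
  ∑ a, ∑ b, ∑ c, ∑ d, A a i * A b j * A c k * A d l * T a b c d

theorem sum_pairs_comm (F : Fin 4 → Fin 4 → Fin 4 → Fin 4 → ℝ) :
    (∑ a, ∑ b, ∑ c, ∑ d, F a b c d) = ∑ c, ∑ d, ∑ a, ∑ b, F a b c d := by
  have h1 : ∀ a, (∑ b, ∑ c, ∑ d, F a b c d) = ∑ c, ∑ d, ∑ b, F a b c d := fun a => by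
    rw [Finset.sum_comm]
    exact Finset.sum_congr rfl fun _ _ => Finset.sum_comm
  rw [Finset.sum_congr rfl fun a _ => h1 a, Finset.sum_comm]
  exact Finset.sum_congr rfl fun _ _ => Finset.sum_comm

theorem asMat_injective : Function.Injective asMat := by
  intro S T h
  funext i j k l
  exact congrFun (congrFun h (i, j)) (k, l)

theorem asVec_injective : Function.Injective asVec := by
  intro S T h
  ext i j
  exact congrFun h (i, j)

/-- With pairs of indices as single indices, a change of frame is congruence by A ⊗ A. Covariance of
contracted expressions then reduces to associativity of matrix products. -/
theorem asMat_pull4 (A : Mat) (T : Tensor4) :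
    asMat (pull4 A T) = (A ⊗ₖ A)ᵀ * asMat T * (A ⊗ₖ A) := by
  ext ⟨i, j⟩ ⟨k, l⟩
  simp only [asMat, pull4, Matrix.mul_apply, Matrix.of_apply, Matrix.transpose_apply,
    Matrix.kroneckerMap_apply, Fintype.sum_prod_type, Finset.sum_mul]
  rw [sum_pairs_comm]
  refine Finset.sum_congr rfl fun _ _ => Finset.sum_congr rfl fun _ _ =>
    Finset.sum_congr rfl fun _ _ => Finset.sum_congr rfl fun _ _ => ?_
  ring

theorem asVec_pull (A φ : Mat) : asVec (Aᵀ * φ * A) = (A ⊗ₖ A)ᵀ *ᵥ asVec φ := by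
  ext ⟨i, j⟩
  simp only [asVec, Matrix.mul_apply, Matrix.mulVec, dotProduct, Matrix.transpose_apply,
    Matrix.kroneckerMap_apply, Fintype.sum_prod_type, Finset.sum_mul]
  rw [Finset.sum_comm]
  refine Finset.sum_congr rfl fun _ _ => Finset.sum_congr rfl fun _ _ => ?_
  ring

theorem asMat_compTwo (g : Mat) (S T : Tensor4) :
    asMat (compTwo g S T) = (1 / 2 : ℝ) • (asMat S * (g⁻¹ ⊗ₖ g⁻¹) * asMat T) := by
  ext ⟨i, j⟩ ⟨k, l⟩
  simp only [asMat, compTwo, Matrix.mul_apply, Matrix.of_apply, Matrix.smul_apply, smul_eq_mul,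
    Matrix.kroneckerMap_apply, Fintype.sum_prod_type, Finset.sum_mul]
  congr 1
  rw [sum_pairs_comm]
  refine Finset.sum_congr rfl fun _ _ => Finset.sum_congr rfl fun _ _ =>
    Finset.sum_congr rfl fun _ _ => Finset.sum_congr rfl fun _ _ => ?_
  ring

theorem asVec_twoFormOp (g : Mat) (T : Tensor4) (φ : Mat) :
    asVec (twoFormOp g T φ) = (1 / 2 : ℝ) • ((asMat T * (g⁻¹ ⊗ₖ g⁻¹)) *ᵥ asVec φ) := by
  ext ⟨i, j⟩
  simp only [asMat, asVec, twoFormOp, Matrix.mulVec, dotProduct, LinearMap.coe_mk, AddHom.coe_mk,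
    Matrix.mul_apply, Matrix.of_apply, Pi.smul_apply, smul_eq_mul,
    Matrix.kroneckerMap_apply, Fintype.sum_prod_type, Finset.sum_mul]
  congr 1
  rw [sum_pairs_comm]
  refine Finset.sum_congr rfl fun _ _ => Finset.sum_congr rfl fun _ _ =>
    Finset.sum_congr rfl fun _ _ => Finset.sum_congr rfl fun _ _ => ?_
  ring

/-- This is the cancellation of A against its inverse at every index contracted with the metric. -/
theorem inv_congr (A g : Mat) (hA : A.det ≠ 0) : A * (Aᵀ * g * A)⁻¹ * Aᵀ = g⁻¹ := by
  have h : IsUnit A.det := isUnit_iff_ne_zero.2 hA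
  have h' : IsUnit Aᵀ.det := by rwa [Matrix.det_transpose]
  rw [Matrix.mul_inv_rev, Matrix.mul_inv_rev, ← Matrix.mul_assoc, Matrix.mul_nonsing_inv _ h,
    Matrix.one_mul, Matrix.mul_assoc, Matrix.nonsing_inv_mul _ h', Matrix.mul_one]

theorem kronecker_inv_congr (A g : Mat) (hA : A.det ≠ 0) :
    (A ⊗ₖ A) * ((Aᵀ * g * A)⁻¹ ⊗ₖ (Aᵀ * g * A)⁻¹) * (A ⊗ₖ A)ᵀ = g⁻¹ ⊗ₖ g⁻¹ := by
  rw [← Matrix.kroneckerMap_transpose, ← Matrix.mul_kronecker_mul, ← Matrix.mul_kronecker_mul,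
    inv_congr A g hA]

theorem compTwo_pull4 (A g : Mat) (hA : A.det ≠ 0) (S T : Tensor4) :
    compTwo (Aᵀ * g * A) (pull4 A S) (pull4 A T) = pull4 A (compTwo g S T) := by
  apply asMat_injective
  rw [asMat_compTwo, asMat_pull4, asMat_pull4, asMat_pull4, asMat_compTwo,
    ← kronecker_inv_congr A g hA]
  simp only [Matrix.mul_assoc, Matrix.mul_smul, Matrix.smul_mul]

theorem twoFormOp_pull4 (A g : Mat) (hA : A.det ≠ 0) (T : Tensor4) (φ : Mat) :
    twoFormOp (Aᵀ * g * A) (pull4 A T) (Aᵀ * φ * A) = Aᵀ * twoFormOp g T φ * A := by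
  apply asVec_injective
  rw [asVec_twoFormOp, asVec_pull, asMat_pull4, asVec_pull, asVec_twoFormOp,
    ← kronecker_inv_congr A g hA]
  simp only [Matrix.mul_assoc, Matrix.mulVec_mulVec, Matrix.mulVec_smul]

theorem pull4_mul (A B : Mat) (T : Tensor4) : pull4 (A * B) T = pull4 B (pull4 A T) := by
  apply asMat_injective
  rw [asMat_pull4, asMat_pull4, asMat_pull4, Matrix.mul_kronecker_mul, Matrix.transpose_mul]
  simp only [Matrix.mul_assoc]

theorem pull4_one (T : Tensor4) : pull4 1 T = T := by
  apply asMat_injective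
  rw [asMat_pull4, Matrix.one_kronecker_one]
  simp

theorem pull4_add (A : Mat) (S T : Tensor4) : pull4 A (S + T) = pull4 A S + pull4 A T := by
  funext i j k l
  simp only [pull4, Pi.add_apply, mul_add, Finset.sum_add_distrib]

theorem pull4_smul (A : Mat) (c : ℝ) (T : Tensor4) : pull4 A (c • T) = c • pull4 A T := by
  funext i j k l
  simp only [pull4, Pi.smul_apply, smul_eq_mul, Finset.mul_sum]
  refine Finset.sum_congr rfl fun _ _ => Finset.sum_congr rfl fun _ _ =>
    Finset.sum_congr rfl fun _ _ => Finset.sum_congr rfl fun _ _ => ?_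
  ring

theorem pull4_neg (A : Mat) (T : Tensor4) : pull4 A (-T) = -pull4 A T := by
  have := pull4_smul A (-1) T
  simpa using this

theorem pull4_sub (A : Mat) (S T : Tensor4) : pull4 A (S - T) = pull4 A S - pull4 A T := by
  rw [sub_eq_add_neg, pull4_add, pull4_neg, ← sub_eq_add_neg]

/-- The tensor `φᵢⱼ ψₖₗ`. -/
def tens (φ ψ : Mat) : Tensor4 := fun i j k l => φ i j * ψ k l

/-- Exchange of the first two indices. -/
def swap12 (T : Tensor4) : Tensor4 := fun i j k l => T j i k l

/-- Exchange of the middle indices. -/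
def swap23 (T : Tensor4) : Tensor4 := fun i j k l => T i k j l

/-- Exchange of the last two indices. -/
def swap34 (T : Tensor4) : Tensor4 := fun i j k l => T i j l k

/-- Exchange of the two pairs of indices. -/
def swapPairs (T : Tensor4) : Tensor4 := fun i j k l => T k l i j

theorem pull_apply (A φ : Mat) (i j : Fin 4) :
    (Aᵀ * φ * A) i j = ∑ a, ∑ b, A a i * A b j * φ a b := by
  simp only [Matrix.mul_apply, Matrix.transpose_apply, Finset.sum_mul]
  rw [Finset.sum_comm]
  refine Finset.sum_congr rfl fun _ _ => Finset.sum_congr rfl fun _ _ => ?_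
  ring

theorem pull4_tens (A φ ψ : Mat) : pull4 A (tens φ ψ) = tens (Aᵀ * φ * A) (Aᵀ * ψ * A) := by
  funext i j k l
  simp only [tens, pull_apply, pull4, Finset.sum_mul, Finset.mul_sum]
  rw [sum_pairs_comm]
  refine Finset.sum_congr rfl fun _ _ => Finset.sum_congr rfl fun _ _ =>
    Finset.sum_congr rfl fun _ _ => Finset.sum_congr rfl fun _ _ => ?_
  ring

theorem pull4_swap12 (A : Mat) (T : Tensor4) : pull4 A (swap12 T) = swap12 (pull4 A T) := by
  funext i j k l
  simp only [pull4, swap12]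
  rw [Finset.sum_comm]
  refine Finset.sum_congr rfl fun _ _ => Finset.sum_congr rfl fun _ _ =>
    Finset.sum_congr rfl fun _ _ => Finset.sum_congr rfl fun _ _ => ?_
  ring

theorem pull4_swap23 (A : Mat) (T : Tensor4) : pull4 A (swap23 T) = swap23 (pull4 A T) := by
  funext i j k l
  simp only [pull4, swap23]
  refine Finset.sum_congr rfl fun a _ => ?_
  rw [Finset.sum_comm]
  refine Finset.sum_congr rfl fun _ _ => Finset.sum_congr rfl fun _ _ =>
    Finset.sum_congr rfl fun _ _ => ?_
  ring

theorem pull4_swap34 (A : Mat) (T : Tensor4) : pull4 A (swap34 T) = swap34 (pull4 A T) := by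
  funext i j k l
  simp only [pull4, swap34]
  refine Finset.sum_congr rfl fun _ _ => Finset.sum_congr rfl fun _ _ => ?_
  rw [Finset.sum_comm]
  refine Finset.sum_congr rfl fun _ _ => Finset.sum_congr rfl fun _ _ => ?_
  ring

theorem pull4_swapPairs (A : Mat) (T : Tensor4) :
    pull4 A (swapPairs T) = swapPairs (pull4 A T) := by
  apply asMat_injective
  have e : ∀ T, asMat (swapPairs T) = (asMat T)ᵀ := fun T => by
    ext ⟨i, j⟩ ⟨k, l⟩; rfl
  rw [asMat_pull4, e, e, asMat_pull4]
  simp only [Matrix.transpose_mul, Matrix.transpose_transpose, Matrix.mul_assoc]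

/-- The Kulkarni–Nomizu type product `φᵢₖ ψⱼₗ - φᵢₗ ψⱼₖ`. -/
def kn (φ ψ : Mat) : Tensor4 := fun i j k l => φ i k * ψ j l - φ i l * ψ j k

theorem kn_eq (φ ψ : Mat) : kn φ ψ = swap23 (tens φ ψ) - swap34 (swap23 (tens φ ψ)) := rfl

theorem pull4_kn (A φ ψ : Mat) : pull4 A (kn φ ψ) = kn (Aᵀ * φ * A) (Aᵀ * ψ * A) := by
  simp only [kn_eq, pull4_sub, pull4_swap34, pull4_swap23, pull4_tens]

/-! ### The volume tensor -/

/-- The right side is a Vandermonde product: it vanishes on repeated indices, is antisymmetric, and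
equals 1!·2!·3! = 12 at 0, 1, 2, 3. Over the integers, identities for it can be decided by
enumeration. -/
theorem twelve_mul_leviCivitaSymbol (i j k l : Fin 4) : 12 * leviCivitaSymbol i j k l =
    ((((j : ℕ) : ℤ) - (i : ℕ)) * ((k : ℕ) - (i : ℕ)) * ((l : ℕ) - (i : ℕ)) *
      ((k : ℕ) - (j : ℕ)) * ((l : ℕ) - (j : ℕ)) * ((l : ℕ) - (k : ℕ)) : ℤ) := by
  have h : leviCivitaSymbol i j k l = ((Matrix.det (Matrix.of fun a b : Fin 4 =>
      if ![i, j, k, l] a = b then (1 : ℤ) else 0) : ℤ) : ℝ) := by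
    rw [Int.cast_det, leviCivitaSymbol]
    congr 1
    ext a b
    simp
  have key : 12 * Matrix.det (Matrix.of fun a b : Fin 4 =>
      if ![i, j, k, l] a = b then (1 : ℤ) else 0) =
      (((j : ℕ) : ℤ) - (i : ℕ)) * ((k : ℕ) - (i : ℕ)) * ((l : ℕ) - (i : ℕ)) *
      ((k : ℕ) - (j : ℕ)) * ((l : ℕ) - (j : ℕ)) * ((l : ℕ) - (k : ℕ)) := by
    clear h
    simp only [Matrix.det_succ_row_zero (n := 3), Matrix.det_fin_three, Fin.sum_univ_four]
    simp only [Matrix.submatrix_apply, Matrix.of_apply]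
    revert i j k l
    decide
  rw [h, ← key]
  push_cast
  rfl

theorem leviCivitaSymbol_eq (i j k l : Fin 4) : leviCivitaSymbol i j k l =
    (1 / 12) * ((((j : ℕ) : ℝ) - (i : ℕ)) * ((k : ℕ) - (i : ℕ)) * ((l : ℕ) - (i : ℕ)) *
      ((k : ℕ) - (j : ℕ)) * ((l : ℕ) - (j : ℕ)) * ((l : ℕ) - (k : ℕ))) := by
  have h := twelve_mul_leviCivitaSymbol i j k l
  push_cast at h
  linarith

theorem sum_leviCivitaSymbol (f : Fin 4 → Fin 4 → Fin 4 → Fin 4 → ℝ) :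
    ∑ a, ∑ b, ∑ c, ∑ d, f a b c d * leviCivitaSymbol a b c d =
      f 0 1 2 3 - f 0 1 3 2 - f 0 2 1 3 + f 0 2 3 1 + f 0 3 1 2 - f 0 3 2 1
      - f 1 0 2 3 + f 1 0 3 2 + f 1 2 0 3 - f 1 2 3 0 - f 1 3 0 2 + f 1 3 2 0
      + f 2 0 1 3 - f 2 0 3 1 - f 2 1 0 3 + f 2 1 3 0 + f 2 3 0 1 - f 2 3 1 0
      - f 3 0 1 2 + f 3 0 2 1 + f 3 1 0 2 - f 3 1 2 0 - f 3 2 0 1 + f 3 2 1 0 := by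
  simp only [leviCivitaSymbol_eq, Fin.sum_univ_four]
  norm_num
  ring

theorem det_rows (A : Mat) (i j k l : Fin 4) :
    (Matrix.of fun r b => A b (![i, j, k, l] r)).det = A.det * leviCivitaSymbol i j k l := by
  have : (Matrix.of fun r b => A b (![i, j, k, l] r)) =
      (Matrix.of fun a b : Fin 4 => if ![i, j, k, l] a = b then (1 : ℝ) else 0) * Aᵀ := by
    ext r b
    simp [Matrix.mul_apply]
  rw [this, Matrix.det_mul, Matrix.det_transpose, leviCivitaSymbol, mul_comm]

theorem pull4_leviCivitaSymbol (A : Mat) :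
    pull4 A leviCivitaSymbol = A.det • leviCivitaSymbol := by
  funext i j k l
  rw [Pi.smul_apply, Pi.smul_apply, Pi.smul_apply, Pi.smul_apply, smul_eq_mul, ← det_rows, pull4,
    sum_leviCivitaSymbol]
  simp only [Matrix.det_succ_row_zero (n := 3), Matrix.det_fin_three, Fin.sum_univ_four]
  simp [Matrix.submatrix_apply, Fin.succAbove]
  ring

theorem volumeTensor_eq (g : Mat) (s : ℝ) :
    volumeTensor g s = (s * √g.det) • leviCivitaSymbol := by
  funext i j k l
  simp [volumeTensor]

/-- The hypothesis says s' = s · sign (det A) without mentioning the sign function; it compensates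
for √(det A²) being |det A|. -/
theorem volumeTensor_pull (A g : Mat) (s s' : ℝ) (h : s' * |A.det| = s * A.det) :
    volumeTensor (Aᵀ * g * A) s' = pull4 A (volumeTensor g s) := by
  rw [volumeTensor_eq, volumeTensor_eq, pull4_smul, pull4_leviCivitaSymbol, smul_smul,
    Matrix.det_mul, Matrix.det_mul, Matrix.det_transpose,
    show A.det * g.det * A.det = A.det ^ 2 * g.det by ring, Real.sqrt_mul (sq_nonneg _),
    Real.sqrt_sq_eq_abs, ← mul_assoc, h]
  congr 1
  ring

theorem selfDualProj_eq (g : Mat) (s : ℝ) :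
    selfDualProj g s = (1 / 2 : ℝ) • (kn g g + volumeTensor g s) := by
  funext i j k l
  simp [selfDualProj, kn]

theorem selfDualProj_pull (A g : Mat) (s s' : ℝ) (h : s' * |A.det| = s * A.det) :
    selfDualProj (Aᵀ * g * A) s' = pull4 A (selfDualProj g s) := by
  rw [selfDualProj_eq, selfDualProj_eq, volumeTensor_pull A g s s' h, pull4_smul, pull4_add,
    pull4_kn]

theorem mem_selfDual_pull (A g : Mat) (s s' : ℝ) (hA : A.det ≠ 0)
    (h : s' * |A.det| = s * A.det) {φ : Mat} (hφ : φ ∈ selfDual g s) :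
    Aᵀ * φ * A ∈ selfDual (Aᵀ * g * A) s' := by
  obtain ⟨h1, h2⟩ := hφ
  refine ⟨?_, ?_⟩
  · simp [Matrix.transpose_mul, Matrix.mul_assoc, h1]
  · rw [hodgeStar, volumeTensor_pull A g s s' h, twoFormOp_pull4 A g hA, ← hodgeStar, h2]

/-! ### The Weyl tensor and its self-dual part from the Riemann tensor -/

/-- The Ricci contraction of a curvature tensor. -/
def ricciOf (g : Mat) (R : Tensor4) : Mat := Matrix.of fun l j => ∑ k, ∑ m, g⁻¹ k m * R m l k j

/-- The total trace of a two-tensor. -/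
def traceOf (g h : Mat) : ℝ := ∑ l, ∑ j, g⁻¹ l j * h l j

/-- The trace-free part of a curvature tensor. -/
def weylOf (g : Mat) (R : Tensor4) : Tensor4 :=
  R - (1 / 2 : ℝ) • (kn g (ricciOf g R) + kn (ricciOf g R) g)
    + (traceOf g (ricciOf g R) / 6) • kn g g

/-- The self-dual part of the trace-free part of a curvature tensor. -/
def weylPlusOf (g : Mat) (s : ℝ) (R : Tensor4) : Tensor4 :=
  compTwo g (selfDualProj g s) (compTwo g (weylOf g R) (selfDualProj g s))

theorem asVec_inv_congr (A g : Mat) (hA : A.det ≠ 0) :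
    asVec g⁻¹ = (A ⊗ₖ A) *ᵥ asVec (Aᵀ * g * A)⁻¹ := by
  have := asVec_pull Aᵀ (Aᵀ * g * A)⁻¹
  rwa [Matrix.transpose_transpose, inv_congr A g hA, Matrix.kroneckerMap_transpose,
    Matrix.transpose_transpose] at this

theorem asVec_ricciOf (g : Mat) (R : Tensor4) :
    asVec (ricciOf g R) = (asMat (swap12 (swap23 R)))ᵀ *ᵥ asVec g⁻¹ := by
  ext ⟨l, j⟩
  simp only [asVec, ricciOf, asMat, swap12, swap23, Matrix.of_apply, Matrix.mulVec, dotProduct,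
    Matrix.transpose_apply, Fintype.sum_prod_type]
  refine Finset.sum_congr rfl fun _ _ => Finset.sum_congr rfl fun _ _ => ?_
  ring

theorem traceOf_eq (g h : Mat) : traceOf g h = asVec g⁻¹ ⬝ᵥ asVec h := by
  simp only [traceOf, dotProduct, asVec, Fintype.sum_prod_type]

theorem ricciOf_pull (A g : Mat) (hA : A.det ≠ 0) (R : Tensor4) :
    ricciOf (Aᵀ * g * A) (pull4 A R) = Aᵀ * ricciOf g R * A := by
  apply asVec_injective
  rw [asVec_ricciOf, asVec_pull, asVec_ricciOf, ← pull4_swap23, ← pull4_swap12, asMat_pull4,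
    asVec_inv_congr A g hA]
  simp only [Matrix.transpose_mul, Matrix.transpose_transpose, Matrix.mul_assoc,
    Matrix.mulVec_mulVec]

theorem traceOf_pull (A g h : Mat) (hA : A.det ≠ 0) :
    traceOf (Aᵀ * g * A) (Aᵀ * h * A) = traceOf g h := by
  rw [traceOf_eq, traceOf_eq, asVec_inv_congr A g hA, asVec_pull, Matrix.dotProduct_mulVec,
    Matrix.vecMul_transpose]

theorem weylOf_pull (A g : Mat) (hA : A.det ≠ 0) (R : Tensor4) :
    weylOf (Aᵀ * g * A) (pull4 A R) = pull4 A (weylOf g R) := by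
  simp only [weylOf, ricciOf_pull A g hA, traceOf_pull A g _ hA, pull4_add, pull4_sub, pull4_smul,
    pull4_kn]

theorem weylPlusOf_pull (A g : Mat) (s s' : ℝ) (hA : A.det ≠ 0)
    (h : s' * |A.det| = s * A.det) (R : Tensor4) :
    weylPlusOf (Aᵀ * g * A) s' (pull4 A R) = pull4 A (weylPlusOf g s R) := by
  rw [weylPlusOf, weylPlusOf, weylOf_pull A g hA, selfDualProj_pull A g s s' h,
    compTwo_pull4 A g hA, compTwo_pull4 A g hA]

/-- The coordinate definition traces the curvature with its first index up. Lowering this index and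
raising it again makes the Ricci tensor a function of the metric and the lowered curvature at the
point alone. -/
theorem ricci_eq_ricciOf (G : R4 → Mat) (z : R4) (hG : (G z).det ≠ 0) :
    Matrix.of (ricci G z) = ricciOf (G z) (riemann G z) := by
  ext l j
  simp only [ricci, ricciOf, Matrix.of_apply, riemann, Finset.mul_sum]
  refine Finset.sum_congr rfl fun k _ => ?_
  rw [Finset.sum_comm]
  have : ∀ n, (∑ m, (G z)⁻¹ k m * (G z m n * riemannUp G z n l k j)) =
      (1 : Mat) k n * riemannUp G z n l k j := fun n => by
    rw [← Matrix.nonsing_inv_mul _ (isUnit_iff_ne_zero.2 hG), Matrix.mul_apply, Finset.sum_mul]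
    simp only [mul_assoc]
  rw [Finset.sum_congr rfl fun n _ => this n]
  simp [Matrix.one_apply]

theorem weyl_eq_weylOf (G : R4 → Mat) (z : R4) (hG : (G z).det ≠ 0) :
    weyl G z = weylOf (G z) (riemann G z) := by
  funext k l i j
  have h := ricci_eq_ricciOf G z hG
  have h2 : scalarCurv G z = traceOf (G z) (ricciOf (G z) (riemann G z)) := by
    rw [← h]; rfl
  simp only [weyl, h2, weylOf, ← h, kn, Pi.add_apply, Pi.sub_apply, Pi.smul_apply, smul_eq_mul,
    Matrix.of_apply]
  ring

/-- Derivatives of the metric enter only through the Riemann tensor, so covariance of W⁺ becomes a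
question of algebra at one point. -/
theorem weylPlus_eq_weylPlusOf (G : R4 → Mat) (s : R4 → ℝ) (z : R4) (hG : (G z).det ≠ 0) :
    weylPlus G s z = weylPlusOf (G z) (s z) (riemann G z) := by
  rw [weylPlus, weylPlusOf, weyl_eq_weylOf G z hG]

end FourGeom

/-! ### The Euclidean model of Λ⁺ and operators of rank one -/

namespace FourGeom

open Matrix Kronecker

/-! ### The standard self-dual two-forms -/

/-- The forms e⁰¹ + e²³, e⁰² − e¹³, e⁰³ + e¹², of norm √2: an orthogonal basis of Λ⁺ for the
Euclidean metric. -/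
def eta : Fin 3 → Mat :=
  ![!![0, 1, 0, 0; -1, 0, 0, 0; 0, 0, 0, 1; 0, 0, -1, 0],
    !![0, 0, 1, 0; 0, 0, 0, -1; -1, 0, 0, 0; 0, 1, 0, 0],
    !![0, 0, 0, 1; 0, 0, 1, 0; 0, -1, 0, 0; -1, 0, 0, 0]]

/-- The inner product `½ φᵢⱼ ψⁱʲ` of two-tensors. -/
def pair (g φ ψ : Mat) : ℝ :=
  (1 / 2) * ∑ i, ∑ j, ∑ k, ∑ l, g⁻¹ i k * g⁻¹ j l * φ i j * ψ k l

theorem pair_eq (g φ ψ : Mat) :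
    pair g φ ψ = (1 / 2) * (asVec φ ⬝ᵥ ((g⁻¹ ⊗ₖ g⁻¹) *ᵥ asVec ψ)) := by
  simp only [pair, asVec, dotProduct, Matrix.mulVec, Fintype.sum_prod_type,
    Matrix.kroneckerMap_apply, Finset.mul_sum]
  refine Finset.sum_congr rfl fun _ _ => Finset.sum_congr rfl fun _ _ =>
    Finset.sum_congr rfl fun _ _ => Finset.sum_congr rfl fun _ _ => ?_
  ring

theorem pair_one (φ ψ : Mat) : pair 1 φ ψ = (1 / 2) * ∑ i, ∑ j, φ i j * ψ i j := by
  rw [pair_eq, inv_one, Matrix.one_kronecker_one, Matrix.one_mulVec]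
  simp only [asVec, dotProduct, Fintype.sum_prod_type]

theorem pair_pull (A g : Mat) (hA : A.det ≠ 0) (φ ψ : Mat) :
    pair (Aᵀ * g * A) (Aᵀ * φ * A) (Aᵀ * ψ * A) = pair g φ ψ := by
  rw [pair_eq, pair_eq, asVec_pull, asVec_pull, ← kronecker_inv_congr A g hA,
    Matrix.mulVec_transpose, ← Matrix.dotProduct_mulVec]
  simp only [Matrix.mulVec_mulVec, Matrix.mul_assoc]

theorem pair_add_right (g φ ψ χ : Mat) : pair g φ (ψ + χ) = pair g φ ψ + pair g φ χ := by
  simp only [pair, Matrix.add_apply, mul_add, Finset.sum_add_distrib]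

theorem pair_smul_right (g φ ψ : Mat) (c : ℝ) : pair g φ (c • ψ) = c * pair g φ ψ := by
  have : asVec (c • ψ) = c • asVec ψ := rfl
  simp only [pair_eq, this, Matrix.mulVec_smul, dotProduct_smul, smul_eq_mul]
  ring

theorem pair_smul_left (g φ ψ : Mat) (c : ℝ) : pair g (c • φ) ψ = c * pair g φ ψ := by
  have : asVec (c • φ) = c • asVec φ := rfl
  simp only [pair_eq, this, smul_dotProduct, smul_eq_mul]
  ring

theorem pair_sum_right {ι : Type*} (s : Finset ι) (g φ : Mat) (ψ : ι → Mat) :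
    pair g φ (∑ a ∈ s, ψ a) = ∑ a ∈ s, pair g φ (ψ a) := by
  have : asVec (∑ a ∈ s, ψ a) = ∑ a ∈ s, asVec (ψ a) := by
    ext p; simp [asVec, Matrix.sum_apply]
  simp only [pair_eq, this, Matrix.mulVec_sum, dotProduct_sum, Finset.mul_sum]

theorem asMat_tens (φ ψ : Mat) : asMat (tens φ ψ) = vecMulVec (asVec φ) (asVec ψ) := rfl

theorem twoFormOp_tens (g φ ψ χ : Mat) :
    twoFormOp g (tens φ ψ) χ = pair g ψ χ • φ := by
  apply asVec_injective
  rw [asVec_twoFormOp, asMat_tens, ← Matrix.mulVec_mulVec, Matrix.vecMulVec_mulVec, pair_eq]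
  ext p
  simp [asVec]
  ring

theorem twoFormOp_add (g : Mat) (S T : Tensor4) :
    twoFormOp g (S + T) = twoFormOp g S + twoFormOp g T := by
  ext1 φ
  apply asVec_injective
  have h : ∀ S T, asMat (S + T) = asMat S + asMat T := fun _ _ => rfl
  have h2 : ∀ S T, asVec (S + T) = asVec S + asVec T := fun _ _ => rfl
  rw [LinearMap.add_apply, h2, asVec_twoFormOp, asVec_twoFormOp, asVec_twoFormOp, h,
    Matrix.add_mul, Matrix.add_mulVec, smul_add]

theorem twoFormOp_smul (g : Mat) (c : ℝ) (T : Tensor4) :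
    twoFormOp g (c • T) = c • twoFormOp g T := by
  ext1 φ
  apply asVec_injective
  have h : ∀ T, asMat (c • T) = c • asMat T := fun _ => rfl
  have h2 : ∀ T, asVec (c • T) = c • asVec T := fun _ => rfl
  rw [LinearMap.smul_apply, h2, asVec_twoFormOp, asVec_twoFormOp, h,
    Matrix.smul_mul, Matrix.smul_mulVec, smul_comm]

theorem twoFormOp_sub (g : Mat) (S T : Tensor4) :
    twoFormOp g (S - T) = twoFormOp g S - twoFormOp g T := by
  have h := twoFormOp_smul g (-1) T
  rw [neg_one_smul, show (-1 : ℝ) • twoFormOp g T = -twoFormOp g T by module] at h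
  rw [sub_eq_add_neg, twoFormOp_add, h, ← sub_eq_add_neg]

theorem twoFormOp_sum {ι : Type*} (s : Finset ι) (g : Mat) (T : ι → Tensor4) :
    twoFormOp g (∑ a ∈ s, T a) = ∑ a ∈ s, twoFormOp g (T a) := by
  classical
  induction s using Finset.induction_on with
  | empty =>
    ext1 φ
    apply asVec_injective
    rw [Finset.sum_empty, asVec_twoFormOp]
    simp [show asMat 0 = 0 from rfl, show asVec 0 = 0 from rfl]
  | insert a s ha ih => rw [Finset.sum_insert ha, Finset.sum_insert ha, twoFormOp_add, ih]

/-- With the projection written as a sum of rank-one tensors, each sandwich of T extracts one matrix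
entry of T. This turns the Λ⁺-block of a tensor into a 3 × 3 matrix. -/
theorem compTwo_sandwich (g : Mat) (a b c d : Mat) (T : Tensor4) :
    compTwo g (tens a b) (compTwo g T (tens c d)) = pair g b (twoFormOp g T c) • tens a d := by
  apply asMat_injective
  rw [asMat_compTwo, asMat_compTwo, asMat_tens, asMat_tens, pair_eq, asVec_twoFormOp]
  have h : ∀ (c : ℝ) T, asMat (c • T) = c • asMat T := fun _ _ => rfl
  rw [h, asMat_tens]
  simp only [Matrix.mul_smul, smul_smul, Matrix.mulVec_smul, dotProduct_smul, smul_eq_mul]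
  rw [Matrix.mul_vecMulVec, Matrix.mul_assoc, Matrix.mul_vecMulVec, Matrix.vecMulVec_mul_vecMulVec]
  ext p q
  simp only [Matrix.smul_apply, Pi.smul_apply, smul_eq_mul, Matrix.vecMulVec_apply]
  ring

theorem compTwo_sum_left {ι : Type*} (s : Finset ι) (g : Mat) (S : ι → Tensor4) (T : Tensor4) :
    compTwo g (∑ a ∈ s, S a) T = ∑ a ∈ s, compTwo g (S a) T := by
  apply asMat_injective
  have h : ∀ S : ι → Tensor4, asMat (∑ a ∈ s, S a) = ∑ a ∈ s, asMat (S a) := fun S => by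
    ext p q; simp [asMat, Matrix.sum_apply]
  simp only [h, asMat_compTwo, Matrix.sum_mul, Finset.smul_sum]

theorem compTwo_sum_right {ι : Type*} (s : Finset ι) (g : Mat) (S : Tensor4) (T : ι → Tensor4) :
    compTwo g S (∑ a ∈ s, T a) = ∑ a ∈ s, compTwo g S (T a) := by
  apply asMat_injective
  have h : ∀ S : ι → Tensor4, asMat (∑ a ∈ s, S a) = ∑ a ∈ s, asMat (S a) := fun S => by
    ext p q; simp [asMat, Matrix.sum_apply]
  simp only [h, asMat_compTwo, Matrix.mul_sum, Finset.smul_sum]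

theorem compTwo_smul_left (g : Mat) (c : ℝ) (S T : Tensor4) :
    compTwo g (c • S) T = c • compTwo g S T := by
  apply asMat_injective
  have h : ∀ T, asMat (c • T) = c • asMat T := fun _ => rfl
  simp only [h, asMat_compTwo, Matrix.smul_mul, smul_comm c]

theorem compTwo_smul_right (g : Mat) (c : ℝ) (S T : Tensor4) :
    compTwo g S (c • T) = c • compTwo g S T := by
  apply asMat_injective
  have h : ∀ T, asMat (c • T) = c • asMat T := fun _ => rfl
  simp only [h, asMat_compTwo, Matrix.mul_smul, smul_comm c]

/-- The components of the standard self-dual two-forms, as integers. -/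
def etaInt : Fin 3 → Matrix (Fin 4) (Fin 4) ℤ :=
  ![!![0, 1, 0, 0; -1, 0, 0, 0; 0, 0, 0, 1; 0, 0, -1, 0],
    !![0, 0, 1, 0; 0, 0, 0, -1; -1, 0, 0, 0; 0, 1, 0, 0],
    !![0, 0, 0, 1; 0, 0, 1, 0; 0, -1, 0, 0; -1, 0, 0, 0]]

theorem eta_eq_etaInt (a : Fin 3) (i j : Fin 4) : eta a i j = (etaInt a i j : ℤ) := by
  fin_cases a <;> fin_cases i <;> fin_cases j <;> simp [eta, etaInt]

/-- Twelve times the expansion of the self-dual projection in the standard basis, an integer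
identity in finitely many index quadruples. -/
theorem etaInt_contraction (i j k l : Fin 4) :
    12 * ((if i = k then 1 else 0) * (if j = l then 1 else 0) -
      (if i = l then 1 else 0) * (if j = k then 1 else 0)) +
      (((j : ℕ) : ℤ) - (i : ℕ)) * ((k : ℕ) - (i : ℕ)) * ((l : ℕ) - (i : ℕ)) *
      ((k : ℕ) - (j : ℕ)) * ((l : ℕ) - (j : ℕ)) * ((l : ℕ) - (k : ℕ)) =
    12 * (etaInt 0 i j * etaInt 0 k l + etaInt 1 i j * etaInt 1 k l +
      etaInt 2 i j * etaInt 2 k l) := by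
  revert i j k l
  decide

theorem selfDualProj_one : selfDualProj 1 1 = (1 / 2 : ℝ) • ∑ a, tens (eta a) (eta a) := by
  funext i j k l
  have h := congrArg (fun n : ℤ => (n : ℝ)) (etaInt_contraction i j k l)
  rw [Fin.sum_univ_three]
  simp only [selfDualProj, volumeTensor, Matrix.det_one, Real.sqrt_one, leviCivitaSymbol_eq,
    Pi.smul_apply, Pi.add_apply, tens, smul_eq_mul, eta_eq_etaInt, Matrix.one_apply]
  push_cast at h
  linarith

theorem pair_eta (a b : Fin 3) : pair 1 (eta a) (eta b) = if a = b then 2 else 0 := by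
  rw [pair_one]
  fin_cases a <;> fin_cases b <;> simp [eta, Fin.sum_univ_four] <;> norm_num

theorem eta_mem_selfDual (a : Fin 3) : eta a ∈ selfDual 1 1 := by
  have h : (eta a)ᵀ = -eta a := by
    fin_cases a <;> · ext i j; fin_cases i <;> fin_cases j <;> simp [eta]
  refine ⟨h, ?_⟩
  ext i j
  simp only [hodgeStar, twoFormOp, LinearMap.coe_mk, AddHom.coe_mk, Matrix.of_apply,
    volumeTensor, Matrix.det_one, Real.sqrt_one, inv_one, leviCivitaSymbol_eq,
    Matrix.one_apply]
  fin_cases a <;> fin_cases i <;> fin_cases j <;> simp [eta, Fin.sum_univ_four] <;> norm_num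

/-- A self-dual form is determined by its first row: self-duality gives the entries (2,3), (1,3),
(1,2) and skewness the rest. -/
theorem exists_eq_sum_eta {φ : Mat} (hφ : φ ∈ selfDual 1 1) :
    ∃ v : Fin 3 → ℝ, φ = ∑ a, v a • eta a := by
  obtain ⟨h1, h2⟩ := hφ
  have h1' : ∀ i j, φ j i = -φ i j := fun i j => congrFun (congrFun h1 i) j
  have h2' : ∀ i j, hodgeStar 1 1 φ i j = φ i j := fun i j => by rw [h2]
  simp only [hodgeStar, twoFormOp, LinearMap.coe_mk, AddHom.coe_mk, Matrix.of_apply,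
    volumeTensor, Matrix.det_one, Real.sqrt_one, inv_one, leviCivitaSymbol_eq,
    Matrix.one_apply] at h2'
  have a1 := h2' 2 3
  have a2 := h2' 1 3
  have a3 := h2' 1 2
  simp [Fin.sum_univ_four] at a1 a2 a3
  have d : ∀ i, φ i i = 0 := fun i => by linarith [h1' i i]
  refine ⟨![φ 0 1, φ 0 2, φ 0 3], ?_⟩
  ext i j
  fin_cases i <;> fin_cases j <;> simp [eta, Fin.sum_univ_three, d] <;>
    linarith [h1' 0 1, h1' 0 2, h1' 0 3, h1' 1 2, h1' 1 3, h1' 2 3]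

end FourGeom

/-! ### The normal form of a type D self-dual Weyl tensor at a point -/

namespace FourGeom

open Matrix Kronecker

/-! ### Symmetric trace-free operators with a double eigenvalue in dimension three -/

/-- By rank-nullity B = w − a has rank one, so its columns are multiples of one vector u; symmetry
makes B a multiple of u uᵀ, and the trace −3a fixes the multiple. If a were zero, B would vanish,
contrary to its rank. -/
theorem eq_of_double_eigenvalue {w : Matrix (Fin 3) (Fin 3) ℝ} {a : ℝ} (hs : wᵀ = w)
    (ht : w.trace = 0)
    (hf : Module.finrank ℝ (LinearMap.ker (Matrix.toLin' (w - a • (1 : Matrix (Fin 3) (Fin 3) ℝ))))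
      = 2) :
    a ≠ 0 ∧ ∃ n : Fin 3 → ℝ, n ⬝ᵥ n = 1 ∧
      ∀ i j, w i j = a * ((if i = j then 1 else 0) - 3 * n i * n j) := by
  set B := w - a • (1 : Matrix (Fin 3) (Fin 3) ℝ) with hB
  have hr := LinearMap.finrank_range_add_finrank_ker (Matrix.toLin' B)
  rw [hf, Module.finrank_fin_fun] at hr
  have hr1 : Module.finrank ℝ (LinearMap.range (Matrix.toLin' B)) = 1 := by omega
  obtain ⟨⟨u, hu⟩, hu0, huc⟩ := finrank_eq_one_iff'.1 hr1
  have hc : ∀ j, ∃ c : ℝ, ∀ i, B i j = u i * c := by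
    intro j
    obtain ⟨c, hc⟩ := huc ⟨Matrix.toLin' B (Pi.single j 1), LinearMap.mem_range_self _ _⟩
    refine ⟨c, fun i => ?_⟩
    have := congrFun (congrArg Subtype.val hc) i
    simp at this
    rw [← this, mul_comm]
  choose c hc using hc
  have hsym : ∀ i j, B i j = B j i := by
    intro i j
    have := congrFun (congrFun hs j) i
    simp only [Matrix.transpose_apply] at this
    simp [hB, this, Matrix.one_apply, eq_comm]
  have htr : B 0 0 + B 1 1 + B 2 2 = -3 * a := by
    simp [Matrix.trace, Fin.sum_univ_three] at ht
    simp [hB]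
    linarith
  have hupos : 0 < u 0 ^ 2 + u 1 ^ 2 + u 2 ^ 2 := by
    by_contra hneg
    have h0 : u 0 = 0 := by nlinarith [sq_nonneg (u 0), sq_nonneg (u 1), sq_nonneg (u 2)]
    have h1 : u 1 = 0 := by nlinarith [sq_nonneg (u 0), sq_nonneg (u 1), sq_nonneg (u 2)]
    have h2 : u 2 = 0 := by nlinarith [sq_nonneg (u 0), sq_nonneg (u 1), sq_nonneg (u 2)]
    apply hu0
    ext i
    fin_cases i <;> simp [h0, h1, h2]
  set N := u 0 ^ 2 + u 1 ^ 2 + u 2 ^ 2 with hN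
  -- Symmetry of u cᵀ makes c parallel to u; contracting with u gives the factor, which is the trace
  -- u · c.
  have hcu : ∀ j, N * c j = u j * (-3 * a) := by
    intro j
    rw [← htr, hc 0 0, hc 1 1, hc 2 2]
    have e := fun i => (hc j i).symm.trans ((hsym i j).trans (hc i j))
    linear_combination u 0 * e 0 + u 1 * e 1 + u 2 * e 2
  have hBN : ∀ i j, N * B i j = -3 * a * u i * u j := by
    intro i j
    rw [hc j i]
    linear_combination u i * hcu j
  have ha : a ≠ 0 := by
    rintro rfl
    have : B = 0 := by
      ext i j
      have := hBN i j
      rw [mul_zero, zero_mul, zero_mul] at this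
      exact (mul_eq_zero.1 this).resolve_left hupos.ne'
    have h2 : Module.finrank ℝ (LinearMap.range (Matrix.toLin' (0 : Matrix (Fin 3) (Fin 3) ℝ))) = 1 :=
      this ▸ hr1
    rw [map_zero, LinearMap.range_zero, finrank_bot] at h2
    exact zero_ne_one h2
  refine ⟨ha, fun i => u i / √N, ?_, fun i j => ?_⟩
  · simp only [dotProduct, Fin.sum_univ_three, div_mul_div_comm, Real.mul_self_sqrt hupos.le]
    rw [← add_div, ← add_div, div_eq_one_iff_eq hupos.ne', hN]
    ring
  · have h := hBN i j
    have h2 : w i j = B i j + a * (if i = j then 1 else 0) := by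
      simp [hB, Matrix.one_apply]
    have h3 : u i / √N * (u j / √N) = u i * u j / N := by
      rw [div_mul_div_comm, Real.mul_self_sqrt hupos.le]
    rw [h2, mul_assoc 3, h3]
    field_simp
    linear_combination h

/-! ### Curvature-like tensors -/

/-- The algebraic symmetries of a Riemann tensor. -/
structure IsCurvatureLike (R : Tensor4) : Prop where
  antisymm_left : ∀ i j k l, R j i k l = -R i j k l
  antisymm_right : ∀ i j k l, R i j l k = -R i j k l
  pair_symm : ∀ i j k l, R k l i j = R i j k l
  bianchi : ∀ i j k l, R i j k l + R i k l j + R i l j k = 0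

theorem IsCurvatureLike.pull {R : Tensor4} (h : IsCurvatureLike R) (A : Mat) :
    IsCurvatureLike (pull4 A R) where
  antisymm_left i j k l := by
    have e : swap12 R = -R := by funext i j k l; exact h.antisymm_left i j k l
    have := pull4_swap12 A R
    rw [e, pull4_neg] at this
    exact (congrFun (congrFun (congrFun (congrFun this i) j) k) l).symm
  antisymm_right i j k l := by
    have e : swap34 R = -R := by funext i j k l; exact h.antisymm_right i j k l
    have := pull4_swap34 A R
    rw [e, pull4_neg] at this
    exact (congrFun (congrFun (congrFun (congrFun this i) j) k) l).symm
  pair_symm i j k l := by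
    have e : swapPairs R = R := by funext i j k l; exact h.pair_symm i j k l
    have := pull4_swapPairs A R
    rw [e] at this
    exact (congrFun (congrFun (congrFun (congrFun this i) j) k) l).symm
  bianchi i j k l := by
    have e : R + swap23 (swap34 R) + swap34 (swap23 R) = 0 := by
      funext i j k l; exact h.bianchi i j k l
    have := congrArg (pull4 A) e
    rw [pull4_add, pull4_add, pull4_swap23, pull4_swap34, pull4_swap34, pull4_swap23] at this
    have h0 : pull4 A 0 = 0 := by simpa using pull4_smul A 0 0
    rw [h0] at this
    exact congrFun (congrFun (congrFun (congrFun this i) j) k) l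

theorem ricciOf_one_symm {R : Tensor4} (h : IsCurvatureLike R) (i j : Fin 4) :
    ricciOf 1 R i j = ricciOf 1 R j i := by
  simp only [ricciOf, inv_one, Matrix.of_apply, Matrix.one_apply, ite_mul, one_mul, zero_mul,
    Finset.sum_ite_eq, Finset.mem_univ, if_true]
  exact Finset.sum_congr rfl fun k _ => h.pair_symm k j k i

theorem isCurvatureLike_kn_add_kn {φ ψ : Mat} (hφ : φᵀ = φ) (hψ : ψᵀ = ψ) :
    IsCurvatureLike (kn φ ψ + kn ψ φ) := by
  have a : ∀ i j, φ i j = φ j i := fun i j => congrFun (congrFun hφ j) i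
  have b : ∀ i j, ψ i j = ψ j i := fun i j => congrFun (congrFun hψ j) i
  refine ⟨fun i j k l => ?_, fun i j k l => ?_, fun i j k l => ?_, fun i j k l => ?_⟩ <;>
    simp only [kn, Pi.add_apply]
  · ring
  · ring
  · rw [a k i, b l j, a k j, b l i, a l j, b k i, a l i, b k j]; ring
  · rw [a k j, a l j, a l k, b k j, b l j, b l k]; ring

theorem IsCurvatureLike.add {R S : Tensor4} (hR : IsCurvatureLike R) (hS : IsCurvatureLike S) :
    IsCurvatureLike (R + S) where
  antisymm_left i j k l := by
    simp only [Pi.add_apply]; linarith [hR.antisymm_left i j k l, hS.antisymm_left i j k l]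
  antisymm_right i j k l := by
    simp only [Pi.add_apply]; linarith [hR.antisymm_right i j k l, hS.antisymm_right i j k l]
  pair_symm i j k l := by
    simp only [Pi.add_apply]; linarith [hR.pair_symm i j k l, hS.pair_symm i j k l]
  bianchi i j k l := by
    simp only [Pi.add_apply]; linarith [hR.bianchi i j k l, hS.bianchi i j k l]

theorem IsCurvatureLike.smul {R : Tensor4} (hR : IsCurvatureLike R) (c : ℝ) :
    IsCurvatureLike (c • R) where
  antisymm_left i j k l := by
    simp only [Pi.smul_apply, smul_eq_mul]; rw [hR.antisymm_left i j k l]; ring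
  antisymm_right i j k l := by
    simp only [Pi.smul_apply, smul_eq_mul]; rw [hR.antisymm_right i j k l]; ring
  pair_symm i j k l := by
    simp only [Pi.smul_apply, smul_eq_mul]; rw [hR.pair_symm i j k l]
  bianchi i j k l := by
    simp only [Pi.smul_apply, smul_eq_mul, ← mul_add]; rw [hR.bianchi i j k l, mul_zero]

theorem isCurvatureLike_weylOf_one {R : Tensor4} (h : IsCurvatureLike R) :
    IsCurvatureLike (weylOf 1 R) := by
  have hr : (ricciOf 1 R)ᵀ = ricciOf 1 R := by
    ext i j
    exact ricciOf_one_symm h j i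
  -- The scalar term is split as `kn 1 1 + kn 1 1` so that the lemma on symmetrised products
  -- applies; this turns the 6 into 12.
  have e : weylOf 1 R = R + (-(1 / 2) : ℝ) • (kn 1 (ricciOf 1 R) + kn (ricciOf 1 R) 1)
      + (traceOf 1 (ricciOf 1 R) / 12) • (kn 1 1 + kn 1 1) := by
    rw [weylOf]; module
  rw [e]
  exact (h.add ((isCurvatureLike_kn_add_kn Matrix.transpose_one hr).smul _)).add
    ((isCurvatureLike_kn_add_kn Matrix.transpose_one Matrix.transpose_one).smul _)

/-- Only the complete trace is needed: besides it, the trace of the operator on Λ⁺ involves just the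
contraction with the volume form. -/
theorem trace_weylOf_one (R : Tensor4) : ∑ i, ∑ k, weylOf 1 R i k i k = 0 := by
  have e : ∀ i k, weylOf 1 R i k i k = R i k i k - (1 / 2) * ((ricciOf 1 R) k k
      - 2 * (if i = k then (ricciOf 1 R) i k else 0) + (ricciOf 1 R) i i)
      + traceOf 1 (ricciOf 1 R) / 6 * (1 - if i = k then 1 else 0) := by
    intro i k
    simp only [weylOf, Pi.add_apply, Pi.sub_apply, Pi.smul_apply, smul_eq_mul, kn,
      Matrix.one_apply]
    by_cases hik : i = k
    · subst hik; simp; ring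
    · simp [hik, Ne.symm hik]
  have t : traceOf 1 (ricciOf 1 R) = ∑ i, ricciOf 1 R i i := by
    simp [traceOf, Matrix.one_apply]
  have r : ∑ i, ricciOf 1 R i i = ∑ i, ∑ k, R i k i k := by
    simp only [ricciOf, inv_one, Matrix.of_apply, Matrix.one_apply, ite_mul, one_mul, zero_mul,
      Finset.sum_ite_eq, Finset.mem_univ, if_true]
    exact Finset.sum_comm
  simp only [e, t]
  simp only [Finset.sum_add_distrib, Finset.sum_sub_distrib, ← Finset.mul_sum, ← r,
    Finset.sum_ite_eq, Finset.mem_univ, if_true, Finset.sum_const, Finset.card_univ,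
    Fintype.card_fin, nsmul_eq_mul]
  push_cast
  ring

/-- The matrix of an operator on self-dual two-forms in the standard basis. -/
def etaMatrix (T : Tensor4) : Matrix (Fin 3) (Fin 3) ℝ :=
  Matrix.of fun a b => (1 / 2) * pair 1 (eta a) (twoFormOp 1 T (eta b))

theorem pair_twoFormOp_one (T : Tensor4) (φ ψ : Mat) :
    pair 1 φ (twoFormOp 1 T ψ) = (1 / 4) * (asVec φ ⬝ᵥ (asMat T *ᵥ asVec ψ)) := by
  rw [pair_eq, asVec_twoFormOp, inv_one, Matrix.one_kronecker_one, Matrix.mul_one, Matrix.one_mulVec,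
    dotProduct_smul, smul_eq_mul]
  ring

theorem etaMatrix_symm {T : Tensor4} (h : IsCurvatureLike T) : (etaMatrix T)ᵀ = etaMatrix T := by
  have e : (asMat T)ᵀ = asMat T := by
    ext ⟨i, j⟩ ⟨k, l⟩
    exact h.pair_symm i j k l
  ext a b
  simp only [etaMatrix, Matrix.transpose_apply, Matrix.of_apply, pair_twoFormOp_one]
  rw [← e, Matrix.mulVec_transpose, e, dotProduct_comm, ← Matrix.dotProduct_mulVec]

/-- The projection onto Λ⁺ is half the sum of identity and Hodge star. The trace over Λ⁺ thus
combines the complete trace, zero by hypothesis, with the contraction against the volume form, zero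
by the Bianchi identity. -/
theorem trace_etaMatrix {T : Tensor4} (h : IsCurvatureLike T)
    (ht : ∑ i, ∑ k, T i k i k = 0) : (etaMatrix T).trace = 0 := by
  have d1 : ∀ i k l, T i i k l = 0 := fun i k l => by linarith [h.antisymm_left i i k l]
  simp only [Fin.sum_univ_four, d1] at ht
  simp only [Matrix.trace, Fin.sum_univ_three, Matrix.diag_apply, etaMatrix, Matrix.of_apply,
    pair_twoFormOp_one, dotProduct, Matrix.mulVec, asVec, asMat, Fintype.sum_prod_type,
    Fin.sum_univ_four]
  simp only [eta]
  simp
  have l := h.antisymm_left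
  have r := h.antisymm_right
  have q := h.pair_symm
  simp only [l 0 1, l 0 2, l 0 3, l 1 2, l 1 3, l 2 3, r _ _ 0 1, r _ _ 0 2, r _ _ 0 3, r _ _ 1 2,
    r _ _ 1 3, r _ _ 2 3] at ht ⊢
  linarith [h.bianchi 0 1 2 3, q 0 1 2 3, q 0 2 1 3, q 0 3 1 2, r 0 2 1 3]

end FourGeom

namespace FourGeom

open Matrix Kronecker

/-! ### Oriented orthonormal coframes and the structure of `W⁺` of type D -/

/-- The rows of `F` are an oriented orthonormal coframe for the metric `G`. -/
structure IsCoframe (F G : Mat) (s : ℝ) : Prop where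
  eq : Fᵀ * F = G
  det_ne : F.det ≠ 0
  orient : s * |F.det| = 1 * F.det

open scoped MatrixOrder Matrix.Norms.L2Operator in
theorem exists_eq_transpose_mul_self {G : Mat} (hG : G.PosDef) : ∃ F : Mat, Fᵀ * F = G := by
  obtain ⟨B, hB⟩ := CStarAlgebra.nonneg_iff_eq_star_mul_self.mp hG.posSemidef.nonneg
  exact ⟨B, by rw [hB]; rfl⟩

theorem exists_isCoframe {G : Mat} (hG : G.PosDef) {s : ℝ} (hs : s = 1 ∨ s = -1) :
    ∃ F, IsCoframe F G s := by
  obtain ⟨F, hF⟩ := exists_eq_transpose_mul_self hG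
  have hd : F.det ≠ 0 := by
    intro h
    have := hG.det_pos
    rw [← hF, Matrix.det_mul, h, mul_zero] at this
    exact lt_irrefl _ this
  by_cases h : s * |F.det| = 1 * F.det
  · exact ⟨F, hF, hd, h⟩
  -- Reflecting the first covector corrects the orientation and keeps the coframe orthonormal.
  · set D : Mat := Matrix.diagonal ![-1, 1, 1, 1] with hD
    have hDD : Dᵀ * D = 1 := by
      rw [hD, Matrix.diagonal_transpose, Matrix.diagonal_mul_diagonal, ← Matrix.diagonal_one]
      congr 1
      funext i
      fin_cases i <;> simp
    have hDd : D.det = -1 := by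
      rw [hD, Matrix.det_diagonal]
      simp [Fin.prod_univ_four]
    refine ⟨D * F, ?_, ?_, ?_⟩
    · rw [Matrix.transpose_mul, Matrix.mul_assoc, ← Matrix.mul_assoc Dᵀ, hDD, Matrix.one_mul, hF]
    · rw [Matrix.det_mul, hDd]; simpa using hd
    · rw [Matrix.det_mul, hDd, neg_one_mul, abs_neg]
      rcases abs_choice F.det with h' | h' <;> rcases hs with rfl | rfl <;> rw [h'] at h ⊢ <;>
        simp at h ⊢

/-- The self-dual two-forms of a coframe. -/
def frameForm (F : Mat) (a : Fin 3) : Mat := Fᵀ * eta a * F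

variable {F G : Mat} {s : ℝ}

theorem IsCoframe.one_pull (hF : IsCoframe F G s) : Fᵀ * 1 * F = G := by
  rw [Matrix.mul_one, hF.eq]

theorem IsCoframe.pair_frameForm (hF : IsCoframe F G s) (a b : Fin 3) :
    pair G (frameForm F a) (frameForm F b) = if a = b then 2 else 0 := by
  rw [← hF.one_pull, frameForm, frameForm, pair_pull F 1 hF.det_ne, pair_eta]

theorem pull4_sum {ι : Type*} (s : Finset ι) (A : Mat) (T : ι → Tensor4) :
    pull4 A (∑ a ∈ s, T a) = ∑ a ∈ s, pull4 A (T a) := by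
  classical
  induction s using Finset.induction_on with
  | empty => simpa using pull4_smul A 0 0
  | insert a s ha ih => rw [Finset.sum_insert ha, Finset.sum_insert ha, pull4_add, ih]

theorem IsCoframe.selfDualProj_eq (hF : IsCoframe F G s) :
    selfDualProj G s = (1 / 2 : ℝ) • ∑ a, tens (frameForm F a) (frameForm F a) := by
  rw [← hF.one_pull, selfDualProj_pull F 1 1 s hF.orient, selfDualProj_one, pull4_smul, pull4_sum]
  simp only [pull4_tens, frameForm]

theorem IsCoframe.frameForm_mem (hF : IsCoframe F G s) (a : Fin 3) :
    frameForm F a ∈ selfDual G s := by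
  rw [← hF.one_pull]
  exact mem_selfDual_pull F 1 1 s hF.det_ne hF.orient (eta_mem_selfDual a)

theorem IsCoframe.exists_eq_sum (hF : IsCoframe F G s) {φ : Mat} (hφ : φ ∈ selfDual G s) :
    ∃ v : Fin 3 → ℝ, φ = ∑ a, v a • frameForm F a := by
  have hu : IsUnit F.det := isUnit_iff_ne_zero.2 hF.det_ne
  have hu' : IsUnit Fᵀ.det := by rwa [Matrix.det_transpose]
  have hd : F⁻¹.det ≠ 0 := by
    rw [Matrix.det_nonsing_inv, Ring.inverse_eq_inv']
    exact inv_ne_zero hF.det_ne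
  have hg : F⁻¹ᵀ * G * F⁻¹ = 1 := by
    rw [← hF.eq, Matrix.mul_assoc, Matrix.mul_assoc, Matrix.mul_nonsing_inv _ hu, Matrix.mul_one,
      ← Matrix.transpose_mul, Matrix.mul_nonsing_inv _ hu, Matrix.transpose_one]
  have ho : 1 * |F⁻¹.det| = s * F⁻¹.det := by
    have h1 : F⁻¹.det = (F.det)⁻¹ := by rw [Matrix.det_nonsing_inv, Ring.inverse_eq_inv']
    have h2 := hF.orient
    have h3 : |F.det| ≠ 0 := abs_ne_zero.2 hF.det_ne
    have h4 := abs_mul_abs_self F.det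
    rw [h1, abs_inv]
    have h5 := hF.det_ne
    field_simp
    nlinarith
  have := mem_selfDual_pull F⁻¹ G s 1 hd ho hφ
  rw [hg] at this
  obtain ⟨v, hv⟩ := exists_eq_sum_eta this
  refine ⟨v, ?_⟩
  have e : φ = Fᵀ * (F⁻¹ᵀ * φ * F⁻¹) * F := by
    rw [Matrix.mul_assoc, Matrix.mul_assoc, Matrix.nonsing_inv_mul _ hu, Matrix.mul_one,
      ← Matrix.mul_assoc, ← Matrix.transpose_mul, Matrix.nonsing_inv_mul _ hu,
      Matrix.transpose_one, Matrix.one_mul]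
  rw [e, hv]
  simp only [frameForm, Matrix.mul_sum, Matrix.sum_mul, Matrix.mul_smul, Matrix.smul_mul]

theorem weylPlusOf_one (R : Tensor4) : weylPlusOf 1 1 R =
    (1 / 2 : ℝ) • ∑ a, ∑ b, etaMatrix (weylOf 1 R) a b • tens (eta a) (eta b) := by
  rw [weylPlusOf, selfDualProj_one]
  simp only [compTwo_smul_left, compTwo_smul_right, compTwo_sum_left, compTwo_sum_right,
    compTwo_sandwich, etaMatrix, Matrix.of_apply, Finset.smul_sum, smul_smul]
  rw [Finset.sum_comm]

/-- The curvature is moved to the Euclidean frame by the inverse of F, where the Λ⁺-block is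
explicit, and the result is moved back by covariance. -/
theorem IsCoframe.exists_weylPlusOf_eq (hF : IsCoframe F G s) {R : Tensor4}
    (hR : IsCurvatureLike R) : ∃ w : Matrix (Fin 3) (Fin 3) ℝ, wᵀ = w ∧ w.trace = 0 ∧
      weylPlusOf G s R =
        (1 / 2 : ℝ) • ∑ a, ∑ b, w a b • tens (frameForm F a) (frameForm F b) := by
  have hu : IsUnit F.det := isUnit_iff_ne_zero.2 hF.det_ne
  have hR' := hR.pull F⁻¹
  have hW := isCurvatureLike_weylOf_one hR'
  have e : R = pull4 F (pull4 F⁻¹ R) := by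
    rw [← pull4_mul, Matrix.nonsing_inv_mul _ hu, pull4_one]
  refine ⟨etaMatrix (weylOf 1 (pull4 F⁻¹ R)), etaMatrix_symm hW,
    trace_etaMatrix hW (trace_weylOf_one _), ?_⟩
  conv_lhs => rw [e, ← hF.one_pull]
  rw [weylPlusOf_pull F 1 1 s hF.det_ne hF.orient, weylPlusOf_one]
  simp only [pull4_smul, pull4_sum, pull4_tens, frameForm]

/-- The linear combination of the self-dual forms of a coframe. -/
def frameComb (F : Mat) : (Fin 3 → ℝ) →ₗ[ℝ] Mat := Fintype.linearCombination ℝ (frameForm F)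

theorem frameComb_apply (F : Mat) (v : Fin 3 → ℝ) :
    frameComb F v = ∑ a, v a • frameForm F a := rfl

theorem IsCoframe.pair_frameComb_right (hF : IsCoframe F G s) (a : Fin 3) (v : Fin 3 → ℝ) :
    pair G (frameForm F a) (frameComb F v) = 2 * v a := by
  rw [frameComb_apply, pair_sum_right]
  simp only [pair_smul_right, hF.pair_frameForm]
  simp [mul_comm]

theorem IsCoframe.frameComb_injective (hF : IsCoframe F G s) :
    Function.Injective (frameComb F) := by
  intro v w h
  funext a
  have h1 := hF.pair_frameComb_right a v
  rw [h, hF.pair_frameComb_right] at h1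
  linarith

theorem IsCoframe.twoFormOp_frameComb (hF : IsCoframe F G s) (w : Matrix (Fin 3) (Fin 3) ℝ)
    (v : Fin 3 → ℝ) :
    twoFormOp G ((1 / 2 : ℝ) • ∑ a, ∑ b, w a b • tens (frameForm F a) (frameForm F b))
      (frameComb F v) = frameComb F (w *ᵥ v) := by
  simp only [twoFormOp_smul, twoFormOp_sum, LinearMap.smul_apply, LinearMap.sum_apply,
    twoFormOp_tens, hF.pair_frameComb_right, frameComb_apply F (w *ᵥ v), Matrix.mulVec, dotProduct,
    Finset.smul_sum, Finset.sum_smul, smul_smul]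
  refine Finset.sum_congr rfl fun _ _ => Finset.sum_congr rfl fun _ _ => ?_
  congr 1
  ring

theorem IsCoframe.frameComb_mem (hF : IsCoframe F G s) (v : Fin 3 → ℝ) :
    frameComb F v ∈ selfDual G s := by
  rw [frameComb_apply]
  exact Submodule.sum_mem _ fun a _ => Submodule.smul_mem _ _ (hF.frameForm_mem a)

/-- `frameComb` identifies ℝ³ with Λ⁺ and intertwines w with the operator, so the multiplicity
assumed on Λ⁺ becomes the dimension of the kernel of a 3 × 3 matrix. -/
theorem IsCoframe.map_ker_eq (hF : IsCoframe F G s) (w : Matrix (Fin 3) (Fin 3) ℝ) (α : ℝ) :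
    selfDual G s ⊓ Module.End.eigenspace (twoFormOp G
      ((1 / 2 : ℝ) • ∑ a, ∑ b, w a b • tens (frameForm F a) (frameForm F b))) α =
    (LinearMap.ker (Matrix.toLin' (w - α • (1 : Matrix (Fin 3) (Fin 3) ℝ)))).map
      (frameComb F) := by
  ext φ
  rw [Submodule.mem_inf, Module.End.mem_eigenspace_iff, Submodule.mem_map]
  have key : ∀ v, (w - α • (1 : Matrix (Fin 3) (Fin 3) ℝ)) *ᵥ v = 0 ↔ w *ᵥ v = α • v := by
    intro v
    rw [Matrix.sub_mulVec, Matrix.smul_mulVec, Matrix.one_mulVec, sub_eq_zero]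
  constructor
  · rintro ⟨h1, h2⟩
    obtain ⟨v, rfl⟩ := hF.exists_eq_sum h1
    refine ⟨v, ?_, rfl⟩
    rw [LinearMap.mem_ker, Matrix.toLin'_apply, key]
    rw [← frameComb_apply, hF.twoFormOp_frameComb, ← map_smul] at h2
    exact hF.frameComb_injective h2
  · rintro ⟨v, hv, rfl⟩
    rw [LinearMap.mem_ker, Matrix.toLin'_apply, key] at hv
    exact ⟨hF.frameComb_mem v, by rw [hF.twoFormOp_frameComb, hv, map_smul]⟩

/-- `W⁺` of type D in terms of a self-dual form of norm `√2`. -/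
theorem IsCoframe.structure_of_finrank (hF : IsCoframe F G s) {R : Tensor4}
    (hR : IsCurvatureLike R) {α : ℝ}
    (h2 : Module.finrank ℝ ↥(selfDual G s ⊓
      Module.End.eigenspace (twoFormOp G (weylPlusOf G s R)) α) = 2) :
    α ≠ 0 ∧ ∃ n : Fin 3 → ℝ, n ⬝ᵥ n = 1 ∧ weylPlusOf G s R =
      α • selfDualProj G s - (3 * α / 2) • tens (frameComb F n) (frameComb F n) := by
  obtain ⟨w, hw, ht, he⟩ := hF.exists_weylPlusOf_eq hR
  rw [he, hF.map_ker_eq w α,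
    ← (Submodule.equivMapOfInjective _ hF.frameComb_injective _).finrank_eq] at h2
  obtain ⟨hα, n, hn, hwn⟩ := eq_of_double_eigenvalue hw ht h2
  refine ⟨hα, n, hn, ?_⟩
  rw [he, hF.selfDualProj_eq]
  funext i j k l
  simp only [frameComb_apply, hwn, Fin.sum_univ_three, Pi.sub_apply, Pi.smul_apply, Pi.add_apply,
    tens, Matrix.add_apply, Matrix.smul_apply, smul_eq_mul]
  simp
  ring

theorem IsCoframe.pair_frameComb (hF : IsCoframe F G s) (v w : Fin 3 → ℝ) :
    pair G (frameComb F v) (frameComb F w) = 2 * (v ⬝ᵥ w) := by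
  have h : ∀ φ, pair G (frameComb F v) φ = ∑ a, v a * pair G (frameForm F a) φ := by
    intro φ
    rw [frameComb_apply]
    simp only [pair, Matrix.sum_apply, Matrix.smul_apply, smul_eq_mul, Fin.sum_univ_three, mul_add,
      add_mul, Finset.sum_add_distrib, Finset.mul_sum]
    congr 1
    · congr 1 <;>
      · refine Finset.sum_congr rfl fun _ _ => Finset.sum_congr rfl fun _ _ =>
          Finset.sum_congr rfl fun _ _ => Finset.sum_congr rfl fun _ _ => ?_
        ring
    · refine Finset.sum_congr rfl fun _ _ => Finset.sum_congr rfl fun _ _ =>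
        Finset.sum_congr rfl fun _ _ => Finset.sum_congr rfl fun _ _ => ?_
      ring
  rw [h]
  simp only [hF.pair_frameComb_right, dotProduct, Finset.mul_sum]
  refine Finset.sum_congr rfl fun _ _ => ?_
  ring

theorem exists_unit_orthogonal (n : Fin 3 → ℝ) :
    ∃ m : Fin 3 → ℝ, m ⬝ᵥ m = 1 ∧ n ⬝ᵥ m = 0 := by
  simp only [dotProduct, Fin.sum_univ_three]
  by_cases h : n 0 ^ 2 + n 1 ^ 2 = 0
  · have h0 : n 0 = 0 := by nlinarith [sq_nonneg (n 0), sq_nonneg (n 1)]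
    exact ⟨![1, 0, 0], by simp, by simp [h0]⟩
  · have hp : 0 < n 0 ^ 2 + n 1 ^ 2 := lt_of_le_of_ne (by positivity) (Ne.symm h)
    refine ⟨![-n 1 / √(n 0 ^ 2 + n 1 ^ 2), n 0 / √(n 0 ^ 2 + n 1 ^ 2), 0], ?_, ?_⟩
    · simp only [Matrix.cons_val_zero, Matrix.cons_val_one, Matrix.cons_val, div_mul_div_comm,
        Real.mul_self_sqrt hp.le]
      field_simp
      ring
    · simp
      ring

/-- A unit combination of the forms of a coframe is the first form of another coframe. -/
theorem IsCoframe.exists_adapted (hF : IsCoframe F G s) {n : Fin 3 → ℝ} (hn : n ⬝ᵥ n = 1) :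
    ∃ F', IsCoframe F' G s ∧ frameComb F n = frameForm F' 0 := by
  obtain ⟨m, hm, hnm⟩ := exists_unit_orthogonal n
  simp only [dotProduct, Fin.sum_univ_three] at hn hm hnm
  -- A rotation fixing e⁰, whose other rows are n, m and n × m. Since each standard form contains
  -- one e⁰ᵃ with coefficient one, a rotation of the last three axes acts on the triple by the same
  -- rotation.
  set Q : Mat := !![1, 0, 0, 0; 0, n 0, n 1, n 2; 0, m 0, m 1, m 2;
    0, n 1 * m 2 - n 2 * m 1, n 2 * m 0 - n 0 * m 2, n 0 * m 1 - n 1 * m 0] with hQ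
  -- Lagrange's identity for |n × m|².
  have hll : (n 1 * m 2 - n 2 * m 1) ^ 2 + (n 2 * m 0 - n 0 * m 2) ^ 2 +
      (n 0 * m 1 - n 1 * m 0) ^ 2 = 1 := by
    linear_combination (m 0 * m 0 + m 1 * m 1 + m 2 * m 2) * hn + hm -
      (n 0 * m 0 + n 1 * m 1 + n 2 * m 2) * hnm
  have hQQ : Q * Qᵀ = 1 := by
    ext i j
    fin_cases i <;> fin_cases j <;>
      simp [hQ, Matrix.mul_apply, Fin.sum_univ_four] <;>
      first
        | linear_combination hn
        | linear_combination hm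
        | linear_combination hnm
        | linear_combination hll
        | ring1
  have hQd : Q.det = 1 := by
    have : Q.det = (n 1 * m 2 - n 2 * m 1) ^ 2 + (n 2 * m 0 - n 0 * m 2) ^ 2 +
      (n 0 * m 1 - n 1 * m 0) ^ 2 := by
      simp [hQ, Matrix.det_succ_row_zero (n := 3), Matrix.det_fin_three, Fin.sum_univ_four,
        Fin.succAbove, Matrix.submatrix_apply]
      ring
    rw [this, hll]
  have hQ' : Qᵀ * Q = 1 := mul_eq_one_comm.1 hQQ
  have hη : Qᵀ * eta 0 * Q = ∑ a, n a • eta a := by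
    ext i j
    rw [Fin.sum_univ_three]
    fin_cases i <;> fin_cases j <;>
      simp [hQ, eta, Matrix.mul_apply, Fin.sum_univ_four] <;>
      first
        | ring1
        | linear_combination n 0 * hm - m 0 * hnm
        | linear_combination n 1 * hm - m 1 * hnm
        | linear_combination n 2 * hm - m 2 * hnm
        | linear_combination -n 0 * hm + m 0 * hnm
        | linear_combination -n 1 * hm + m 1 * hnm
        | linear_combination -n 2 * hm + m 2 * hnm
  refine ⟨Q * F, ⟨?_, ?_, ?_⟩, ?_⟩
  · rw [Matrix.transpose_mul, Matrix.mul_assoc, ← Matrix.mul_assoc Qᵀ, hQ', Matrix.one_mul, hF.eq]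
  · rw [Matrix.det_mul, hQd, one_mul]; exact hF.det_ne
  · rw [Matrix.det_mul, hQd, one_mul]; exact hF.orient
  · rw [frameForm, Matrix.transpose_mul, show Fᵀ * Qᵀ * eta 0 * (Q * F) = Fᵀ * (Qᵀ * eta 0 * Q) * F
      by simp only [Matrix.mul_assoc], hη, frameComb_apply]
    simp only [frameForm, Matrix.mul_sum, Matrix.sum_mul, Matrix.mul_smul, Matrix.smul_mul]

/-- At a point where `W⁺` is of type D, the simple eigenform and the structure of `W⁺`. -/
theorem exists_simple_eigenform (hG : G.PosDef) (hs : s = 1 ∨ s = -1) {R : Tensor4}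
    (hR : IsCurvatureLike R) {α : ℝ}
    (h2 : Module.finrank ℝ ↥(selfDual G s ⊓
      Module.End.eigenspace (twoFormOp G (weylPlusOf G s R)) α) = 2) :
    α ≠ 0 ∧ ∃ F, IsCoframe F G s ∧ weylPlusOf G s R = α • selfDualProj G s -
      (3 * α / 2) • tens (frameForm F 0) (frameForm F 0) := by
  obtain ⟨F, hF⟩ := exists_isCoframe hG hs
  obtain ⟨hα, n, hn, he⟩ := hF.structure_of_finrank hR h2
  obtain ⟨F', hF', hn'⟩ := hF.exists_adapted hn
  exact ⟨hα, F', hF', by rw [he, hn']⟩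

theorem IsCoframe.twoFormOp_typeD (hF : IsCoframe F G s) (α : ℝ) (v : Fin 3 → ℝ) :
    twoFormOp G (α • selfDualProj G s - (3 * α / 2) • tens (frameForm F 0) (frameForm F 0))
      (frameComb F v) = α • frameComb F v - (3 * α * v 0) • frameForm F 0 := by
  have h1 : twoFormOp G (selfDualProj G s) (frameComb F v) = frameComb F v := by
    rw [hF.selfDualProj_eq, twoFormOp_smul, twoFormOp_sum, LinearMap.smul_apply,
      LinearMap.sum_apply, frameComb_apply, Finset.smul_sum]
    refine Finset.sum_congr rfl fun a _ => ?_
    rw [← frameComb_apply, twoFormOp_tens, hF.pair_frameComb_right, smul_smul]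
    congr 1
    ring
  rw [twoFormOp_sub, twoFormOp_smul, twoFormOp_smul, LinearMap.sub_apply, LinearMap.smul_apply,
    LinearMap.smul_apply, h1, twoFormOp_tens, hF.pair_frameComb_right, smul_smul]
  congr 2
  ring

theorem frameComb_single (F : Mat) : frameComb F ![1, 0, 0] = frameForm F 0 := by
  rw [frameComb_apply, Fin.sum_univ_three]
  simp

theorem IsCoframe.frameForm_zero_mem_eigenspace (hF : IsCoframe F G s) (α : ℝ) :
    twoFormOp G (α • selfDualProj G s - (3 * α / 2) • tens (frameForm F 0) (frameForm F 0))
      (frameForm F 0) = (-2 * α) • frameForm F 0 := by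
  have h := hF.twoFormOp_typeD α ![1, 0, 0]
  rw [frameComb_single] at h
  rw [h, ← sub_smul]
  congr 1
  simp
  ring

/-- A normalised eigenform for the simple eigenvalue is, in an adapted coframe, the first
standard self-dual form, and determines `W⁺`. -/
theorem exists_adapted_coframe (hG : G.PosDef) (hs : s = 1 ∨ s = -1) {R : Tensor4}
    (hR : IsCurvatureLike R) {α : ℝ}
    (h2 : Module.finrank ℝ ↥(selfDual G s ⊓
      Module.End.eigenspace (twoFormOp G (weylPlusOf G s R)) α) = 2)
    {S : Mat} (hS : S ∈ selfDual G s)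
    (hSe : twoFormOp G (weylPlusOf G s R) S = (-2 * α) • S) (hSn : pair G S S = 2) :
    ∃ F, IsCoframe F G s ∧ S = frameForm F 0 ∧
      weylPlusOf G s R = α • selfDualProj G s - (3 * α / 2) • tens S S := by
  obtain ⟨hα, F, hF, he⟩ := exists_simple_eigenform hG hs hR h2
  obtain ⟨v, rfl⟩ := hF.exists_eq_sum hS
  rw [← frameComb_apply] at hSe hSn ⊢
  rw [hF.pair_frameComb] at hSn
  have hv : v ⬝ᵥ v = 1 := by linarith
  -- In components the eigenvalue equation is αv − 3αv₀e₀ = −2αv, so v₁ and v₂ vanish and v = ±e₀.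
  rw [he, hF.twoFormOp_typeD, ← frameComb_single, ← map_smul, ← map_smul, ← map_smul,
    ← map_sub] at hSe
  have hc := congrFun (hF.frameComb_injective hSe)
  have h1 := hc 1
  have h2 := hc 2
  simp at h1 h2
  have h1' : v 1 = 0 := by
    have : 3 * α * v 1 = 0 := by linarith
    simpa [hα] using this
  have h2' : v 2 = 0 := by
    have : 3 * α * v 2 = 0 := by linarith
    simpa [hα] using this
  have h0 : v 0 * v 0 = 1 := by
    simpa [dotProduct, Fin.sum_univ_three, h1', h2'] using hv
  -- A second rotation absorbs the sign, so that S itself is the first form of the new coframe; the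
  -- normal form is quadratic in S and unaffected.
  obtain ⟨F', hF', hv'⟩ := hF.exists_adapted hv
  refine ⟨F', hF', hv', ?_⟩
  have hvs : frameComb F v = v 0 • frameForm F 0 := by
    rw [frameComb_apply, Fin.sum_univ_three, h1', h2', zero_smul, zero_smul, add_zero, add_zero]
  have ht : tens (frameComb F v) (frameComb F v) = tens (frameForm F 0) (frameForm F 0) := by
    rw [hvs]
    funext i j k l
    simp only [tens, Matrix.smul_apply, smul_eq_mul]
    linear_combination (frameForm F 0 i j * frameForm F 0 k l) * h0
  rw [he, ht]

end FourGeom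

/-! ### Calculus of scalar and matrix-valued functions of the coordinates -/

namespace FourGeom

open Matrix Filter Topology

/-! ### Partial derivatives -/

section Pd

variable {f h : R4 → ℝ} {z : R4} (i j : Fin 4)

theorem pd_congr {f h : R4 → ℝ} {z : R4} (i : Fin 4) (e : f =ᶠ[𝓝 z] h) : pd i f z = pd i h z := by
  rw [pd, pd, e.fderiv_eq]

theorem pd_add (hf : DifferentiableAt ℝ f z) (hh : DifferentiableAt ℝ h z) :
    pd i (fun y => f y + h y) z = pd i f z + pd i h z := by
  rw [pd, fderiv_fun_add hf hh]; rfl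

theorem pd_sub (hf : DifferentiableAt ℝ f z) (hh : DifferentiableAt ℝ h z) :
    pd i (fun y => f y - h y) z = pd i f z - pd i h z := by
  rw [pd, fderiv_fun_sub hf hh]; rfl

theorem pd_neg : pd i (fun y => -f y) z = -pd i f z := by
  rw [pd, fderiv_fun_neg]; rfl

theorem pd_mul (hf : DifferentiableAt ℝ f z) (hh : DifferentiableAt ℝ h z) :
    pd i (fun y => f y * h y) z = f z * pd i h z + pd i f z * h z := by
  rw [pd, fderiv_fun_mul hf hh]
  simp [pd, mul_comm]

theorem pd_const (c : ℝ) : pd i (fun _ => c) z = 0 := by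
  simp [pd]

theorem pd_const_mul (hf : DifferentiableAt ℝ f z) (c : ℝ) :
    pd i (fun y => c * f y) z = c * pd i f z := by
  rw [pd_mul i (differentiableAt_const c) hf, pd_const, zero_mul, add_zero]

theorem pd_sum {ι : Type*} (s : Finset ι) {F : ι → R4 → ℝ}
    (hF : ∀ a, DifferentiableAt ℝ (F a) z) :
    pd i (fun y => ∑ a ∈ s, F a y) z = ∑ a ∈ s, pd i (F a) z := by
  rw [pd, fderiv_fun_sum fun a _ => hF a]
  simp [pd]

theorem pd_real_comp {u : ℝ → ℝ} {u' : ℝ} (hu : HasDerivAt u u' (f z))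
    (hf : DifferentiableAt ℝ f z) : pd i (fun y => u (f y)) z = u' * pd i f z := by
  have := (hu.comp_hasFDerivAt z hf.hasFDerivAt).fderiv
  rw [pd, show (fun y => u (f y)) = u ∘ f from rfl, this]
  simp [pd]

variable {V : Set R4}

theorem contDiffOn_pd (hV : IsOpen V) (hf : ContDiffOn ℝ ∞ f V) : ContDiffOn ℝ ∞ (pd i f) V :=
  (hf.fderiv_of_isOpen hV (by simp)).clm_apply contDiffOn_const

theorem differentiableAt_of_contDiffOn (hV : IsOpen V) (hf : ContDiffOn ℝ ∞ f V) (hz : z ∈ V) :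
    DifferentiableAt ℝ f z :=
  (hf.contDiffAt (hV.mem_nhds hz)).differentiableAt (by simp)

theorem pd_comm (hV : IsOpen V) (hf : ContDiffOn ℝ ∞ f V) (hz : z ∈ V) :
    pd i (pd j f) z = pd j (pd i f) z := by
  have hc := hf.contDiffAt (hV.mem_nhds hz)
  have hd : DifferentiableAt ℝ (fderiv ℝ f) z :=
    (hc.fderiv_right (m := 1) (by norm_cast)).differentiableAt (by simp)
  have hs := (hc.isSymmSndFDerivAt (by
    rw [minSmoothness_of_isRCLikeNormedField]; norm_cast))
  have e : ∀ i j : Fin 4, pd i (pd j f) z = fderiv ℝ (fderiv ℝ f) z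
      (EuclideanSpace.single i (1 : ℝ)) (EuclideanSpace.single j (1 : ℝ)) := by
    intro i j
    rw [pd, show pd j f = fun y => fderiv ℝ f y (EuclideanSpace.single j (1 : ℝ)) from rfl,
      fderiv_clm_apply hd (differentiableAt_const _)]
    simp
  rw [e, e, hs.eq]

end Pd

/-! ### Matrix-valued functions -/

/-- The entrywise partial derivative of a matrix-valued function. -/
def mpd (i : Fin 4) (A : R4 → Mat) (z : R4) : Mat :=
  Matrix.of fun a b => pd i (fun y => A y a b) z

/-- Entrywise, so that no norm on matrices has to be chosen. -/
def MatDiffAt (A : R4 → Mat) (z : R4) : Prop := ∀ a b, DifferentiableAt ℝ (fun y => A y a b) z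

def MatSmoothOn (A : R4 → Mat) (V : Set R4) : Prop := ∀ a b, ContDiffOn ℝ ∞ (fun y => A y a b) V

section Mpd

variable {A B : R4 → Mat} {z : R4} {V : Set R4} (i j : Fin 4)

theorem mpd_congr (e : A =ᶠ[𝓝 z] B) : mpd i A z = mpd i B z := by
  ext a b
  exact pd_congr i (e.mono fun y hy => congrFun (congrFun hy a) b)

theorem mpd_add (hA : MatDiffAt A z) (hB : MatDiffAt B z) :
    mpd i (fun y => A y + B y) z = mpd i A z + mpd i B z := by
  ext a b
  exact pd_add i (hA a b) (hB a b)

theorem mpd_const (M : Mat) : mpd i (fun _ => M) z = 0 := by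
  ext a b
  exact pd_const i _

theorem mpd_transpose : mpd i (fun y => (A y)ᵀ) z = (mpd i A z)ᵀ := rfl

theorem mpd_mul (hA : MatDiffAt A z) (hB : MatDiffAt B z) :
    mpd i (fun y => A y * B y) z = A z * mpd i B z + mpd i A z * B z := by
  ext a b
  simp only [mpd, Matrix.of_apply, Matrix.mul_apply, Matrix.add_apply]
  rw [pd_sum i _ fun c => (hA a c).fun_mul (hB c b), ← Finset.sum_add_distrib]
  exact Finset.sum_congr rfl fun c _ => pd_mul i (hA a c) (hB c b)

theorem MatDiffAt.mul (hA : MatDiffAt A z) (hB : MatDiffAt B z) : MatDiffAt (fun y => A y * B y) z := by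
  intro a b
  simp only [Matrix.mul_apply]
  exact DifferentiableAt.fun_sum fun c _ => (hA a c).mul (hB c b)

theorem MatDiffAt.transpose (hA : MatDiffAt A z) : MatDiffAt (fun y => (A y)ᵀ) z := fun a b => hA b a

theorem MatSmoothOn.matDiffAt (hA : MatSmoothOn A V) (hV : IsOpen V) (hz : z ∈ V) : MatDiffAt A z :=
  fun a b => differentiableAt_of_contDiffOn hV (hA a b) hz

theorem MatSmoothOn.mul (hA : MatSmoothOn A V) (hB : MatSmoothOn B V) :
    MatSmoothOn (fun y => A y * B y) V := by
  intro a b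
  simp only [Matrix.mul_apply]
  exact ContDiffOn.sum fun c _ => (hA a c).mul (hB c b)

theorem MatSmoothOn.transpose (hA : MatSmoothOn A V) : MatSmoothOn (fun y => (A y)ᵀ) V :=
  fun a b => hA b a

theorem MatSmoothOn.mpd (hA : MatSmoothOn A V) (hV : IsOpen V) : MatSmoothOn (mpd i A) V :=
  fun a b => contDiffOn_pd i hV (hA a b)

theorem mpd_comm (hV : IsOpen V) (hA : MatSmoothOn A V) (hz : z ∈ V) :
    mpd i (mpd j A) z = mpd j (mpd i A) z := by
  ext a b
  exact pd_comm i j hV (hA a b) hz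

theorem contDiffOn_det {n : ℕ} {A : R4 → Matrix (Fin n) (Fin n) ℝ}
    (hA : ∀ a b, ContDiffOn ℝ ∞ (fun y => A y a b) V) : ContDiffOn ℝ ∞ (fun y => (A y).det) V := by
  simp only [Matrix.det_apply']
  exact ContDiffOn.sum fun σ _ => contDiffOn_const.mul (contDiffOn_prod fun c _ => hA _ _)

/-- By Cramer's rule the entries of the inverse are quotients of determinants with smooth entries.
-/
theorem MatSmoothOn.inv (hA : MatSmoothOn A V) (h : ∀ y ∈ V, (A y).det ≠ 0) :
    MatSmoothOn (fun y => (A y)⁻¹) V := by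
  intro a b
  have e : ∀ y, (A y)⁻¹ a b = ((A y).det)⁻¹ * ((A y).updateRow b (Pi.single a 1)).det := by
    intro y
    rw [Matrix.inv_def, Ring.inverse_eq_inv', Matrix.smul_apply, smul_eq_mul,
      Matrix.adjugate_apply]
  simp only [e]
  refine ((contDiffOn_det hA).inv h).mul (contDiffOn_det fun c d => ?_)
  by_cases hc : c = b
  · subst hc
    simpa using contDiffOn_const
  · simpa [Matrix.updateRow_ne hc] using hA c d

theorem det_fin_four (M : Mat) : M.det =
    M 0 0 * (M 1 1 * M 2 2 * M 3 3 - M 1 1 * M 2 3 * M 3 2 - M 1 2 * M 2 1 * M 3 3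
      + M 1 2 * M 2 3 * M 3 1 + M 1 3 * M 2 1 * M 3 2 - M 1 3 * M 2 2 * M 3 1)
    - M 0 1 * (M 1 0 * M 2 2 * M 3 3 - M 1 0 * M 2 3 * M 3 2 - M 1 2 * M 2 0 * M 3 3
      + M 1 2 * M 2 3 * M 3 0 + M 1 3 * M 2 0 * M 3 2 - M 1 3 * M 2 2 * M 3 0)
    + M 0 2 * (M 1 0 * M 2 1 * M 3 3 - M 1 0 * M 2 3 * M 3 1 - M 1 1 * M 2 0 * M 3 3
      + M 1 1 * M 2 3 * M 3 0 + M 1 3 * M 2 0 * M 3 1 - M 1 3 * M 2 1 * M 3 0)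
    - M 0 3 * (M 1 0 * M 2 1 * M 3 2 - M 1 0 * M 2 2 * M 3 1 - M 1 1 * M 2 0 * M 3 2
      + M 1 1 * M 2 2 * M 3 0 + M 1 2 * M 2 0 * M 3 1 - M 1 2 * M 2 1 * M 3 0) := by
  simp [Matrix.det_succ_row_zero (n := 3), Matrix.det_fin_three, Fin.sum_univ_four,
    Matrix.submatrix_apply, Fin.succAbove]
  ring

theorem pd_det_of_eq_one (hA : MatDiffAt A z) (h1 : A z = 1) :
    pd i (fun y => (A y).det) z = (mpd i A z).trace := by
  have d : ∀ a b, DifferentiableAt ℝ (fun y => A y a b) z := hA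
  simp only [det_fin_four, Matrix.trace, Fin.sum_univ_four, Matrix.diag_apply, mpd,
    Matrix.of_apply, pd]
  simp (disch := fun_prop) only [fderiv_fun_add, fderiv_fun_sub, fderiv_fun_mul]
  simp [h1]
  ring

theorem MatDiffAt.det (hA : MatDiffAt A z) : DifferentiableAt ℝ (fun y => (A y).det) z := by
  have d : ∀ a b, DifferentiableAt ℝ (fun y => A y a b) z := hA
  simp only [det_fin_four]
  fun_prop

theorem pd_det (hA : MatDiffAt A z) (h : (A z).det ≠ 0) :
    pd i (fun y => (A y).det) z = (A z).det * ((A z)⁻¹ * mpd i A z).trace := by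
  have hc : MatDiffAt (fun _ => (A z)⁻¹) z := fun a b => differentiableAt_const _
  have hu : IsUnit (A z).det := isUnit_iff_ne_zero.2 h
  -- Multiplying by the constant matrix A(z)⁻¹ reduces Jacobi's formula to the case A(z) = 1, where
  -- the derivative is the trace.
  have e : (fun y => (A y).det) = fun y => (A z).det * ((A z)⁻¹ * A y).det := by
    funext y
    rw [Matrix.det_mul, Matrix.det_nonsing_inv, Ring.inverse_eq_inv', mul_inv_cancel_left₀ h]
  have h1 := pd_det_of_eq_one i (hc.mul hA) (Matrix.nonsing_inv_mul _ hu)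
  rw [e, pd_const_mul i (hc.mul hA).det, h1, mpd_mul i hc hA, mpd_const, Matrix.zero_mul, add_zero]

end Mpd

end FourGeom

/-! ### Levi-Civita calculus in coordinates and the parallel projection onto Λ⁺ -/

namespace FourGeom

open Matrix Filter Topology

/-! ### The Levi-Civita connection in coordinates -/

/-- `G` gives the components of a smooth Riemannian metric on the open set `V`. -/
structure IsMetricOn (G : R4 → Mat) (V : Set R4) : Prop where
  isOpen : IsOpen V
  smooth : MatSmoothOn G V
  posDef : ∀ z ∈ V, (G z).PosDef

/-- The connection matrices `(Γᵢ)ᵏₗ = Γᵏᵢₗ`. -/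
def conn (G : R4 → Mat) (i : Fin 4) (z : R4) : Mat := Matrix.of fun k l => christoffel G z k i l

/-- The curvature matrices `(Rᵢⱼ)ᵏₗ = Rᵏₗᵢⱼ`. -/
def curv (G : R4 → Mat) (i j : Fin 4) (z : R4) : Mat :=
  Matrix.of fun k l => riemannUp G z k l i j

variable {G : R4 → Mat} {V : Set R4} {z : R4}

theorem IsMetricOn.symm (h : IsMetricOn G V) (hz : z ∈ V) (i j : Fin 4) : G z i j = G z j i := by
  have := (h.posDef z hz).isHermitian.apply i j
  simpa using this.symm

theorem IsMetricOn.transpose_eq (h : IsMetricOn G V) (hz : z ∈ V) : (G z)ᵀ = G z := by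
  ext i j
  exact h.symm hz j i

theorem IsMetricOn.det_ne (h : IsMetricOn G V) (hz : z ∈ V) : (G z).det ≠ 0 :=
  (h.posDef z hz).det_pos.ne'

theorem IsMetricOn.isUnit_det (h : IsMetricOn G V) (hz : z ∈ V) : IsUnit (G z).det :=
  isUnit_iff_ne_zero.2 (h.det_ne hz)

theorem IsMetricOn.diff (h : IsMetricOn G V) (hz : z ∈ V) : MatDiffAt G z :=
  h.smooth.matDiffAt h.isOpen hz

theorem IsMetricOn.pd_symm (h : IsMetricOn G V) (hz : z ∈ V) (m i j : Fin 4) :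
    pd m (fun y => G y i j) z = pd m (fun y => G y j i) z :=
  pd_congr m ((h.isOpen.mem_nhds hz : V ∈ 𝓝 z) |> Filter.mem_of_superset <| fun _ hy => h.symm hy i j)

theorem IsMetricOn.christoffel_symm (h : IsMetricOn G V) (hz : z ∈ V) (k i j : Fin 4) :
    christoffel G z k i j = christoffel G z k j i := by
  simp only [christoffel]
  congr 1
  refine Finset.sum_congr rfl fun l _ => ?_
  rw [h.pd_symm hz l i j]
  ring

theorem IsMetricOn.lower_christoffel (h : IsMetricOn G V) (hz : z ∈ V) (l i j : Fin 4) :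
    ∑ k, G z l k * christoffel G z k i j = (1 / 2) * (pd i (fun y => G y l j) z
      + pd j (fun y => G y l i) z - pd l (fun y => G y i j) z) := by
  simp only [christoffel, Finset.mul_sum]
  rw [Finset.sum_comm]
  have : ∀ n, ∑ k, G z l k * ((1 / 2) * ((G z)⁻¹ k n * (pd i (fun y => G y n j) z
      + pd j (fun y => G y n i) z - pd n (fun y => G y i j) z))) =
      (1 : Mat) l n * ((1 / 2) * (pd i (fun y => G y n j) z
      + pd j (fun y => G y n i) z - pd n (fun y => G y i j) z)) := by
    intro n
    rw [← Matrix.mul_nonsing_inv _ (h.isUnit_det hz), Matrix.mul_apply, Finset.sum_mul]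
    refine Finset.sum_congr rfl fun _ _ => ?_
    ring
  rw [Finset.sum_congr rfl fun n _ => this n]
  simp [Matrix.one_apply]

/-- The Levi-Civita connection is metric. -/
theorem IsMetricOn.mpd_eq (h : IsMetricOn G V) (hz : z ∈ V) (m : Fin 4) :
    mpd m G z = (conn G m z)ᵀ * G z + G z * conn G m z := by
  ext i j
  have h1 := h.lower_christoffel hz i m j
  have h2 := h.lower_christoffel hz j m i
  simp only [mpd, conn, Matrix.add_apply, Matrix.mul_apply, Matrix.of_apply,
    Matrix.transpose_apply]
  rw [h1, Finset.sum_congr rfl fun x _ => by rw [mul_comm, h.symm hz x j], h2,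
    h.pd_symm hz i j m, h.pd_symm hz j i m, h.pd_symm hz m j i]
  ring

theorem IsMetricOn.conn_smooth (h : IsMetricOn G V) (i : Fin 4) : MatSmoothOn (conn G i) V := by
  intro k l
  simp only [conn, christoffel, Matrix.of_apply]
  refine contDiffOn_const.mul (ContDiffOn.sum fun n _ => ?_)
  refine ((h.smooth.inv fun y hy => h.det_ne hy) k n).mul ?_
  exact ((contDiffOn_pd _ h.isOpen (h.smooth _ _)).add
    (contDiffOn_pd _ h.isOpen (h.smooth _ _))).sub (contDiffOn_pd _ h.isOpen (h.smooth _ _))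

theorem IsMetricOn.conn_diff (h : IsMetricOn G V) (hz : z ∈ V) (i : Fin 4) :
    MatDiffAt (conn G i) z := (h.conn_smooth i).matDiffAt h.isOpen hz

theorem curv_eq (G : R4 → Mat) (i j : Fin 4) (z : R4) : curv G i j z =
    mpd i (conn G j) z - mpd j (conn G i) z + (conn G i z * conn G j z - conn G j z * conn G i z)
    := by
  ext k l
  simp only [curv, riemannUp, conn, mpd, Matrix.add_apply, Matrix.sub_apply, Matrix.mul_apply,
    Matrix.of_apply, Finset.sum_sub_distrib]

theorem riemann_eq (G : R4 → Mat) (z : R4) (k l i j : Fin 4) :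
    riemann G z k l i j = (G z * curv G i j z) k l := by
  simp only [riemann, curv, Matrix.mul_apply, Matrix.of_apply]

/-- Equality of the mixed second derivatives of the metric, expanded with metric compatibility used
twice. -/
theorem IsMetricOn.mul_curv_antisymm (h : IsMetricOn G V) (hz : z ∈ V) (i j : Fin 4) :
    (G z * curv G i j z)ᵀ = -(G z * curv G i j z) := by
  have e : ∀ j, mpd j G =ᶠ[𝓝 z] fun y => (conn G j y)ᵀ * G y + G y * conn G j y := fun j =>
    Filter.mem_of_superset (h.isOpen.mem_nhds hz) fun y hy => h.mpd_eq hy j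
  have key : ∀ i j, mpd i (mpd j G) z = (conn G j z)ᵀ * mpd i G z + (mpd i (conn G j) z)ᵀ * G z
      + (G z * mpd i (conn G j) z + mpd i G z * conn G j z) := by
    intro i j
    rw [mpd_congr i (e j), mpd_add i ((h.conn_diff hz j).transpose.mul (h.diff hz))
      ((h.diff hz).mul (h.conn_diff hz j)), mpd_mul i (h.conn_diff hz j).transpose (h.diff hz),
      mpd_mul i (h.diff hz) (h.conn_diff hz j), mpd_transpose]
  have hc := mpd_comm i j h.isOpen h.smooth hz
  rw [key, key, h.mpd_eq hz, h.mpd_eq hz] at hc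
  rw [curv_eq, Matrix.transpose_mul, h.transpose_eq hz]
  simp only [Matrix.transpose_add, Matrix.transpose_sub, Matrix.transpose_mul, mul_add, add_mul,
    mul_sub, sub_mul, ← Matrix.mul_assoc] at hc ⊢
  rw [← sub_eq_zero] at hc ⊢
  rw [← hc]
  abel

/-- Because the connection is torsion-free, the derivative terms and the quadratic terms each cancel
in the cyclic sum. -/
theorem IsMetricOn.riemannUp_bianchi (h : IsMetricOn G V) (hz : z ∈ V) (k l i j : Fin 4) :
    riemannUp G z k l i j + riemannUp G z k i j l + riemannUp G z k j l i = 0 := by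
  have e : ∀ m i j, pd m (fun y => christoffel G y k i j) z =
      pd m (fun y => christoffel G y k j i) z := fun m i j =>
    pd_congr m (Filter.mem_of_superset (h.isOpen.mem_nhds hz) fun y hy =>
      h.christoffel_symm hy k i j)
  simp only [riemannUp, Finset.sum_sub_distrib]
  rw [e i l j, e j i l, e l j i]
  simp only [h.christoffel_symm hz _ l j, h.christoffel_symm hz _ j i, h.christoffel_symm hz _ l i]
  ring

/-- Pair symmetry is a formal consequence of the other symmetries: combine the Bianchi identities
for the four cyclic rotations of the indices. -/
theorem isCurvatureLike_of_bianchi {R : Tensor4} (a : ∀ i j k l, R j i k l = -R i j k l)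
    (b : ∀ i j k l, R i j l k = -R i j k l)
    (c : ∀ i j k l, R i j k l + R i k l j + R i l j k = 0) : IsCurvatureLike R := by
  refine ⟨a, b, fun i j k l => ?_, c⟩
  have h1 := c i j k l
  have h2 := c j k l i
  have h3 := c k l i j
  have h4 := c l i j k
  linarith [a i j k l, a i k l j, a i l j k, a j k l i, a j l i k, a k l i j, b i j k l, b i k l j,
    b i l j k, b j k l i, b j l i k, b k l i j, a j i k l, a k i l j, a l i j k, b j i k l,
    b k i l j, b l i j k, b k j l i, b l k i j, b l j i k]

theorem IsMetricOn.isCurvatureLike_riemann (h : IsMetricOn G V) (hz : z ∈ V) :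
    IsCurvatureLike (riemann G z) := by
  refine isCurvatureLike_of_bianchi (fun i j k l => ?_) (fun i j k l => ?_) (fun i j k l => ?_)
  · rw [riemann_eq, riemann_eq]
    exact congrFun (congrFun (h.mul_curv_antisymm hz k l) i) j
  · have : curv G l k z = -curv G k l z := by
      rw [curv_eq, curv_eq]; abel
    rw [riemann_eq, riemann_eq, this, Matrix.mul_neg, Matrix.neg_apply]
  · simp only [riemann, ← Finset.sum_add_distrib, ← mul_add, h.riemannUp_bianchi hz, mul_zero,
      Finset.sum_const_zero]

/-! ### The self-dual projection is parallel -/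

/-- Antisymmetrising over five indices gives zero in dimension four; the identity is this fact for
the volume symbol. -/
theorem leviCivitaInt_identity : ∀ p q i j k l : Fin 4,
    let L : Fin 4 → Fin 4 → Fin 4 → Fin 4 → ℤ := fun i j k l =>
      (((j : ℕ) : ℤ) - (i : ℕ)) * ((k : ℕ) - (i : ℕ)) * ((l : ℕ) - (i : ℕ)) *
        ((k : ℕ) - (j : ℕ)) * ((l : ℕ) - (j : ℕ)) * ((l : ℕ) - (k : ℕ))
    (if i = q then L p j k l else 0) + (if j = q then L i p k l else 0) +
    (if k = q then L i j p l else 0) + (if l = q then L i j k p else 0) =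
    if p = q then L i j k l else 0 := by
  decide +kernel

theorem leviCivitaSymbol_identity (p q i j k l : Fin 4) :
    (if i = q then leviCivitaSymbol p j k l else 0) +
    (if j = q then leviCivitaSymbol i p k l else 0) +
    (if k = q then leviCivitaSymbol i j p l else 0) +
    (if l = q then leviCivitaSymbol i j k p else 0) =
    if p = q then leviCivitaSymbol i j k l else 0 := by
  have h := congrArg (fun n : ℤ => (1 / 12 : ℝ) * n) (leviCivitaInt_identity p q i j k l)
  simp only [leviCivitaSymbol_eq]
  push_cast at h
  simpa only [mul_add, mul_ite, mul_zero] using h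

/-- The infinitesimal form of the determinant rule: B acts on the volume symbol as a derivation,
hence by its trace. -/
theorem sum_mul_leviCivitaSymbol (B : Mat) (i j k l : Fin 4) :
    ∑ a, (B a i * leviCivitaSymbol a j k l + B a j * leviCivitaSymbol i a k l
      + B a k * leviCivitaSymbol i j a l + B a l * leviCivitaSymbol i j k a) =
    B.trace * leviCivitaSymbol i j k l := by
  have e : ∀ a, B a i * leviCivitaSymbol a j k l + B a j * leviCivitaSymbol i a k l
      + B a k * leviCivitaSymbol i j a l + B a l * leviCivitaSymbol i j k a =
      ∑ q, B a q * if a = q then leviCivitaSymbol i j k l else 0 := by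
    intro a
    rw [Finset.sum_congr rfl fun q _ => by rw [← leviCivitaSymbol_identity a q i j k l]]
    simp [mul_add, Finset.sum_add_distrib]
  rw [Finset.sum_congr rfl fun a _ => e a]
  simp [Matrix.trace, Finset.sum_mul]

/-- Jacobi's formula and metric compatibility: the trace of G⁻¹∂G is twice that of the connection
matrix, and the square root halves it. -/
theorem IsMetricOn.pd_sqrt_det (h : IsMetricOn G V) (hz : z ∈ V) (m : Fin 4) :
    pd m (fun y => √(G y).det) z = (conn G m z).trace * √(G z).det := by
  have hd := (h.posDef z hz).det_pos
  have hu := h.isUnit_det hz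
  rw [pd_real_comp m (Real.hasDerivAt_sqrt hd.ne') (h.diff hz).det, pd_det m (h.diff hz) hd.ne',
    h.mpd_eq hz, Matrix.mul_add, Matrix.trace_add, ← Matrix.mul_assoc, ← Matrix.mul_assoc,
    Matrix.nonsing_inv_mul _ hu, Matrix.one_mul, Matrix.mul_assoc, Matrix.trace_mul_comm,
    Matrix.mul_assoc, Matrix.mul_nonsing_inv _ hu, Matrix.mul_one, Matrix.trace_transpose]
  have h2 : √(G z).det ≠ 0 := (Real.sqrt_pos.2 hd).ne'
  field_simp
  nth_rewrite 1 [← Real.sq_sqrt hd.le]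
  ring

theorem covDeriv_congr {G : R4 → Mat} {S T : R4 → Tensor4} (e : S =ᶠ[𝓝 z] T) (m i j k l : Fin 4) :
    covDeriv G S z m i j k l = covDeriv G T z m i j k l := by
  simp only [covDeriv]
  rw [pd_congr m (e.mono fun y (hy : S y = T y) => show S y i j k l = T y i j k l by rw [hy]),
    e.eq_of_nhds]

/-- Metric compatibility disposes of the part quadratic in the metric. In the volume part the
derivative of √det cancels the trace produced by the four Christoffel terms; the orientation sign is
locally constant. -/
theorem IsMetricOn.covDeriv_selfDualProj (h : IsMetricOn G V) (hz : z ∈ V) {s : R4 → ℝ}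
    (hs : ∀ᶠ y in 𝓝 z, s y = s z) (m i j k l : Fin 4) :
    covDeriv G (fun y => selfDualProj (G y) (s y)) z m i j k l = 0 := by
  rw [covDeriv_congr (T := fun y => selfDualProj (G y) (s z)) (hs.mono fun y hy => by rw [hy])]
  have d : ∀ a b, DifferentiableAt ℝ (fun y => G y a b) z := h.diff hz
  have hd := (h.posDef z hz).det_pos
  have dv : DifferentiableAt ℝ (fun y => √(G y).det) z := (h.diff hz).det.sqrt hd.ne'
  have e1 : pd m (fun y => selfDualProj (G y) (s z) i j k l) z = (1 / 2) *
      ((G z i k * pd m (fun y => G y j l) z + pd m (fun y => G y i k) z * G z j l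
      - (G z i l * pd m (fun y => G y j k) z + pd m (fun y => G y i l) z * G z j k))
      + s z * pd m (fun y => √(G y).det) z * leviCivitaSymbol i j k l) := by
    simp only [selfDualProj, volumeTensor]
    have p1 := (d i k).fun_mul (d j l)
    have p2 := (d i l).fun_mul (d j k)
    have p3 := (dv.const_mul (s z)).mul_const (leviCivitaSymbol i j k l)
    rw [pd_const_mul m ((p1.fun_sub p2).fun_add p3), pd_add m (p1.fun_sub p2) p3, pd_sub m p1 p2,
      pd_mul m (d i k) (d j l), pd_mul m (d i l) (d j k),
      pd_mul m (dv.const_mul (s z)) (differentiableAt_const _), pd_const_mul m dv, pd_const]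
    ring
  have hG : ∀ a b, pd m (fun y => G y a b) z =
      ∑ c, (christoffel G z c m a * G z c b + G z a c * christoffel G z c m b) := by
    intro a b
    have := congrFun (congrFun (h.mpd_eq hz m) a) b
    simpa only [mpd, conn, Matrix.of_apply, Matrix.add_apply, Matrix.mul_apply,
      Matrix.transpose_apply, ← Finset.sum_add_distrib] using this
  have hv := sum_mul_leviCivitaSymbol (conn G m z) i j k l
  rw [covDeriv, e1, h.pd_sqrt_det hz, hG, hG, hG, hG]
  simp only [conn, Matrix.of_apply] at hv ⊢
  simp only [Fin.sum_univ_four, selfDualProj, volumeTensor] at hv ⊢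
  simp only [h.symm hz i 0, h.symm hz i 1, h.symm hz i 2, h.symm hz i 3,
    h.symm hz j 0, h.symm hz j 1, h.symm hz j 2, h.symm hz j 3]
  linear_combination -(1 / 2) * s z * √(G z).det * hv

end FourGeom

/-! ### Quaternion relations and the algebra of the divergence equation -/

namespace FourGeom

open Matrix Filter Topology

/-! ### Quaternionic relations -/

theorem eta_zero_mul_eta_zero : eta 0 * eta 0 = -1 := by
  ext i j; fin_cases i <;> fin_cases j <;> simp [eta, Matrix.mul_apply, Fin.sum_univ_four]

theorem eta_zero_mul_eta_one : eta 0 * eta 1 = -eta 2 := by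
  ext i j; fin_cases i <;> fin_cases j <;> simp [eta, Matrix.mul_apply, Fin.sum_univ_four]

theorem eta_zero_mul_eta_two : eta 0 * eta 2 = eta 1 := by
  ext i j; fin_cases i <;> fin_cases j <;> simp [eta, Matrix.mul_apply, Fin.sum_univ_four]

theorem eta_one_mul_eta_zero : eta 1 * eta 0 = eta 2 := by
  ext i j; fin_cases i <;> fin_cases j <;> simp [eta, Matrix.mul_apply, Fin.sum_univ_four]

theorem eta_two_mul_eta_zero : eta 2 * eta 0 = -eta 1 := by
  ext i j; fin_cases i <;> fin_cases j <;> simp [eta, Matrix.mul_apply, Fin.sum_univ_four]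

variable {F g : Mat} {s : ℝ}

theorem IsCoframe.isUnit_det (hF : IsCoframe F g s) : IsUnit F.det :=
  isUnit_iff_ne_zero.2 hF.det_ne

theorem IsCoframe.inv_eq (hF : IsCoframe F g s) : g⁻¹ = F⁻¹ * F⁻¹ᵀ := by
  rw [← hF.eq, Matrix.mul_inv_rev, Matrix.transpose_nonsing_inv]

/-- The inverse metric cancels the two inner copies of F, so products in any coframe follow the
Euclidean quaternion table. -/
theorem IsCoframe.frameForm_mul (hF : IsCoframe F g s) (a b : Fin 3) :
    frameForm F a * g⁻¹ * frameForm F b = Fᵀ * (eta a * eta b) * F := by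
  have h1 : F * F⁻¹ = 1 := Matrix.mul_nonsing_inv _ hF.isUnit_det
  have h2 : F⁻¹ᵀ * Fᵀ = 1 := by rw [← Matrix.transpose_mul, h1, Matrix.transpose_one]
  calc frameForm F a * g⁻¹ * frameForm F b
      = Fᵀ * eta a * (F * F⁻¹) * (F⁻¹ᵀ * Fᵀ) * eta b * F := by
        rw [hF.inv_eq]; simp only [frameForm, Matrix.mul_assoc]
    _ = _ := by rw [h1, h2]; simp only [Matrix.mul_one, Matrix.mul_assoc]

theorem IsCoframe.frameForm_zero_zero (hF : IsCoframe F g s) :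
    frameForm F 0 * g⁻¹ * frameForm F 0 = -g := by
  rw [hF.frameForm_mul, eta_zero_mul_eta_zero, Matrix.mul_neg, Matrix.neg_mul, hF.one_pull]

theorem IsCoframe.frameForm_zero_one (hF : IsCoframe F g s) :
    frameForm F 0 * g⁻¹ * frameForm F 1 = -frameForm F 2 := by
  rw [hF.frameForm_mul, eta_zero_mul_eta_one, Matrix.mul_neg, Matrix.neg_mul, frameForm]

theorem IsCoframe.frameForm_zero_two (hF : IsCoframe F g s) :
    frameForm F 0 * g⁻¹ * frameForm F 2 = frameForm F 1 := by
  rw [hF.frameForm_mul, eta_zero_mul_eta_two, frameForm]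

theorem IsCoframe.frameForm_one_zero (hF : IsCoframe F g s) :
    frameForm F 1 * g⁻¹ * frameForm F 0 = frameForm F 2 := by
  rw [hF.frameForm_mul, eta_one_mul_eta_zero, frameForm]

theorem IsCoframe.frameForm_two_zero (hF : IsCoframe F g s) :
    frameForm F 2 * g⁻¹ * frameForm F 0 = -frameForm F 1 := by
  rw [hF.frameForm_mul, eta_two_mul_eta_zero, Matrix.mul_neg, Matrix.neg_mul, frameForm]

theorem IsCoframe.isUnit_det_metric (hF : IsCoframe F g s) : IsUnit g.det := by
  rw [← hF.eq, Matrix.det_mul, Matrix.det_transpose]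
  exact hF.isUnit_det.mul hF.isUnit_det

/-- The almost complex structure squares to `-1`. -/
theorem IsCoframe.inv_mul_frameForm_sq (hF : IsCoframe F g s) :
    (g⁻¹ * frameForm F 0) * (g⁻¹ * frameForm F 0) = -1 := by
  rw [Matrix.mul_assoc, ← Matrix.mul_assoc (frameForm F 0), hF.frameForm_zero_zero, Matrix.mul_neg,
    Matrix.nonsing_inv_mul _ hF.isUnit_det_metric]

/-! ### The pointwise consequences of the vanishing of the divergence -/

/-- The contraction `f_a(v, ·)`. -/
def contr (f : Mat) (v : Fin 4 → ℝ) : Fin 4 → ℝ := fun j => ∑ i, f i j * v i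

theorem contr_eq (f : Mat) (v : Fin 4 → ℝ) : contr f v = v ᵥ* f := by
  funext j
  simp only [contr, Matrix.vecMul, dotProduct, mul_comm]

theorem sum_mul_contr (K f : Mat) (v : Fin 4 → ℝ) (p : Fin 4) :
    ∑ j, K j p * contr f v j = contr (f * K) v p := by
  rw [contr_eq, contr_eq, ← Matrix.vecMul_vecMul]
  exact Finset.sum_congr rfl fun _ _ => mul_comm _ _

theorem contr_neg (f : Mat) (v : Fin 4 → ℝ) (p : Fin 4) : contr (-f) v p = -contr f v p := by
  simp [contr]

theorem tens_apply (φ ψ : Mat) (i j k l : Fin 4) : tens φ ψ i j k l = φ i j * ψ k l := rfl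

theorem pair_eq_trace (g φ ψ : Mat) :
    pair g φ ψ = (1 / 2) * (φᵀ * g⁻¹ * ψ * g⁻¹ᵀ).trace := by
  simp only [pair, Matrix.trace, Matrix.diag_apply, Matrix.mul_apply, Matrix.transpose_apply,
    Finset.sum_mul]
  congr 1
  rw [Finset.sum_comm]
  refine Finset.sum_congr rfl fun j _ => ?_
  have e : ∀ F : Fin 4 → Fin 4 → Fin 4 → ℝ,
      (∑ i, ∑ k, ∑ l, F i k l) = ∑ l, ∑ k, ∑ i, F i k l := by
    intro F
    rw [Finset.sum_comm, Finset.sum_congr rfl fun k _ => Finset.sum_comm, Finset.sum_comm]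
  rw [e]
  refine Finset.sum_congr rfl fun _ _ => Finset.sum_congr rfl fun _ _ =>
    Finset.sum_congr rfl fun _ _ => ?_
  ring

/-- Contracting twice with the almost complex structure multiplies by −1. This recovers D from the
contraction that the divergence controls. -/
theorem IsCoframe.eq_sum_of_contraction (hF : IsCoframe F g s) (D : Fin 4 → Mat) (p : Fin 4) :
    D p = -∑ j, (g⁻¹ * frameForm F 0) j p • ∑ m, (g⁻¹ * frameForm F 0) m j • D m := by
  have h1 : ∑ j, (g⁻¹ * frameForm F 0) j p • ∑ m, (g⁻¹ * frameForm F 0) m j • D m =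
      ∑ m, ((g⁻¹ * frameForm F 0) * (g⁻¹ * frameForm F 0)) m p • D m := by
    simp only [Finset.smul_sum, smul_smul]
    rw [Finset.sum_comm]
    refine Finset.sum_congr rfl fun m _ => ?_
    rw [← Finset.sum_smul, Matrix.mul_apply (M := g⁻¹ * frameForm F 0)]
    congr 1
    refine Finset.sum_congr rfl fun _ _ => ?_
    ring
  rw [h1, hF.inv_mul_frameForm_sq]
  simp [Matrix.one_apply]

/-- The vanishing of the divergence of `α P - (3α/2) S ⊗ S`, solved for the contraction of
`S ⊗ D`, `D` being the covariant derivative of `S` and `d` that of `α`. -/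
theorem IsCoframe.contraction_eq (hF : IsCoframe F g s) {α : ℝ}
    {d : Fin 4 → ℝ} {D : Fin 4 → Mat} (hD : ∀ m, pair g (frameForm F 0) (D m) = 0)
    (hdiv : ∀ j k l, ∑ m, ∑ i, g⁻¹ m i * (d m * selfDualProj g s i j k l - (3 / 2) *
      (d m * (frameForm F 0 i j * frameForm F 0 k l) + α * (D m i j * frameForm F 0 k l
        + frameForm F 0 i j * D m k l))) = 0) (j : Fin 4) :
    (3 * α) • ∑ m, (g⁻¹ * frameForm F 0) m j • D m =
      contr (frameForm F 1) (d ᵥ* g⁻¹) j • frameForm F 1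
        + contr (frameForm F 2) (d ᵥ* g⁻¹) j • frameForm F 2 := by
  set x : Fin 3 → Fin 4 → ℝ := fun a => contr (frameForm F a) (d ᵥ* g⁻¹) with hx
  set δ : Fin 4 → ℝ := fun j => ∑ m, ∑ i, g⁻¹ m i * D m i j with hδ
  set Y : Fin 4 → Mat := fun j => ∑ m, (g⁻¹ * frameForm F 0) m j • D m with hY
  have hxs : ∀ a j, x a j = ∑ m, ∑ i, g⁻¹ m i * (d m * frameForm F a i j) := by
    intro a j
    simp only [hx, contr, Matrix.vecMul, dotProduct, Finset.mul_sum]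
    rw [Finset.sum_comm]
    refine Finset.sum_congr rfl fun _ _ => Finset.sum_congr rfl fun _ _ => ?_
    ring
  have hYs : ∀ j k l, Y j k l = ∑ m, ∑ i, g⁻¹ m i * (frameForm F 0 i j * D m k l) := by
    intro j k l
    simp only [hY, Matrix.sum_apply, Matrix.smul_apply, Matrix.mul_apply, smul_eq_mul,
      Finset.sum_mul, mul_assoc]
  -- For fixed j, the divergence as an identity between two-forms in the last two indices, with the
  -- projection expanded in the coframe.
  have E : ∀ j, (1 / 2 : ℝ) • (∑ a, x a j • frameForm F a) - (3 / 2 : ℝ) •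
      (x 0 j • frameForm F 0 + α • (δ j • frameForm F 0 + Y j)) = 0 := by
    intro j
    ext k l
    have h := hdiv j k l
    rw [hF.selfDualProj_eq] at h
    rw [Matrix.zero_apply, ← h]
    simp only [Matrix.sub_apply, Matrix.add_apply, Matrix.smul_apply, smul_eq_mul,
      hxs, hYs, hδ, Pi.smul_apply, Fin.sum_univ_three, Pi.add_apply, tens_apply,
      Finset.mul_sum, Finset.sum_mul, ← Finset.sum_add_distrib, ← Finset.sum_sub_distrib]
    refine Finset.sum_congr rfl fun _ _ => Finset.sum_congr rfl fun _ _ => ?_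
    ring
  have hpY : ∀ j, pair g (frameForm F 0) (Y j) = 0 := by
    intro j
    simp only [hY, pair_sum_right, pair_smul_right, hD, mul_zero, Finset.sum_const_zero]
  -- Pairing with the first form removes Y and the other two forms and leaves x₀ − 3x₀ − 3αδ = 0.
  have hδx : ∀ j, α * δ j = -(2 / 3) * x 0 j := by
    intro j
    have h := congrArg (pair g (frameForm F 0)) (E j)
    rw [sub_eq_add_neg, ← neg_smul, pair_add_right, pair_smul_right, pair_smul_right,
      pair_add_right, pair_smul_right, pair_smul_right, pair_add_right, pair_smul_right, hpY,
      ← frameComb_apply F (fun a => x a j), hF.pair_frameComb_right, hF.pair_frameForm, if_pos rfl,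
      ← zero_smul ℝ (0 : Mat), pair_smul_right] at h
    linarith
  change (3 * α) • Y j = x 1 j • frameForm F 1 + x 2 j • frameForm F 2
  ext k l
  have h := congrFun (congrFun (E j) k) l
  simp only [Matrix.sub_apply, Matrix.add_apply, Matrix.smul_apply, smul_eq_mul,
    Fin.sum_univ_three, Matrix.zero_apply] at h ⊢
  linear_combination (-2) * h - 3 * frameForm F 0 k l * hδx j

/-- If `W = α P - (3α/2) S ⊗ S` is divergence-free, the covariant derivative `D` of `S` is
determined by the derivative `d` of `α`. -/
theorem IsCoframe.covariant_derivative_eq (hF : IsCoframe F g s) {α : ℝ}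
    {d : Fin 4 → ℝ} {D : Fin 4 → Mat} (hD : ∀ m, pair g (frameForm F 0) (D m) = 0)
    (hdiv : ∀ j k l, ∑ m, ∑ i, g⁻¹ m i * (d m * selfDualProj g s i j k l - (3 / 2) *
      (d m * (frameForm F 0 i j * frameForm F 0 k l) + α * (D m i j * frameForm F 0 k l
        + frameForm F 0 i j * D m k l))) = 0) (p : Fin 4) :
    (3 * α) • D p = contr (frameForm F 1) (d ᵥ* g⁻¹) p • frameForm F 2
      - contr (frameForm F 2) (d ᵥ* g⁻¹) p • frameForm F 1 := by
  have hY := hF.contraction_eq hD hdiv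
  have h1 := sum_mul_contr (g⁻¹ * frameForm F 0) (frameForm F 1) (d ᵥ* g⁻¹) p
  have h2 := sum_mul_contr (g⁻¹ * frameForm F 0) (frameForm F 2) (d ᵥ* g⁻¹) p
  rw [← Matrix.mul_assoc, hF.frameForm_one_zero] at h1
  rw [← Matrix.mul_assoc, hF.frameForm_two_zero, contr_neg] at h2
  rw [hF.eq_sum_of_contraction D p, smul_neg, Finset.smul_sum,
    Finset.sum_congr rfl fun j _ => (smul_comm (3 * α) _ _).trans (congrArg _ (hY j))]
  simp only [smul_add, smul_smul, Finset.sum_add_distrib, ← Finset.sum_smul]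
  rw [h1, h2, neg_smul, neg_add, neg_neg]
  abel

/-- The Nijenhuis tensor in terms of covariant derivatives. -/
theorem IsCoframe.nijenhuis_algebra (hF : IsCoframe F g s) (v : Fin 4 → ℝ) {K : Mat}
    {K' : Fin 4 → Mat} (hK : K = g⁻¹ * frameForm F 0) (c : ℝ)
    (hK' : ∀ m, c • K' m = contr (frameForm F 1) v m • (g⁻¹ * frameForm F 2)
      - contr (frameForm F 2) v m • (g⁻¹ * frameForm F 1)) (hc : c ≠ 0) (i j k : Fin 4) :
    ∑ l, (K l j * K' l i k - K l k * K' l i j - K i l * (K' j l k - K' k l j)) = 0 := by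
  -- K sends the pair of one-forms (x₁, x₂) to (x₂, −x₁), and left multiplication by K sends the two
  -- remaining endomorphisms (I₁, I₂) to (−I₂, I₁). These rotations make the terms of the Nijenhuis
  -- tensor cancel in pairs.
  have h1 : ∀ p, ∑ j, K j p * contr (frameForm F 1) v j = contr (frameForm F 2) v p := by
    intro p
    rw [sum_mul_contr, hK, ← Matrix.mul_assoc, hF.frameForm_one_zero]
  have h2 : ∀ p, ∑ j, K j p * contr (frameForm F 2) v j = -contr (frameForm F 1) v p := by
    intro p
    rw [sum_mul_contr, hK, ← Matrix.mul_assoc, hF.frameForm_two_zero, contr_neg]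
  have k1 : ∀ m, ∑ l, K i l * (g⁻¹ * frameForm F 1) l m = -(g⁻¹ * frameForm F 2) i m := by
    intro m
    rw [← Matrix.mul_apply, hK, Matrix.mul_assoc, ← Matrix.mul_assoc (frameForm F 0),
      hF.frameForm_zero_one, Matrix.mul_neg, Matrix.neg_apply]
  have k2 : ∀ m, ∑ l, K i l * (g⁻¹ * frameForm F 2) l m = (g⁻¹ * frameForm F 1) i m := by
    intro m
    rw [← Matrix.mul_apply, hK, Matrix.mul_assoc, ← Matrix.mul_assoc (frameForm F 0),
      hF.frameForm_zero_two]
  have e : ∀ m a b, c * K' m a b = contr (frameForm F 1) v m * (g⁻¹ * frameForm F 2) a b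
      - contr (frameForm F 2) v m * (g⁻¹ * frameForm F 1) a b := fun m a b => by
    simpa using congrFun (congrFun (hK' m) a) b
  refine (mul_eq_zero.1 (?_ : c * _ = 0)).resolve_left hc
  rw [Finset.mul_sum]
  have : ∀ l, c * (K l j * K' l i k - K l k * K' l i j - K i l * (K' j l k - K' k l j)) =
      K l j * (c * K' l i k) - K l k * (c * K' l i j) - K i l * (c * K' j l k)
        + K i l * (c * K' k l j) := fun l => by ring
  simp only [this, e]
  have f1 := h1 j
  have f2 := h1 k
  have f3 := h2 j
  have f4 := h2 k
  have f5 := k1 j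
  have f6 := k1 k
  have f7 := k2 j
  have f8 := k2 k
  simp only [Fin.sum_univ_four] at f1 f2 f3 f4 f5 f6 f7 f8 ⊢
  linear_combination (g⁻¹ * frameForm F 2) i k * f1 - (g⁻¹ * frameForm F 1) i k * f3
    - (g⁻¹ * frameForm F 2) i j * f2 + (g⁻¹ * frameForm F 1) i j * f4
    - contr (frameForm F 1) v j * f8 + contr (frameForm F 2) v j * f6
    + contr (frameForm F 1) v k * f7 - contr (frameForm F 2) v k * f5

/-- The Euclidean form of x₁ ∧ Σ₂ − x₂ ∧ Σ₁ = −2 v ∧ Σ₀. The coefficient 2 here is the source of the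
exponent 2/3. -/
theorem eta_cyclic (v : Fin 4 → ℝ) (p q r : Fin 4) :
    (contr (eta 1) v p * eta 2 q r - contr (eta 2) v p * eta 1 q r + 2 * v p * eta 0 q r)
    + (contr (eta 1) v q * eta 2 r p - contr (eta 2) v q * eta 1 r p + 2 * v q * eta 0 r p)
    + (contr (eta 1) v r * eta 2 p q - contr (eta 2) v r * eta 1 p q + 2 * v r * eta 0 p q)
    = 0 := by
  simp only [contr, Fin.sum_univ_four]
  fin_cases p <;> fin_cases q <;> fin_cases r <;> simp [eta] <;> ring

theorem frameForm_cyclic (F : Mat) (v : Fin 4 → ℝ) (m k l : Fin 4) :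
    (contr (frameForm F 1) v m * frameForm F 2 k l - contr (frameForm F 2) v m * frameForm F 1 k l
      + 2 * contr (Fᵀ * F) v m * frameForm F 0 k l)
    + (contr (frameForm F 1) v k * frameForm F 2 l m
      - contr (frameForm F 2) v k * frameForm F 1 l m
      + 2 * contr (Fᵀ * F) v k * frameForm F 0 l m)
    + (contr (frameForm F 1) v l * frameForm F 2 m k
      - contr (frameForm F 2) v l * frameForm F 1 m k
      + 2 * contr (Fᵀ * F) v l * frameForm F 0 m k) = 0 := by
  set u : Fin 4 → ℝ := F *ᵥ v with hu
  have h1 : ∀ a m, contr (frameForm F a) v m = ∑ p, F p m * contr (eta a) u p := by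
    intro a m
    rw [sum_mul_contr, contr_eq, contr_eq, frameForm, Matrix.mul_assoc, ← Matrix.vecMul_vecMul,
      Matrix.vecMul_transpose]
  have h2 : ∀ m, contr (Fᵀ * F) v m = ∑ p, F p m * u p := by
    intro m
    rw [contr_eq, ← Matrix.vecMul_vecMul, Matrix.vecMul_transpose, ← contr_eq]
    rfl
  have e1 : ∀ f : Fin 4 → Fin 4 → Fin 4 → ℝ, ∑ p, ∑ q, ∑ r, f p q r = ∑ r, ∑ p, ∑ q, f p q r :=
    fun f => by
      rw [Finset.sum_congr rfl fun p _ => Finset.sum_comm, Finset.sum_comm]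
  have T : ∀ m k l, contr (frameForm F 1) v m * frameForm F 2 k l
      - contr (frameForm F 2) v m * frameForm F 1 k l
      + 2 * contr (Fᵀ * F) v m * frameForm F 0 k l = ∑ p, ∑ q, ∑ r, F p m * F q k * F r l *
        (contr (eta 1) u p * eta 2 q r - contr (eta 2) u p * eta 1 q r + 2 * u p * eta 0 q r) := by
    intro m k l
    rw [h1, h1, h2]
    simp only [frameForm, pull_apply, Finset.sum_mul, Finset.mul_sum, ← Finset.sum_sub_distrib,
      ← Finset.sum_add_distrib]
    rw [e1]
    refine Finset.sum_congr rfl fun _ _ => Finset.sum_congr rfl fun _ _ =>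
      Finset.sum_congr rfl fun _ _ => ?_
    ring
  rw [T m, T k, T l, e1 (fun p q r => F p k * F q l * F r m * _), e1 (fun p q r => F p l * F q m * F r k * _),
    e1 (fun r p q => F p l * F q m * F r k * _)]
  simp only [← Finset.sum_add_distrib]
  refine Finset.sum_eq_zero fun p _ => Finset.sum_eq_zero fun q _ => Finset.sum_eq_zero fun r _ => ?_
  linear_combination F p m * F q k * F r l * eta_cyclic u p q r

end FourGeom

/-! ### Smoothness of the eigenvalue and local existence of the eigenform -/

namespace FourGeom

open Matrix Filter Topology Kronecker

/-! ### Type D metrics in a coordinate domain -/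

/-- `G` is a metric on `V` whose `W⁺` is of type D with repeated eigenvalue `α`, the coordinates
having orientation `s`. -/
structure IsTypeDOn (G : R4 → Mat) (s α : R4 → ℝ) (V : Set R4) : Prop extends IsMetricOn G V where
  sign : ∀ z ∈ V, s z = 1 ∨ s z = -1
  sign_cont : ContinuousOn s V
  finrank_eq : ∀ z ∈ V, Module.finrank ℝ (weylPlusEigenspace G s z (α z)) = 2

/-- `S` is a smooth normalised self-dual eigenform of `W⁺` for the eigenvalue `-2 α`. -/
structure IsEigenformOn (G : R4 → Mat) (s α : R4 → ℝ) (S : R4 → Mat) (V : Set R4) : Prop where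
  smooth : MatSmoothOn S V
  mem : ∀ z ∈ V, S z ∈ weylPlusEigenspace G s z (-2 * α z)
  norm : ∀ z ∈ V, pair (G z) (S z) (S z) = 2

variable {G S : R4 → Mat} {s α : R4 → ℝ} {V : Set R4} {z : R4}

theorem IsTypeDOn.sign_eventually (h : IsTypeDOn G s α V) (hz : z ∈ V) :
    ∀ᶠ y in 𝓝 z, s y = s z := by
  have hc : ContinuousAt s z := h.sign_cont.continuousAt (h.isOpen.mem_nhds hz)
  -- The only possible values 1 and −1 are at distance two, so closeness within one forces equality.
  filter_upwards [h.isOpen.mem_nhds hz, hc.eventually (Metric.ball_mem_nhds (s z) one_pos)]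
    with y hy hy'
  rw [Real.dist_eq] at hy'
  have := abs_lt.1 hy'
  rcases h.sign z hz with h1 | h1 <;> rcases h.sign y hy with h2 | h2 <;>
    linarith [this.1, this.2]

theorem IsTypeDOn.sign_smooth (h : IsTypeDOn G s α V) : ContDiffOn ℝ ∞ s V := fun _ hz =>
  (contDiffAt_const.congr_of_eventuallyEq (h.sign_eventually hz)).contDiffWithinAt

theorem IsTypeDOn.isCurvatureLike (h : IsTypeDOn G s α V) (hz : z ∈ V) :
    IsCurvatureLike (riemann G z) := h.toIsMetricOn.isCurvatureLike_riemann hz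

theorem IsTypeDOn.exists_coframe (h : IsTypeDOn G s α V) (hz : z ∈ V) :
    α z ≠ 0 ∧ ∃ F, IsCoframe F (G z) (s z) ∧ weylPlus G s z = α z • selfDualProj (G z) (s z) -
      (3 * α z / 2) • tens (frameForm F 0) (frameForm F 0) := by
  have h2 := h.finrank_eq z hz
  rw [weylPlusEigenspace, weylPlus_eq_weylPlusOf G s z (h.det_ne hz)] at h2
  rw [weylPlus_eq_weylPlusOf G s z (h.det_ne hz)]
  exact exists_simple_eigenform (h.posDef z hz) (h.sign z hz) (h.isCurvatureLike hz) h2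

theorem IsTypeDOn.exists_adapted (h : IsTypeDOn G s α V) (hS : IsEigenformOn G s α S V)
    (hz : z ∈ V) : ∃ F, IsCoframe F (G z) (s z) ∧ S z = frameForm F 0 ∧
      weylPlus G s z = α z • selfDualProj (G z) (s z) - (3 * α z / 2) • tens (S z) (S z) := by
  have h2 := h.finrank_eq z hz
  have h3 := hS.mem z hz
  rw [weylPlusEigenspace, weylPlus_eq_weylPlusOf G s z (h.det_ne hz)] at h2 h3
  rw [weylPlus_eq_weylPlusOf G s z (h.det_ne hz)]
  exact exists_adapted_coframe (h.posDef z hz) (h.sign z hz) (h.isCurvatureLike hz) h2 h3.1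
    (Module.End.mem_eigenspace_iff.1 h3.2) (hS.norm z hz)

/-! ### Smoothness of `W⁺` and of its eigenvalue -/

/-- A four-tensor field with smooth components. -/
def TensorSmoothOn (T : R4 → Tensor4) (V : Set R4) : Prop :=
  ∀ i j k l, ContDiffOn ℝ ∞ (fun y => T y i j k l) V

theorem IsMetricOn.inv_smooth (h : IsMetricOn G V) : MatSmoothOn (fun y => (G y)⁻¹) V :=
  h.smooth.inv fun _ hy => h.det_ne hy

theorem IsMetricOn.compTwo_smooth (h : IsMetricOn G V) {S T : R4 → Tensor4}
    (hS : TensorSmoothOn S V) (hT : TensorSmoothOn T V) :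
    TensorSmoothOn (fun y => compTwo (G y) (S y) (T y)) V := by
  intro i j k l
  simp only [compTwo]
  exact contDiffOn_const.mul (ContDiffOn.sum fun a _ => ContDiffOn.sum fun b _ =>
    ContDiffOn.sum fun c _ => ContDiffOn.sum fun d _ =>
      (((hS i j a b).mul (h.inv_smooth a c)).mul (h.inv_smooth b d)).mul (hT c d k l))

theorem IsTypeDOn.selfDualProj_smooth (h : IsTypeDOn G s α V) :
    TensorSmoothOn (fun y => selfDualProj (G y) (s y)) V := by
  intro i j k l
  simp only [selfDualProj, volumeTensor]
  have hd : ContDiffOn ℝ ∞ (fun y => √(G y).det) V :=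
    (contDiffOn_det h.smooth).sqrt fun y hy => (h.det_ne hy)
  exact contDiffOn_const.mul ((((h.smooth i k).mul (h.smooth j l)).sub
    ((h.smooth i l).mul (h.smooth j k))).add ((h.sign_smooth.mul hd).mul contDiffOn_const))

theorem IsMetricOn.riemannUp_smooth (h : IsMetricOn G V) (k l i j : Fin 4) :
    ContDiffOn ℝ ∞ (fun y => riemannUp G y k l i j) V := by
  simp only [riemannUp]
  have c : ∀ k i j, ContDiffOn ℝ ∞ (fun y => christoffel G y k i j) V := fun k i j =>
    h.conn_smooth i k j
  exact ((contDiffOn_pd _ h.isOpen (c _ _ _)).sub (contDiffOn_pd _ h.isOpen (c _ _ _))).add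
    (ContDiffOn.sum fun m _ => ((c _ _ _).mul (c _ _ _)).sub ((c _ _ _).mul (c _ _ _)))

theorem IsMetricOn.weyl_smooth (h : IsMetricOn G V) : TensorSmoothOn (weyl G) V := by
  have r : ∀ l j, ContDiffOn ℝ ∞ (fun y => ricci G y l j) V := fun l j =>
    ContDiffOn.sum fun k _ => h.riemannUp_smooth _ _ _ _
  have sc : ContDiffOn ℝ ∞ (fun y => scalarCurv G y) V :=
    ContDiffOn.sum fun l _ => ContDiffOn.sum fun j _ => (h.inv_smooth l j).mul (r l j)
  have rm : ∀ k l i j, ContDiffOn ℝ ∞ (fun y => riemann G y k l i j) V := fun k l i j =>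
    ContDiffOn.sum fun m _ => (h.smooth k m).mul (h.riemannUp_smooth _ _ _ _)
  intro k l i j
  simp only [weyl]
  have g := h.smooth
  refine ((rm k l i j).sub (contDiffOn_const.mul ?_)).add ((sc.div_const 6).mul ?_)
  · exact ((((g k i).mul (r l j)).sub ((g k j).mul (r l i))).add ((g l j).mul (r k i))).sub
      ((g l i).mul (r k j))
  · exact ((g k i).mul (g l j)).sub ((g k j).mul (g l i))

theorem IsTypeDOn.weylPlus_smooth (h : IsTypeDOn G s α V) : TensorSmoothOn (weylPlus G s) V :=
  h.compTwo_smooth h.selfDualProj_smooth (h.compTwo_smooth h.weyl_smooth h.selfDualProj_smooth)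

/-- The matrix of `W⁺` acting on two-tensors, up to a factor. -/
def weylPlusMat (G : R4 → Mat) (s : R4 → ℝ) (z : R4) :
    Matrix (Fin 4 × Fin 4) (Fin 4 × Fin 4) ℝ :=
  asMat (weylPlus G s z) * ((G z)⁻¹ ⊗ₖ (G z)⁻¹)

theorem IsCoframe.frameForm_dotProduct {F g : Mat} {s : ℝ} (hF : IsCoframe F g s) (a b : Fin 3) :
    (asVec (frameForm F a) ᵥ* (g⁻¹ ⊗ₖ g⁻¹)) ⬝ᵥ asVec (frameForm F b) = if a = b then 4 else 0 := by
  have h := hF.pair_frameForm a b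
  rw [pair_eq, Matrix.dotProduct_mulVec] at h
  split_ifs at h ⊢ <;> linarith

/-- The E a are four times mutually orthogonal idempotents of rank one. Without the factor ½ of the
action on two-forms, the nonzero eigenvalues are −4α, 2α, 2α, with power sums 24α² and −48α³. -/
theorem IsTypeDOn.trace_weylPlusMat (h : IsTypeDOn G s α V) (hz : z ∈ V) :
    (weylPlusMat G s z * weylPlusMat G s z).trace = 24 * α z ^ 2 ∧
    (weylPlusMat G s z * weylPlusMat G s z * weylPlusMat G s z).trace = -48 * α z ^ 3 := by
  obtain ⟨-, F, hF, he⟩ := h.exists_coframe hz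
  set E : Fin 3 → Matrix (Fin 4 × Fin 4) (Fin 4 × Fin 4) ℝ := fun a =>
    vecMulVec (asVec (frameForm F a)) (asVec (frameForm F a) ᵥ* ((G z)⁻¹ ⊗ₖ (G z)⁻¹)) with hE
  have hN : weylPlusMat G s z = (α z / 2) • ((-2 : ℝ) • E 0 + E 1 + E 2) := by
    have e : asMat (weylPlus G s z) = (α z / 2) • ((-2 : ℝ) • asMat (tens (frameForm F 0)
        (frameForm F 0)) + asMat (tens (frameForm F 1) (frameForm F 1)) +
        asMat (tens (frameForm F 2) (frameForm F 2))) := by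
      rw [he, hF.selfDualProj_eq, Fin.sum_univ_three]
      ext p q
      simp only [asMat, Matrix.of_apply, Pi.sub_apply, Pi.add_apply, Pi.smul_apply, smul_eq_mul,
        Matrix.smul_apply, Matrix.add_apply]
      ring
    rw [weylPlusMat, e]
    simp only [Matrix.smul_mul, Matrix.add_mul, asMat_tens, hE, Matrix.vecMulVec_mul]
  have hEE : ∀ a b, E a * E b = if a = b then (4 : ℝ) • E a else 0 := by
    intro a b
    simp only [hE]
    rw [Matrix.vecMulVec_mul_vecMulVec, hF.frameForm_dotProduct]
    split_ifs with hab
    · subst hab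
      ext p q
      simp [Matrix.vecMulVec_apply]
      ring
    · ext p q
      simp [Matrix.vecMulVec_apply]
  have hT : ∀ a, (E a).trace = 4 := by
    intro a
    simp only [hE]
    rw [Matrix.trace_vecMulVec, dotProduct_comm, hF.frameForm_dotProduct, if_pos rfl]
  have h2 : weylPlusMat G s z * weylPlusMat G s z = (α z ^ 2) • ((4 : ℝ) • E 0 + E 1 + E 2) := by
    rw [hN]
    simp only [Matrix.smul_mul, Matrix.mul_smul, Matrix.add_mul, Matrix.mul_add, hEE]
    simp
    module
  have h3 : weylPlusMat G s z * weylPlusMat G s z * weylPlusMat G s z =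
      (2 * α z ^ 3) • ((-8 : ℝ) • E 0 + E 1 + E 2) := by
    rw [h2, hN]
    simp only [Matrix.smul_mul, Matrix.mul_smul, Matrix.add_mul, Matrix.mul_add, hEE]
    simp
    module
  rw [h3, h2]
  simp only [Matrix.trace_smul, Matrix.trace_add, hT, smul_eq_mul]
  constructor <;> ring

/-- The eigenvalue is −½ times the trace of the cube over the trace of the square; the denominator
24α² never vanishes. -/
theorem IsTypeDOn.smooth_eigenvalue (h : IsTypeDOn G s α V) : ContDiffOn ℝ ∞ α V := by
  have hN : ∀ p q, ContDiffOn ℝ ∞ (fun y => weylPlusMat G s y p q) V := by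
    intro p q
    simp only [weylPlusMat, Matrix.mul_apply, asMat, Matrix.of_apply, Matrix.kroneckerMap_apply]
    exact ContDiffOn.sum fun r _ => (h.weylPlus_smooth _ _ _ _).mul
      ((h.inv_smooth _ _).mul (h.inv_smooth _ _))
  have h2 : ContDiffOn ℝ ∞ (fun y => (weylPlusMat G s y * weylPlusMat G s y).trace) V := by
    simp only [Matrix.trace, Matrix.diag_apply, Matrix.mul_apply]
    exact ContDiffOn.sum fun p _ => ContDiffOn.sum fun q _ => (hN _ _).mul (hN _ _)
  have h3 : ContDiffOn ℝ ∞
      (fun y => (weylPlusMat G s y * weylPlusMat G s y * weylPlusMat G s y).trace) V := by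
    simp only [Matrix.trace, Matrix.diag_apply, Matrix.mul_apply]
    exact ContDiffOn.sum fun p _ => ContDiffOn.sum fun q _ =>
      (ContDiffOn.sum fun r _ => (hN _ _).mul (hN _ _)).mul (hN _ _)
  have hne : ∀ y ∈ V, (weylPlusMat G s y * weylPlusMat G s y).trace ≠ 0 := by
    intro y hy
    rw [(h.trace_weylPlusMat hy).1]
    have := (h.exists_coframe hy).1
    positivity
  refine (contDiffOn_const.mul (h3.div h2 hne) : ContDiffOn ℝ ∞ (fun y => (-1 / 2 : ℝ) * _) V).congr
    fun y hy => ?_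
  have := (h.exists_coframe hy).1
  rw [Pi.div_apply, (h.trace_weylPlusMat hy).1, (h.trace_weylPlusMat hy).2]
  field_simp
  norm_num

/-! ### Local existence of the eigenform -/

theorem IsCoframe.isEigenform_smul {F g : Mat} {s : ℝ} (hF : IsCoframe F g s) {c : ℝ}
    (hc : c * c = 1) : pair g (c • frameForm F 0) (c • frameForm F 0) = 2 := by
  rw [pair_smul_left, pair_smul_right, hF.pair_frameForm, if_pos rfl, ← mul_assoc, hc, one_mul]

theorem IsTypeDOn.mono (h : IsTypeDOn G s α V) {V' : Set R4} (hV' : IsOpen V') (hs : V' ⊆ V) :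
    IsTypeDOn G s α V' where
  isOpen := hV'
  smooth i j := (h.smooth i j).mono hs
  posDef z hz := h.posDef z (hs hz)
  sign z hz := h.sign z (hs hz)
  sign_cont := h.sign_cont.mono hs
  finrank_eq z hz := h.finrank_eq z (hs hz)

theorem IsTypeDOn.exists_eigenform (h : IsTypeDOn G s α V) (hz : z ∈ V) :
    ∃ V', IsOpen V' ∧ z ∈ V' ∧ V' ⊆ V ∧ ∃ S, IsEigenformOn G s α S V' := by
  -- The normal form of W⁺ solved for Σ ⊗ Σ, which is smooth and independent of the sign of Σ.
  set T : R4 → Tensor4 := fun y => (2 / (3 * α y)) • (α y • selfDualProj (G y) (s y) -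
    weylPlus G s y) with hT
  have hα : ∀ y ∈ V, α y ≠ 0 := fun y hy => (h.exists_coframe hy).1
  have hTs : TensorSmoothOn T V := by
    intro i j k l
    have hα' := h.smooth_eigenvalue
    exact (contDiffOn_const.div (contDiffOn_const.mul hα') fun y hy => by
      simpa using hα y hy).mul ((hα'.mul (h.selfDualProj_smooth i j k l)).sub
      (h.weylPlus_smooth i j k l))
  have hTF : ∀ y ∈ V, ∃ F, IsCoframe F (G y) (s y) ∧ T y = tens (frameForm F 0) (frameForm F 0) ∧
      weylPlus G s y = α y • selfDualProj (G y) (s y) -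
      (3 * α y / 2) • tens (frameForm F 0) (frameForm F 0) := by
    intro y hy
    obtain ⟨h0, F, hF, he⟩ := h.exists_coframe hy
    refine ⟨F, hF, ?_, he⟩
    simp only [hT]
    rw [he, sub_sub_cancel, smul_smul]
    rw [show 2 / (3 * α y) * (3 * α y / 2) = 1 by field_simp, one_smul]
  obtain ⟨F, hF, hFT, -⟩ := hTF z hz
  obtain ⟨i, j, hij⟩ : ∃ i j, frameForm F 0 i j ≠ 0 := by
    by_contra hcon
    push Not at hcon
    have h0 : frameForm F 0 = 0 := by ext i j; exact hcon i j
    have := hF.pair_frameForm 0 0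
    rw [h0, if_pos rfl, ← zero_smul ℝ (0 : Mat), pair_smul_left, zero_mul] at this
    norm_num at this
  have hpos : 0 < T z i j i j := by
    rw [hFT, tens_apply]
    exact mul_self_pos.2 hij
  have hcont : ContinuousOn (fun y => T y i j i j) V := (hTs i j i j).continuousOn
  -- Where the entry Σᵢⱼ is nonzero, the slice ΣₖₗΣᵢⱼ divided by |Σᵢⱼ| is Σ with the sign that makes
  -- the entry (i, j) positive.
  refine ⟨V ∩ (fun y => T y i j i j) ⁻¹' Set.Ioi 0, hcont.isOpen_inter_preimage h.isOpen isOpen_Ioi,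
    ⟨hz, hpos⟩, Set.inter_subset_left, fun y => Matrix.of fun k l => T y k l i j / √(T y i j i j),
    ?_⟩
  have key : ∀ y ∈ V ∩ (fun y => T y i j i j) ⁻¹' Set.Ioi 0, ∃ F : Mat, ∃ c : ℝ,
      IsCoframe F (G y) (s y) ∧
      c * c = 1 ∧ (Matrix.of fun k l => T y k l i j / √(T y i j i j) : Mat) = c • frameForm F 0 ∧
      weylPlus G s y = α y • selfDualProj (G y) (s y) -
      (3 * α y / 2) • tens (frameForm F 0) (frameForm F 0) := by
    rintro y ⟨hy, hy'⟩
    obtain ⟨F, hF, hFT, he⟩ := hTF y hy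
    have hp : 0 < T y i j i j := hy'
    refine ⟨F, frameForm F 0 i j / √(T y i j i j), hF, ?_, ?_, he⟩
    · rw [div_mul_div_comm, Real.mul_self_sqrt hp.le]
      have e : frameForm F 0 i j * frameForm F 0 i j = T y i j i j := by rw [hFT, tens_apply]
      rw [e, div_self hp.ne']
    · ext k l
      simp only [Matrix.of_apply, Matrix.smul_apply, smul_eq_mul]
      nth_rewrite 1 [hFT]
      rw [tens_apply]
      ring
  refine ⟨fun k l => ?_, fun y hy => ?_, fun y hy => ?_⟩
  · simp only [Matrix.of_apply]
    refine ((hTs k l i j).mono Set.inter_subset_left).div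
      (((hTs i j i j).mono Set.inter_subset_left).sqrt fun y hy => ?_) fun y hy => ?_
    · exact (show 0 < T y i j i j from hy.2).ne'
    · exact (Real.sqrt_pos.2 hy.2).ne'
  · obtain ⟨F, c, hF, hc, he, hW⟩ := key y hy
    rw [he, weylPlusEigenspace, hW]
    refine ⟨Submodule.smul_mem _ _ (hF.frameForm_mem 0), ?_⟩
    exact Submodule.smul_mem _ _ (Module.End.mem_eigenspace_iff.2
      (hF.frameForm_zero_mem_eigenspace (α y)))
  · obtain ⟨F, c, hF, hc, he, hW⟩ := key y hy
    simp only [he]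
    exact hF.isEigenform_smul hc

end FourGeom

/-! ### The covariant derivative of the eigenform, closedness and integrability -/

namespace FourGeom

open Matrix Filter Topology

variable {G S : R4 → Mat} {s α : R4 → ℝ} {V : Set R4} {z : R4}

/-! ### The covariant derivative of the eigenform -/

/-- The covariant derivatives `∇ₘ Sᵢⱼ` of a field of bilinear forms. -/
def covTwo (G S : R4 → Mat) (m : Fin 4) (z : R4) : Mat :=
  mpd m S z - (conn G m z)ᵀ * S z - S z * conn G m z

/-- The Leibniz rule for the normal form, valid near the point; the projection contributes no
derivative because it is parallel. -/
theorem IsTypeDOn.covDeriv_weylPlus (h : IsTypeDOn G s α V) (hS : IsEigenformOn G s α S V)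
    (hz : z ∈ V) (m i j k l : Fin 4) : covDeriv G (weylPlus G s) z m i j k l =
      pd m α z * selfDualProj (G z) (s z) i j k l - (3 / 2) *
        (pd m α z * (S z i j * S z k l) + α z * (covTwo G S m z i j * S z k l
          + S z i j * covTwo G S m z k l)) := by
  have e : weylPlus G s =ᶠ[𝓝 z] fun y => α y • selfDualProj (G y) (s y) -
      (3 * α y / 2) • tens (S y) (S y) :=
    mem_of_superset (h.isOpen.mem_nhds hz) fun y hy =>
      (h.exists_adapted hS hy).elim fun F hF => hF.2.2
  have hα : DifferentiableAt ℝ α z := differentiableAt_of_contDiffOn h.isOpen h.smooth_eigenvalue hz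
  have hP : DifferentiableAt ℝ (fun y => selfDualProj (G y) (s y) i j k l) z :=
    differentiableAt_of_contDiffOn h.isOpen (h.selfDualProj_smooth i j k l) hz
  have hd : MatDiffAt S z := hS.smooth.matDiffAt h.isOpen hz
  have h0 := h.covDeriv_selfDualProj hz (h.sign_eventually hz) m i j k l
  have hpd : pd m (fun y => (α y • selfDualProj (G y) (s y) -
      (3 * α y / 2) • tens (S y) (S y)) i j k l) z =
      α z * pd m (fun y => selfDualProj (G y) (s y) i j k l) z
        + pd m α z * selfDualProj (G z) (s z) i j k l
        - (3 / 2) * (α z * (S z i j * mpd m S z k l + mpd m S z i j * S z k l)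
          + pd m α z * (S z i j * S z k l)) := by
    have e2 : (fun y => (α y • selfDualProj (G y) (s y) -
        (3 * α y / 2) • tens (S y) (S y)) i j k l) = fun y =>
        α y * selfDualProj (G y) (s y) i j k l - (3 / 2) * (α y * (S y i j * S y k l)) := by
      funext y
      simp only [Pi.sub_apply, Pi.smul_apply, smul_eq_mul, tens_apply]
      ring
    have d1 := (hd i j).fun_mul (hd k l)
    rw [e2, pd_sub m (hα.fun_mul hP) ((hα.fun_mul d1).const_mul _), pd_mul m hα hP,
      pd_const_mul m (hα.fun_mul d1), pd_mul m hα d1, pd_mul m (hd i j) (hd k l)]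
    rfl
  rw [covDeriv_congr e]
  simp only [covDeriv] at h0 ⊢
  rw [hpd]
  simp only [covTwo, Matrix.sub_apply, Matrix.mul_apply, Matrix.transpose_apply, conn,
    Matrix.of_apply, Pi.sub_apply, Pi.smul_apply, smul_eq_mul, tens_apply, Fin.sum_univ_four]
    at h0 ⊢
  linear_combination α z * h0

theorem IsEigenformOn.transpose_eq_neg (hS : IsEigenformOn G s α S V)
    (hz : z ∈ V) : (S z)ᵀ = -S z := (hS.mem z hz).1.1

theorem IsTypeDOn.inv_mul_sq (h : IsTypeDOn G s α V) (hS : IsEigenformOn G s α S V)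
    (hz : z ∈ V) : ((G z)⁻¹ * S z) * ((G z)⁻¹ * S z) = -1 := by
  obtain ⟨F, hF, hSF, -⟩ := h.exists_adapted hS hz
  rw [hSF, hF.inv_mul_frameForm_sq]

theorem IsTypeDOn.mpd_inv_mul (h : IsTypeDOn G s α V) (hS : IsEigenformOn G s α S V)
    (hz : z ∈ V) (m : Fin 4) : mpd m (fun y => (G y)⁻¹ * S y) z =
      (G z)⁻¹ * covTwo G S m z - conn G m z * ((G z)⁻¹ * S z)
        + ((G z)⁻¹ * S z) * conn G m z := by
  have hu := h.isUnit_det hz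
  have hK : MatDiffAt (fun y => (G y)⁻¹ * S y) z :=
    (h.inv_smooth.mul hS.smooth).matDiffAt h.isOpen hz
  -- Differentiating S = G · (G⁻¹S) avoids differentiating the inverse metric.
  have e : S =ᶠ[𝓝 z] fun y => G y * ((G y)⁻¹ * S y) :=
    mem_of_superset (h.isOpen.mem_nhds hz) fun y hy => by
      change S y = G y * ((G y)⁻¹ * S y)
      rw [← Matrix.mul_assoc, Matrix.mul_nonsing_inv _ (h.isUnit_det hy), Matrix.one_mul]
  have e1 : mpd m S z = G z * mpd m (fun y => (G y)⁻¹ * S y) z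
      + ((conn G m z)ᵀ * S z + G z * (conn G m z * ((G z)⁻¹ * S z))) := by
    rw [mpd_congr m e, mpd_mul m (h.diff hz) hK, h.mpd_eq hz, Matrix.add_mul, Matrix.mul_assoc,
      Matrix.mul_nonsing_inv_cancel_left _ _ hu, Matrix.mul_assoc]
  rw [covTwo, e1]
  simp only [Matrix.mul_sub, Matrix.mul_add, Matrix.nonsing_inv_mul_cancel_left _ _ hu,
    Matrix.mul_assoc]
  abel

/-- Constancy of the norm, in the guise of K² = −1: differentiate, multiply by K and take the trace.
The connection terms cancel by cyclicity and leave the trace of K∇K. -/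
theorem IsTypeDOn.pair_covTwo (h : IsTypeDOn G s α V) (hS : IsEigenformOn G s α S V)
    (hz : z ∈ V) (m : Fin 4) : pair (G z) (S z) (covTwo G S m z) = 0 := by
  have hK : MatDiffAt (fun y => (G y)⁻¹ * S y) z :=
    (h.inv_smooth.mul hS.smooth).matDiffAt h.isOpen hz
  have e : (fun y => ((G y)⁻¹ * S y) * ((G y)⁻¹ * S y)) =ᶠ[𝓝 z] fun _ => (-1 : Mat) :=
    mem_of_superset (h.isOpen.mem_nhds hz) fun y hy => h.inv_mul_sq hS hy
  have h1 := mpd_congr m e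
  rw [mpd_const, mpd_mul m hK hK, h.mpd_inv_mul hS hz] at h1
  have h2 := congrArg Matrix.trace h1
  set K := (G z)⁻¹ * S z with hKdef
  set X := (G z)⁻¹ * covTwo G S m z with hX
  rw [pair_eq_trace, hS.transpose_eq_neg hz, Matrix.transpose_nonsing_inv, h.transpose_eq hz,
    Matrix.mul_assoc (-S z), ← hX, Matrix.trace_mul_comm, ← Matrix.mul_assoc, Matrix.mul_neg,
    ← hKdef, Matrix.neg_mul, Matrix.trace_neg]
  simp only [Matrix.mul_add, Matrix.mul_sub, Matrix.add_mul, Matrix.sub_mul, Matrix.trace_add,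
    Matrix.trace_sub, Matrix.trace_zero] at h2
  rw [Matrix.trace_mul_comm X K, Matrix.trace_mul_comm (conn G m z * K) K,
    Matrix.trace_mul_comm (K * conn G m z) K] at h2
  have h3 := Matrix.trace_mul_cycle K (conn G m z) K
  rw [Matrix.mul_assoc K (conn G m z) K, Matrix.mul_assoc K K] at h3
  linarith

theorem IsTypeDOn.exists_covTwo_eq (h : IsTypeDOn G s α V) (hS : IsEigenformOn G s α S V)
    (hdiv : ∀ j k l, divergence G (weylPlus G s) z j k l = 0) (hz : z ∈ V) :
    ∃ F, IsCoframe F (G z) (s z) ∧ S z = frameForm F 0 ∧ ∀ p, (3 * α z) • covTwo G S p z =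
      contr (frameForm F 1) ((fun m => pd m α z) ᵥ* (G z)⁻¹) p • frameForm F 2
      - contr (frameForm F 2) ((fun m => pd m α z) ᵥ* (G z)⁻¹) p • frameForm F 1 := by
  obtain ⟨F, hF, hSF, -⟩ := h.exists_adapted hS hz
  refine ⟨F, hF, hSF, hF.covariant_derivative_eq (fun m => ?_) fun j k l => ?_⟩
  · rw [← hSF]
    exact h.pair_covTwo hS hz m
  · rw [← hSF, ← hdiv j k l, divergence]
    exact Finset.sum_congr rfl fun m _ => Finset.sum_congr rfl fun i _ => by
      rw [h.covDeriv_weylPlus hS hz]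

/-! ### Closedness of the Kähler form -/

theorem hasDerivAt_abs_rpow {x : ℝ} (hx : x ≠ 0) (p : ℝ) :
    HasDerivAt (fun y : ℝ => |y| ^ p) (p * |x| ^ p / x) x := by
  have h := (hasDerivAt_abs hx).rpow_const (p := p) (Or.inl (abs_ne_zero.2 hx))
  convert h using 1
  rw [Real.rpow_sub_one (abs_ne_zero.2 hx)]
  rcases lt_or_gt_of_ne hx with h | h
  · rw [abs_of_neg h, sign_neg h]
    simp
    field_simp
  · rw [abs_of_pos h, sign_pos h]
    simp
    field_simp

theorem IsTypeDOn.extDerivTwo_eq_zero (h : IsTypeDOn G s α V) (hS : IsEigenformOn G s α S V)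
    (hdiv : ∀ j k l, divergence G (weylPlus G s) z j k l = 0) (hz : z ∈ V) (i j k : Fin 4) :
    extDerivTwo (fun y => |α y| ^ (2 / 3 : ℝ) • S y) z i j k = 0 := by
  obtain ⟨F, hF, hSF, hD⟩ := h.exists_covTwo_eq hS hdiv hz
  have h0 : α z ≠ 0 := (h.exists_coframe hz).1
  have hα : DifferentiableAt ℝ α z := differentiableAt_of_contDiffOn h.isOpen h.smooth_eigenvalue hz
  have hd : MatDiffAt S z := hS.smooth.matDiffAt h.isOpen hz
  have hu := h.isUnit_det hz
  have hc : contr (Fᵀ * F) ((fun m => pd m α z) ᵥ* (G z)⁻¹) = fun m => pd m α z := by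
    rw [contr_eq, hF.eq, Matrix.vecMul_vecMul, Matrix.nonsing_inv_mul _ hu, Matrix.vecMul_one]
  have hcyc := frameForm_cyclic F ((fun m => pd m α z) ᵥ* (G z)⁻¹) i j k
  rw [hc, ← hSF] at hcyc
  have hD' : ∀ p a b, 3 * α z * covTwo G S p z a b =
      contr (frameForm F 1) ((fun m => pd m α z) ᵥ* (G z)⁻¹) p * frameForm F 2 a b
      - contr (frameForm F 2) ((fun m => pd m α z) ᵥ* (G z)⁻¹) p * frameForm F 1 a b :=
    fun p a b => congrFun (congrFun (hD p) a) b
  rw [← hD', ← hD', ← hD'] at hcyc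
  have hpd : ∀ p a b, pd p (fun y => (|α y| ^ (2 / 3 : ℝ) • S y) a b) z =
      |α z| ^ (2 / 3 : ℝ) * mpd p S z a b
      + (2 / 3) * |α z| ^ (2 / 3 : ℝ) / α z * pd p α z * S z a b := by
    intro p a b
    have h1 := hasDerivAt_abs_rpow h0 (2 / 3)
    have := pd_mul p (h1.differentiableAt.comp z hα) (hd a b)
    rw [show (fun y : ℝ => |y| ^ (2 / 3 : ℝ)) ∘ α = fun y => |α y| ^ (2 / 3 : ℝ) from rfl,
      pd_real_comp p h1 hα] at this
    exact this
  -- With skewness and torsion-freeness, the Christoffel terms drop out of the cyclic sum and ∂ may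
  -- replace ∇.
  have hskew : ∀ a b, S z a b = -S z b a := fun a b =>
    congrFun (congrFun (hS.transpose_eq_neg hz) b) a
  have hcov : covTwo G S i z j k + covTwo G S j z k i + covTwo G S k z i j =
      mpd i S z j k + mpd j S z k i + mpd k S z i j := by
    have e1 : ∀ p a b, (S z * conn G p z) a b = -((conn G p z)ᵀ * S z) b a := by
      intro p a b
      simp only [Matrix.mul_apply, Matrix.transpose_apply, ← Finset.sum_neg_distrib]
      exact Finset.sum_congr rfl fun c _ => by rw [hskew a c]; ring
    have e2 : ∀ p a b, ((conn G p z)ᵀ * S z) a b = ((conn G a z)ᵀ * S z) p b := by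
      intro p a b
      simp only [Matrix.mul_apply, Matrix.transpose_apply, conn, Matrix.of_apply]
      exact Finset.sum_congr rfl fun c _ => by rw [h.christoffel_symm hz c p a]
    simp only [covTwo, Matrix.sub_apply, e1]
    rw [e2 i j k, e2 j k i, e2 k i j]
    ring
  simp only [extDerivTwo, hpd]
  field_simp
  -- Here `hcyc` says 3α dΣ + 2 dα ∧ Σ = 0 with covariant derivatives, and `hcov` replaces these by
  -- partial ones.
  linear_combination |α z| ^ (2 / 3 : ℝ) * (hcyc - 3 * α z * hcov)

/-! ### Integrability of the almost complex structure -/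

/-- Symmetry of the lower Christoffel indices cancels all connection terms. The Nijenhuis tensor may
therefore be computed with ∇ in place of ∂. -/
theorem nijenhuis_connection {K : Mat} {C : Fin 4 → Mat} (hC : ∀ l a k, C l a k = C k a l)
    (i j k : Fin 4) :
    ∑ l, (K l j * ((C l * K) i k - (K * C l) i k) - K l k * ((C l * K) i j - (K * C l) i j)
      - K i l * (((C j * K) l k - (K * C j) l k) - ((C k * K) l j - (K * C k) l j))) = 0 := by
  have hA : ∀ j k, ∑ l, K l j * (C l * K) i k = ∑ l, ∑ a, K l j * (C l i a * K a k) := fun j k =>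
    Finset.sum_congr rfl fun l _ => by rw [Matrix.mul_apply, Finset.mul_sum]
  have h1 : ∑ l, K l j * (C l * K) i k = ∑ l, K l k * (C l * K) i j := by
    rw [hA, hA, Finset.sum_comm]
    exact Finset.sum_congr rfl fun l _ => Finset.sum_congr rfl fun a _ => by rw [hC a i l]; ring
  have h2 : ∀ j k, ∑ l, K l j * (K * C l) i k = ∑ l, K i l * (C k * K) l j := by
    intro j k
    simp only [Matrix.mul_apply, Finset.mul_sum]
    rw [Finset.sum_comm]
    exact Finset.sum_congr rfl fun l _ => Finset.sum_congr rfl fun a _ => by rw [hC a l k]; ring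
  have h3 : ∑ l, K i l * (K * C j) l k = ∑ l, K i l * (K * C k) l j := by
    refine Finset.sum_congr rfl fun l _ => ?_
    simp only [Matrix.mul_apply]
    congr 1
    exact Finset.sum_congr rfl fun a _ => by rw [hC j a k]
  simp only [mul_sub, Finset.sum_sub_distrib]
  rw [h1, h2 j k, h2 k j, h3]
  ring

theorem nijenhuis_congr {J J' : R4 → Mat} (e : J =ᶠ[𝓝 z] J') (i j k : Fin 4) :
    nijenhuis J z i j k = nijenhuis J' z i j k := by
  have h1 : ∀ l a b, pd l (fun y => J y a b) z = pd l (fun y => J' y a b) z := fun l a b =>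
    pd_congr l (e.mono fun y hy => congrFun (congrFun hy a) b)
  simp only [nijenhuis, e.self_of_nhds, h1]

theorem nijenhuis_neg (J : R4 → Mat) (i j k : Fin 4) :
    nijenhuis (fun y => -J y) z i j k = nijenhuis J z i j k := by
  simp only [nijenhuis, Matrix.neg_apply, pd_neg]
  exact Finset.sum_congr rfl fun l _ => by ring

theorem IsTypeDOn.nijenhuis_eq_zero (h : IsTypeDOn G s α V) (hS : IsEigenformOn G s α S V)
    (hdiv : ∀ j k l, divergence G (weylPlus G s) z j k l = 0) (hz : z ∈ V) (i j k : Fin 4) :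
    nijenhuis (fun y => (G y)⁻¹ * (S y)ᵀ) z i j k = 0 := by
  -- Lowering with g(Ju, v) = Σ(u, v) puts the transpose in J = G⁻¹Sᵀ = −G⁻¹S; the Nijenhuis tensor
  -- is quadratic, so the sign is harmless.
  have e : (fun y => (G y)⁻¹ * (S y)ᵀ) =ᶠ[𝓝 z] fun y => -((G y)⁻¹ * S y) :=
    mem_of_superset (h.isOpen.mem_nhds hz) fun y hy => by
      change (G y)⁻¹ * (S y)ᵀ = -((G y)⁻¹ * S y)
      rw [hS.transpose_eq_neg hy, Matrix.mul_neg]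
  rw [nijenhuis_congr e, nijenhuis_neg]
  obtain ⟨F, hF, hSF, hD⟩ := h.exists_covTwo_eq hS hdiv hz
  have h0 : α z ≠ 0 := (h.exists_coframe hz).1
  have h1 := hF.nijenhuis_algebra ((fun m => pd m α z) ᵥ* (G z)⁻¹) (K := (G z)⁻¹ * S z)
    (K' := fun m => (G z)⁻¹ * covTwo G S m z) (by rw [hSF]) (3 * α z) (fun m => by
      rw [← Matrix.mul_smul, hD, Matrix.mul_sub, Matrix.mul_smul, Matrix.mul_smul])
    (mul_ne_zero three_ne_zero h0) i j k
  have h2 := nijenhuis_connection (K := (G z)⁻¹ * S z) (C := fun l => conn G l z)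
    (fun l a k => h.christoffel_symm hz a l k) i j k
  have h3 : ∀ l a b, pd l (fun y => ((G y)⁻¹ * S y) a b) z = ((G z)⁻¹ * covTwo G S l z) a b -
      (conn G l z * ((G z)⁻¹ * S z)) a b + (((G z)⁻¹ * S z) * conn G l z) a b := fun l a b =>
    congrFun (congrFun (h.mpd_inv_mul hS hz l) a) b
  simp only [nijenhuis, h3]
  refine Eq.trans ?_ (congrArg₂ (· - ·) h1 h2 |>.trans (sub_zero 0))
  rw [← Finset.sum_sub_distrib]
  exact Finset.sum_congr rfl fun l _ => by ring

end FourGeom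

/-! ### Transformation of connection, curvature and W⁺ under coordinate changes -/

namespace FourGeom

open Matrix Filter Topology

variable {G G' : R4 → Mat} {V V' : Set R4} {z : R4} {φ : R4 → R4}

/-! ### Change of coordinates -/

/-- The `a`-th coordinate function. -/
def coord (a : Fin 4) : R4 →L[ℝ] ℝ := EuclideanSpace.proj a

/-- The Jacobian matrix `∂ᵢ φᵃ`. -/
def jac (φ : R4 → R4) (z : R4) : Mat := Matrix.of fun a i => pd i (fun y => φ y a) z

theorem pd_eq_fderiv_apply (hφ : DifferentiableAt ℝ φ z) (a i : Fin 4) :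
    pd i (fun y => φ y a) z = fderiv ℝ φ z (EuclideanSpace.single i (1 : ℝ)) a := by
  have h := ((coord a).hasFDerivAt.comp z
    hφ.hasFDerivAt).fderiv
  rw [pd]
  change fderiv ℝ (⇑(coord a) ∘ φ) z _ = _
  rw [h]
  rfl

theorem eq_sum_single (v : R4) : v = ∑ a, v a • EuclideanSpace.single a (1 : ℝ) := by
  ext b
  simp [Fin.sum_univ_four]
  fin_cases b <;> simp

theorem pd_comp {f : R4 → ℝ} (hf : DifferentiableAt ℝ f (φ z)) (hφ : DifferentiableAt ℝ φ z)
    (i : Fin 4) : pd i (fun y => f (φ y)) z = ∑ a, jac φ z a i * pd a f (φ z) := by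
  have h := (hf.hasFDerivAt.comp z hφ.hasFDerivAt).fderiv
  rw [pd]
  change fderiv ℝ (f ∘ φ) z _ = _
  rw [h, ContinuousLinearMap.comp_apply, eq_sum_single (fderiv ℝ φ z _), map_sum]
  refine Finset.sum_congr rfl fun a _ => ?_
  rw [map_smul, smul_eq_mul, jac, Matrix.of_apply, pd_eq_fderiv_apply hφ]
  rfl

theorem mpd_comp {A : R4 → Mat} (hA : MatDiffAt A (φ z)) (hφ : DifferentiableAt ℝ φ z)
    (i : Fin 4) : mpd i (fun y => A (φ y)) z = ∑ a, jac φ z a i • mpd a A (φ z) := by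
  ext b c
  simp only [Matrix.sum_apply, Matrix.smul_apply, smul_eq_mul]
  exact pd_comp (hA b c) hφ i

theorem mpd_smul {f : R4 → ℝ} {A : R4 → Mat} (hf : DifferentiableAt ℝ f z) (hA : MatDiffAt A z)
    (i : Fin 4) : mpd i (fun y => f y • A y) z = f z • mpd i A z + pd i f z • A z := by
  ext b c
  exact pd_mul i hf (hA b c)

theorem mpd_sum {A : Fin 4 → R4 → Mat} (hA : ∀ a, MatDiffAt (A a) z) (i : Fin 4) :
    mpd i (fun y => ∑ a, A a y) z = ∑ a, mpd i (A a) z := by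
  ext b c
  simp only [mpd, Matrix.of_apply, Matrix.sum_apply]
  exact pd_sum i _ fun a => hA a b c

theorem MatDiffAt.comp {A : R4 → Mat} (hA : MatDiffAt A (φ z)) (hφ : DifferentiableAt ℝ φ z) :
    MatDiffAt (fun y => A (φ y)) z := fun a b => (hA a b).comp z hφ

theorem MatDiffAt.smul {f : R4 → ℝ} {A : R4 → Mat} (hf : DifferentiableAt ℝ f z)
    (hA : MatDiffAt A z) : MatDiffAt (fun y => f y • A y) z := fun a b => hf.fun_mul (hA a b)

theorem MatDiffAt.sum {A : Fin 4 → R4 → Mat} (hA : ∀ a, MatDiffAt (A a) z) :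
    MatDiffAt (fun y => ∑ a, A a y) z := by
  intro b c
  simp only [Matrix.sum_apply]
  exact DifferentiableAt.fun_sum fun a _ => hA a b c

/-- Koszul's argument: symmetry in the lower indices and metric compatibility determine the lowered
coefficients, and the metric is invertible. -/
theorem IsMetricOn.conn_unique (h : IsMetricOn G V) (hz : z ∈ V) {C : Fin 4 → Mat}
    (hC : ∀ i k j, C i k j = C j k i) (hG : ∀ i, mpd i G z = (C i)ᵀ * G z + G z * C i)
    (i : Fin 4) : conn G i z = C i := by
  have hL : ∀ i l j, (G z * C i) l j = (G z * C j) l i := fun i l j => by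
    simp only [Matrix.mul_apply]
    exact Finset.sum_congr rfl fun k _ => by rw [hC]
  have hp : ∀ i l j, pd i (fun y => G y l j) z = (G z * C i) j l + (G z * C i) l j := by
    intro i l j
    have e : (C i)ᵀ * G z = (G z * C i)ᵀ := by rw [Matrix.transpose_mul, h.transpose_eq hz]
    exact (congrFun (congrFun (hG i) l) j).trans (by rw [e]; rfl)
  have key : G z * conn G i z = G z * C i := by
    ext l j
    have := h.lower_christoffel hz l i j
    rw [hp, hp, hp] at this
    refine Eq.trans (by rw [Matrix.mul_apply]; rfl) (this.trans ?_)
    rw [hL i j l, hL j i l, hL j l i]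
    ring
  rw [← Matrix.nonsing_inv_mul_cancel_left (A := G z) (conn G i z) (h.isUnit_det hz), key,
    Matrix.nonsing_inv_mul_cancel_left _ _ (h.isUnit_det hz)]

/-- `φ` pulls the metric `G` on `V` back to the metric `G'` on `V'`. -/
structure IsPullback (φ : R4 → R4) (G G' : R4 → Mat) (V V' : Set R4) : Prop where
  metric : IsMetricOn G V
  metric' : IsMetricOn G' V'
  smooth : ContDiffOn ℝ ∞ φ V'
  mapsTo : ∀ z ∈ V', φ z ∈ V
  eq : ∀ z ∈ V', G' z = (jac φ z)ᵀ * G (φ z) * jac φ z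

/-- The pulled back connection matrices. -/
def pullConn (φ : R4 → R4) (G : R4 → Mat) (i : Fin 4) (z : R4) : Mat :=
  ∑ a, jac φ z a i • conn G a (φ z)

section

variable (h : IsPullback φ G G' V V') (hz : z ∈ V')
include h

theorem IsPullback.jac_smooth : MatSmoothOn (jac φ) V' := fun a i =>
  contDiffOn_pd i h.metric'.isOpen ((coord a).contDiff.comp_contDiffOn h.smooth)

include hz

theorem IsPullback.isUnit_det : IsUnit (jac φ z).det := by
  have h1 := h.metric'.isUnit_det hz
  rw [h.eq z hz, Matrix.det_mul] at h1
  exact isUnit_of_mul_isUnit_right h1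

theorem IsPullback.diff : DifferentiableAt ℝ φ z :=
  (h.smooth.contDiffAt (h.metric'.isOpen.mem_nhds hz)).differentiableAt (by simp)

theorem IsPullback.mpd_jac_symm (i j a : Fin 4) : mpd i (jac φ) z a j = mpd j (jac φ) z a i :=
  pd_comm i j h.metric'.isOpen ((coord a).contDiff.comp_contDiffOn h.smooth) hz

theorem IsPullback.jac_mul_conn (i : Fin 4) :
    jac φ z * conn G' i z = pullConn φ G i z * jac φ z + mpd i (jac φ) z := by
  have hu := h.isUnit_det hz
  have hA := h.jac_smooth.matDiffAt h.metric'.isOpen hz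
  have hG : MatDiffAt (fun y => G (φ y)) z := (h.metric.diff (h.mapsTo z hz)).comp (h.diff hz)
  -- The candidate given by the classical transformation law; it is symmetric and metric, so
  -- uniqueness identifies it with the Levi-Civita connection.
  set C : Fin 4 → Mat := fun i =>
    (jac φ z)⁻¹ * (pullConn φ G i z * jac φ z + mpd i (jac φ) z) with hCdef
  have hAC : ∀ i, jac φ z * C i = pullConn φ G i z * jac φ z + mpd i (jac φ) z := fun i =>
    Matrix.mul_nonsing_inv_cancel_left _ _ hu
  have hC : ∀ i k j, C i k j = C j k i := by
    intro i k j
    have e : ∀ i b j, (pullConn φ G i z * jac φ z) b j = (pullConn φ G j z * jac φ z) b i := by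
      intro i b j
      simp only [pullConn, Matrix.mul_apply, Matrix.sum_apply, Matrix.smul_apply, smul_eq_mul,
        Finset.sum_mul]
      rw [Finset.sum_comm]
      refine Finset.sum_congr rfl fun a _ => Finset.sum_congr rfl fun c _ => ?_
      simp only [conn, Matrix.of_apply]
      rw [h.metric.christoffel_symm (h.mapsTo z hz) b a c]
      ring
    simp only [hCdef]
    rw [Matrix.mul_apply, Matrix.mul_apply]
    refine Finset.sum_congr rfl fun b _ => ?_
    rw [Matrix.add_apply, Matrix.add_apply, e i b j, h.mpd_jac_symm hz i j b]
  have hm : ∀ i, mpd i (fun y => G (φ y)) z =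
      (pullConn φ G i z)ᵀ * G (φ z) + G (φ z) * pullConn φ G i z := by
    intro i
    rw [mpd_comp (h.metric.diff (h.mapsTo z hz)) (h.diff hz)]
    simp only [pullConn, Matrix.transpose_sum, Finset.sum_mul, Finset.mul_sum,
      h.metric.mpd_eq (h.mapsTo z hz), smul_add, Finset.sum_add_distrib, Matrix.transpose_smul,
      Matrix.smul_mul, Matrix.mul_smul]
  rw [h.metric'.conn_unique hz hC (fun i => ?_) i, hAC]
  have e : G' =ᶠ[𝓝 z] fun y => (jac φ y)ᵀ * G (φ y) * jac φ y :=
    mem_of_superset (h.metric'.isOpen.mem_nhds hz) h.eq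
  have hAC' : (C i)ᵀ * (jac φ z)ᵀ = (jac φ z)ᵀ * (pullConn φ G i z)ᵀ + (mpd i (jac φ) z)ᵀ := by
    rw [← Matrix.transpose_mul, hAC, Matrix.transpose_add, Matrix.transpose_mul]
  rw [mpd_congr i e, mpd_mul i (hA.transpose.mul hG) hA, mpd_mul i hA.transpose hG, mpd_transpose,
    hm, h.eq z hz, Matrix.mul_assoc _ (jac φ z) (C i), hAC, ← Matrix.mul_assoc (C i)ᵀ,
    ← Matrix.mul_assoc (C i)ᵀ, hAC']
  simp only [Matrix.mul_add, Matrix.add_mul, Matrix.mul_assoc]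
  abel

theorem IsPullback.jac_mul_curv (i j : Fin 4) : jac φ z * curv G' i j z =
    (∑ a, ∑ b, (jac φ z a i * jac φ z b j) • curv G a b (φ z)) * jac φ z := by
  have hA := h.jac_smooth.matDiffAt h.metric'.isOpen hz
  have hΓ : ∀ a, MatDiffAt (conn G a) (φ z) := fun a => h.metric.conn_diff (h.mapsTo z hz) a
  have hΓφ : ∀ a, MatDiffAt (fun y => conn G a (φ y)) z := fun a => (hΓ a).comp (h.diff hz)
  have hB : ∀ i, MatDiffAt (pullConn φ G i) z := fun i =>
    MatDiffAt.sum fun a => MatDiffAt.smul (hA a i) (hΓφ a)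
  have e : ∀ j, (fun y => jac φ y * conn G' j y) =ᶠ[𝓝 z]
      fun y => pullConn φ G j y * jac φ y + mpd j (jac φ) y := fun j =>
    mem_of_superset (h.metric'.isOpen.mem_nhds hz) fun y hy => h.jac_mul_conn hy j
  have hdA : ∀ j, MatDiffAt (mpd j (jac φ)) z := fun j =>
    (h.jac_smooth.mpd j h.metric'.isOpen).matDiffAt h.metric'.isOpen hz
  -- The derivative of the transformation law. All terms in derivatives of the Jacobian matrix that
  -- are written out here are symmetric in i and j, so they cancel in the curvature; `h6` treats
  -- those hidden in the derivative of `pullConn`.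
  have h1 : ∀ i j, jac φ z * (mpd i (conn G' j) z + conn G' i z * conn G' j z) =
      (mpd i (pullConn φ G j) z + pullConn φ G i z * pullConn φ G j z) * jac φ z
      + (pullConn φ G j z * mpd i (jac φ) z + pullConn φ G i z * mpd j (jac φ) z)
      + mpd i (mpd j (jac φ)) z := by
    intro i j
    have h2 := mpd_congr i (e j)
    rw [mpd_mul i hA (h.metric'.conn_diff hz j), mpd_add i ((hB j).mul hA) (hdA j),
      mpd_mul i (hB j) hA] at h2
    rw [Matrix.mul_add, eq_sub_of_add_eq h2, ← Matrix.mul_assoc, h.jac_mul_conn hz i,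
      Matrix.add_mul, Matrix.mul_assoc _ (jac φ z), h.jac_mul_conn hz j, Matrix.mul_add,
      Matrix.add_mul, Matrix.mul_assoc _ _ (jac φ z)]
    abel
  have h3 : ∀ i j, mpd i (pullConn φ G j) z =
      ∑ a, mpd i (jac φ) z a j • conn G a (φ z)
      + ∑ a, ∑ b, (jac φ z a i * jac φ z b j) • mpd a (conn G b) (φ z) := by
    intro i j
    have : mpd i (pullConn φ G j) z = _ :=
      mpd_sum (fun a => MatDiffAt.smul (hA a j) (hΓφ a)) i
    rw [this, Finset.sum_comm (f := fun a b => (jac φ z a i * jac φ z b j) • _),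
      ← Finset.sum_add_distrib]
    refine Finset.sum_congr rfl fun a _ => ?_
    rw [mpd_smul (hA a j) (hΓφ a), mpd_comp (hΓ a) (h.diff hz), Finset.smul_sum, add_comm]
    congr 1
    exact Finset.sum_congr rfl fun b _ => by rw [smul_smul, mul_comm]
  have h4 : ∀ i j, pullConn φ G i z * pullConn φ G j z =
      ∑ a, ∑ b, (jac φ z a i * jac φ z b j) • (conn G a (φ z) * conn G b (φ z)) := by
    intro i j
    simp only [pullConn, Finset.sum_mul, Finset.mul_sum, Matrix.smul_mul, Matrix.mul_smul,
      smul_smul]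
    rw [Finset.sum_comm]
    exact Finset.sum_congr rfl fun _ _ => Finset.sum_congr rfl fun _ _ => by rw [mul_comm]
  have h5 : ∀ H : Fin 4 → Fin 4 → Mat, ∑ a, ∑ b, (jac φ z a j * jac φ z b i) • H a b =
      ∑ a, ∑ b, (jac φ z a i * jac φ z b j) • H b a := by
    intro H
    rw [Finset.sum_comm]
    exact Finset.sum_congr rfl fun _ _ => Finset.sum_congr rfl fun _ _ => by rw [mul_comm]
  have h6 : ∑ a, mpd i (jac φ) z a j • conn G a (φ z) =
      ∑ a, mpd j (jac φ) z a i • conn G a (φ z) :=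
    Finset.sum_congr rfl fun a _ => by rw [h.mpd_jac_symm hz]
  calc jac φ z * curv G' i j z
      = jac φ z * (mpd i (conn G' j) z + conn G' i z * conn G' j z)
        - jac φ z * (mpd j (conn G' i) z + conn G' j z * conn G' i z) := by
        rw [curv_eq, ← Matrix.mul_sub]
        congr 1
        abel
    _ = ((mpd i (pullConn φ G j) z + pullConn φ G i z * pullConn φ G j z)
        - (mpd j (pullConn φ G i) z + pullConn φ G j z * pullConn φ G i z)) * jac φ z := by
        rw [h1, h1, mpd_comm i j h.metric'.isOpen h.jac_smooth hz, Matrix.sub_mul]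
        abel
    _ = _ := by
        congr 1
        rw [h3, h3, h4, h4, h6, h5, h5]
        simp only [curv_eq, smul_add, smul_sub, Finset.sum_add_distrib, Finset.sum_sub_distrib]
        abel

theorem IsPullback.riemann_eq : riemann G' z = pull4 (jac φ z) (riemann G (φ z)) := by
  funext k l i j
  have e : G' z * curv G' i j z = ∑ a, ∑ b, (jac φ z a i * jac φ z b j) •
      ((jac φ z)ᵀ * (G (φ z) * curv G a b (φ z)) * jac φ z) := by
    rw [h.eq z hz, Matrix.mul_assoc, h.jac_mul_curv hz]
    simp only [Finset.mul_sum, Finset.sum_mul, Matrix.mul_smul, Matrix.smul_mul, Matrix.mul_assoc]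
  rw [FourGeom.riemann_eq, e, pull4, sum_pairs_comm]
  simp only [Matrix.sum_apply, Matrix.smul_apply, smul_eq_mul, pull_apply, Finset.mul_sum]
  refine Finset.sum_congr rfl fun _ _ => Finset.sum_congr rfl fun _ _ =>
    Finset.sum_congr rfl fun _ _ => Finset.sum_congr rfl fun _ _ => ?_
  rw [FourGeom.riemann_eq]
  ring

theorem IsPullback.mem_weylPlusEigenspace {s s' : R4 → ℝ}
    (hs : s' z * |(jac φ z).det| = s (φ z) * (jac φ z).det) {a : ℝ} {σ : Mat}
    (hσ : σ ∈ weylPlusEigenspace G s (φ z) a) :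
    (jac φ z)ᵀ * σ * jac φ z ∈ weylPlusEigenspace G' s' z a := by
  have hA := (h.isUnit_det hz).ne_zero
  obtain ⟨h1, h2⟩ := hσ
  have h3 := Module.End.mem_eigenspace_iff.1 h2
  rw [weylPlus_eq_weylPlusOf G s (φ z) (h.metric.det_ne (h.mapsTo z hz))] at h3
  refine ⟨?_, Module.End.mem_eigenspace_iff.2 ?_⟩
  · rw [h.eq z hz]
    exact mem_selfDual_pull _ _ _ _ hA hs h1
  · rw [weylPlus_eq_weylPlusOf G' s' z (h.metric'.det_ne hz), h.riemann_eq hz, h.eq z hz,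
      weylPlusOf_pull _ _ _ _ hA hs, twoFormOp_pull4 _ _ hA, h3, Matrix.mul_smul, Matrix.smul_mul]

end

end FourGeom

/-! ### Charts, frames, orientation and the conformal metric on the manifold -/

namespace FourGeom

open Matrix Filter Topology Bundle

section Manifold

variable {M : Type*} [TopologicalSpace M] [ChartedSpace R4 M]
  {e e₀ : OpenPartialHomeomorph M R4} {z : R4} {x : M}

/-! ### Coordinate frames -/

theorem mdifferentiable_of_mem_charts (he : e ∈ charts M) : e.MDifferentiable (𝓡 4) (𝓡 4) :=
  ⟨(contMDiffOn_of_mem_maximalAtlas he).mdifferentiableOn (by simp),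
    (contMDiffOn_symm_of_mem_maximalAtlas he).mdifferentiableOn (by simp)⟩

/-- The components of a tangent vector in the chart `e`. -/
def vecComp (e : OpenPartialHomeomorph M R4) (x : M) : TangentSpace (𝓡 4) x →L[ℝ] R4 :=
  mfderiv (𝓡 4) (𝓡 4) e x

/-- The coordinate vector `∂ᵢ` of the chart `e` at the point `x`. -/
def frameAt (e : OpenPartialHomeomorph M R4) (x : M) (i : Fin 4) : TangentSpace (𝓡 4) x :=
  (mfderiv (𝓡 4) (𝓡 4) e.symm (e x) : R4 →L[ℝ] R4) (EuclideanSpace.single i (1 : ℝ))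

theorem bilinComp_eq (B : BilinField M) (hx : x ∈ e.source) (i j : Fin 4) :
    bilinComp e B (e x) i j = B x (frameAt e x i) (frameAt e x j) := by
  -- All tangent spaces unfold to the model space, so the base point can be replaced while the
  -- vectors are kept.
  have h : ∀ y : M, y = x → ∀ v w : R4, B y v w = B x v w := by
    rintro y rfl v w
    rfl
  exact h _ (e.left_inv hx) _ _

/-- The transition map from the chart `e` to the chart `e₀`. -/
def transition (e₀ e : OpenPartialHomeomorph M R4) : R4 → R4 := e₀ ∘ e.symm

theorem contDiffOn_transition (he : e ∈ charts M) (he₀ : e₀ ∈ charts M) :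
    ContDiffOn ℝ ∞ (transition e₀ e) (e.target ∩ e.symm ⁻¹' e₀.source) :=
  ((contMDiffOn_of_mem_maximalAtlas he₀).comp' (contMDiffOn_symm_of_mem_maximalAtlas he)).contDiffOn

theorem vecComp_frameAt (he : e ∈ charts M) (hx : x ∈ e.source) (i : Fin 4) :
    vecComp e x (frameAt e x i) = EuclideanSpace.single i (1 : ℝ) := by
  have h := (mdifferentiable_of_mem_charts he).comp_symm_deriv (e.map_source hx)
  rw [e.left_inv hx] at h
  exact DFunLike.congr_fun h (EuclideanSpace.single i (1 : ℝ) : R4)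

theorem vecComp_injective (he : e ∈ charts M) (hx : x ∈ e.source) :
    Function.Injective (vecComp e x) :=
  (mdifferentiable_of_mem_charts he).mfderiv_injective hx

theorem eq_sum_frameAt (he : e ∈ charts M) (hx : x ∈ e.source) (u : TangentSpace (𝓡 4) x) :
    u = ∑ i, vecComp e x u i • frameAt e x i := by
  apply vecComp_injective he hx
  rw [map_sum]
  simp only [map_smul, vecComp_frameAt he hx]
  exact eq_sum_single _

theorem bilin_eq_sum (he : e ∈ charts M) (hx : x ∈ e.source) (B : BilinField M)
    (u v : TangentSpace (𝓡 4) x) :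
    B x u v = ∑ i, ∑ j, vecComp e x u i * vecComp e x v j * bilinComp e B (e x) i j := by
  conv_lhs => rw [eq_sum_frameAt he hx u, eq_sum_frameAt he hx v]
  simp only [map_sum, map_smul, _root_.sum_apply, _root_.smul_apply,
    smul_eq_mul, bilinComp_eq B hx, Finset.mul_sum]
  rw [Finset.sum_comm]
  exact Finset.sum_congr rfl fun i _ => Finset.sum_congr rfl fun j _ => by ring

theorem vecComp_endo (he : e ∈ charts M) (hx : x ∈ e.source) (J : EndField M)
    (u : TangentSpace (𝓡 4) x) (i : Fin 4) :
    vecComp e x (J x u) i = ∑ j, endComp e J (e x) i j * vecComp e x u j := by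
  have h : ∀ y : M, y = x → ∀ v : R4, vecComp e y (J y v) i = vecComp e x (J x v) i := by
    rintro y rfl v
    rfl
  have h1 : ∀ j, endComp e J (e x) i j = vecComp e x (J x (frameAt e x j)) i := fun j =>
    h _ (e.left_inv hx) _
  conv_lhs => rw [eq_sum_frameAt he hx u]
  simp only [map_sum, map_smul, h1]
  simp [mul_comm]

/-! ### Change of charts -/

theorem vecComp_frameAt_eq_jac (he : e ∈ charts M) (he₀ : e₀ ∈ charts M) (hz : z ∈ e.target)
    (hz₀ : e.symm z ∈ e₀.source) (i a : Fin 4) :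
    vecComp e₀ (e.symm z) (frame e z i) a = jac (transition e₀ e) z a i := by
  have h1 := (mdifferentiable_of_mem_charts he).mdifferentiableAt_symm hz
  have h2 := (mdifferentiable_of_mem_charts he₀).mdifferentiableAt hz₀
  have h3 := mfderiv_comp z h2 h1
  rw [mfderiv_eq_fderiv] at h3
  have hd : DifferentiableAt ℝ (transition e₀ e) z := (h2.comp z h1).differentiableAt
  rw [jac, Matrix.of_apply, pd_eq_fderiv_apply hd]
  exact congrArg (fun v : R4 => v a) (DFunLike.congr_fun h3 (EuclideanSpace.single i (1 : ℝ))).symm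

theorem bilinComp_change (he : e ∈ charts M) (he₀ : e₀ ∈ charts M) (hz : z ∈ e.target)
    (hz₀ : e.symm z ∈ e₀.source) (B : BilinField M) :
    bilinComp e B z = (jac (transition e₀ e) z)ᵀ * bilinComp e₀ B (transition e₀ e z) *
      jac (transition e₀ e) z := by
  ext i j
  rw [pull_apply]
  simp only [← vecComp_frameAt_eq_jac he he₀ hz hz₀]
  exact bilin_eq_sum he₀ hz₀ B _ _

/-! ### The metric and the orientation in coordinates -/

variable [IsManifold (𝓡 4) ∞ M]

theorem contMDiffOn_frame (he : e ∈ charts M) (i : Fin 4) :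
    ContMDiffOn (𝓡 4) (𝓡 4).tangent ∞
      (fun z => (⟨e.symm z, frame e z i⟩ : TangentBundle (𝓡 4) M)) e.target := by
  have h1 := (contMDiffOn_symm_of_mem_maximalAtlas he).contMDiffOn_tangentMapWithin (m := ∞)
    (by simp) e.open_target.uniqueMDiffOn
  have h2 : ContMDiffOn (𝓡 4) (𝓡 4).tangent ∞
      (fun z => (⟨z, EuclideanSpace.single i (1 : ℝ)⟩ : TangentBundle (𝓡 4) R4)) e.target :=
    contMDiffOn_vectorSpace_iff_contDiffOn.2 contDiffOn_const
  refine (h1.comp h2 fun z hz => hz).congr fun z hz => ?_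
  simp only [Function.comp, tangentMapWithin, mfderivWithin_of_isOpen e.open_target hz]
  rfl

/-- The metric is a smooth section and the coordinate vectors are smooth sections of the tangent
bundle; their evaluation is a smooth section of a trivial line bundle. -/
theorem contDiffOn_metricComp (g : Metric4 M) (he : e ∈ charts M) :
    MatSmoothOn (metricComp g e) e.target := by
  intro i j
  have h : ContMDiffOn (𝓡 4) ((𝓡 4).prod 𝓘(ℝ, ℝ)) ∞ (fun z => TotalSpace.mk' ℝ (E := Bundle.Trivial M ℝ) (e.symm z)
      (g.inner (e.symm z) (frame e z i) (frame e z j))) e.target := by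
    intro z hz
    apply ContMDiffWithinAt.clm_bundle_apply₂ (F₁ := R4) (F₂ := R4)
    · exact ContMDiffAt.comp_contMDiffWithinAt z g.contMDiff.contMDiffAt
        (contMDiffOn_symm_of_mem_maximalAtlas he z hz)
    · exact contMDiffOn_frame he i z hz
    · exact contMDiffOn_frame he j z hz
  intro z hz
  have h1 := h z hz
  rw [contMDiffWithinAt_totalSpace] at h1
  exact h1.2.contDiffWithinAt

theorem isMetricOn_metricComp (g : Metric4 M) (he : e ∈ charts M) :
    IsMetricOn (metricComp g e) e.target where
  isOpen := e.open_target
  smooth := contDiffOn_metricComp g he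
  posDef z hz := by
    refine Matrix.PosDef.of_dotProduct_mulVec_pos ?_ fun v hv => ?_
    · ext i j
      exact g.symm _ _ _
    · set u : TangentSpace (𝓡 4) (e.symm z) :=
        ∑ i, v i • frameAt e (e.symm z) i with hu
      have hx := e.map_target hz
      have hc : ∀ i, vecComp e (e.symm z) u i = v i := by
        intro i
        rw [hu, map_sum]
        simp only [map_smul, vecComp_frameAt he hx]
        exact congrArg (fun w : R4 => w i) (eq_sum_single (WithLp.toLp 2 v)).symm
      have hne : u ≠ 0 := by
        intro h0
        apply hv
        funext i
        rw [← hc, h0, map_zero]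
        rfl
      have hp := g.pos _ u hne
      rw [bilin_eq_sum he hx, e.right_inv hz] at hp
      simp only [hc] at hp
      refine hp.trans_eq ?_
      simp only [dotProduct, Matrix.mulVec, Finset.mul_sum, star_trivial]
      exact Finset.sum_congr rfl fun i _ => Finset.sum_congr rfl fun j _ => by
        simp only [metricComp]; ring

end Manifold

end FourGeom

namespace FourGeom

open Matrix Filter Topology Bundle

section Manifold

variable {M : Type*} [TopologicalSpace M] [ChartedSpace R4 M]
  {e e₀ : OpenPartialHomeomorph M R4} {z : R4} {x : M}

theorem frame_eq_sum (he : e ∈ charts M) (he₀ : e₀ ∈ charts M) (hz : z ∈ e.target)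
    (hz₀ : e.symm z ∈ e₀.source) (i : Fin 4) : frame e z i =
      ∑ a, jac (transition e₀ e) z a i • frameAt e₀ (e.symm z) a := by
  simp only [← vecComp_frameAt_eq_jac he he₀ hz hz₀]
  exact eq_sum_frameAt he₀ hz₀ _

theorem alternating_sum {E : Type*} [AddCommGroup E] [Module ℝ E] (f : E [⋀^Fin 4]→ₗ[ℝ] ℝ)
    (b : Fin 4 → E) (A : Mat) : f (fun i => ∑ a, A a i • b a) = A.det * f b := by
  set L : (Fin 4 → ℝ) →ₗ[ℝ] E := Fintype.linearCombination ℝ b with hL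
  have h1 := (f.compLinearMap L).eq_smul_basis_det (Pi.basisFun ℝ (Fin 4))
  have h2 := DFunLike.congr_fun h1 fun i a => A a i
  have e1 : (fun i => L (fun a => A a i)) = fun i => ∑ a, A a i • b a := by
    funext i
    rw [hL, Fintype.linearCombination_apply]
  have e2 : (fun i => L (Pi.basisFun ℝ (Fin 4) i)) = b := by
    funext i
    rw [hL, Pi.basisFun_apply, Fintype.linearCombination_apply_single, one_smul]
  rw [AlternatingMap.smul_apply, AlternatingMap.compLinearMap_apply,
    AlternatingMap.compLinearMap_apply, Pi.basisFun_det_apply, smul_eq_mul] at h2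
  have e3 : (Matrix.of fun i a => A a i).det = A.det := Matrix.det_transpose A
  rw [show (fun i => L ((fun i a => A a i) i)) = fun i => ∑ a, A a i • b a from e1] at h2
  rw [h2, e2, e3, mul_comm]

theorem frameSign_eq (o : (x : M) → Orientation ℝ (TangentSpace (𝓡 4) x) (Fin 4))
    (hx : x ∈ e.source) :
    frameSign o e (e x) = (SignType.sign ((o x).someVector (frameAt e x)) : ℝ) := by
  have h : ∀ y : M, y = x → ∀ v : Fin 4 → R4,
      (SignType.sign ((o y).someVector v) : ℝ) = (SignType.sign ((o x).someVector v) : ℝ) := by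
    rintro y rfl v
    rfl
  exact h _ (e.left_inv hx) _

/-- An alternating form of top degree scales by the Jacobian determinant. The result has the shape
required by the covariance of the volume tensor. -/
theorem frameSign_change (o : (x : M) → Orientation ℝ (TangentSpace (𝓡 4) x) (Fin 4))
    (he : e ∈ charts M) (he₀ : e₀ ∈ charts M) (hz : z ∈ e.target)
    (hz₀ : e.symm z ∈ e₀.source) :
    frameSign o e z * |(jac (transition e₀ e) z).det| =
      frameSign o e₀ (transition e₀ e z) * (jac (transition e₀ e) z).det := by
  have h1 := alternating_sum (o (e.symm z)).someVector (frameAt e₀ (e.symm z))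
    (jac (transition e₀ e) z)
  rw [show (fun i => ∑ a, jac (transition e₀ e) z a i • frameAt e₀ (e.symm z) a) = frame e z from
    funext fun i => (frame_eq_sum he he₀ hz hz₀ i).symm] at h1
  have h2 : frameSign o e₀ (transition e₀ e z) = _ := frameSign_eq o hz₀
  rw [h2, frameSign, h1, sign_mul]
  push_cast
  rw [mul_right_comm, sign_mul_abs, mul_comm]

theorem frameSign_eq_one_or (o : (x : M) → Orientation ℝ (TangentSpace (𝓡 4) x) (Fin 4))
    (he : e ∈ charts M) (hz : z ∈ e.target) : frameSign o e z = 1 ∨ frameSign o e z = -1 := by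
  have hne : (o (e.symm z)).someVector (frame e z) ≠ 0 := by
    intro h0
    -- A form of top degree that vanishes on one basis vanishes identically.
    apply (o (e.symm z)).someVector_ne_zero
    ext v
    have hx := e.map_target hz
    have h1 := alternating_sum (o (e.symm z)).someVector (frameAt e (e.symm z))
      (Matrix.of fun a i => vecComp e (e.symm z) (v i) a)
    have h2 : (fun i => ∑ a, (Matrix.of fun a i => vecComp e (e.symm z) (v i) a) a i •
        frameAt e (e.symm z) a) = v := funext fun i => (eq_sum_frameAt he hx (v i)).symm
    have h3 : frameAt e (e.symm z) = frame e z := by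
      funext i
      exact congrArg (fun y => (mfderiv (𝓡 4) (𝓡 4) e.symm y : R4 →L[ℝ] R4)
        (EuclideanSpace.single i (1 : ℝ))) (e.right_inv hz)
    rw [h2, h3, h0, mul_zero] at h1
    exact h1
  rw [frameSign]
  rcases lt_or_gt_of_ne hne with h | h
  · right; simp [sign_neg h]
  · left; simp [sign_pos h]

/-! ### Bilinear forms with prescribed components -/

/-- The bilinear form with matrix `A`. -/
def bilinOfMatrix (A : Mat) : R4 →L[ℝ] R4 →L[ℝ] ℝ :=
  ∑ i, ∑ j, A i j • (coord i).smulRight (coord j)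

theorem bilinOfMatrix_apply (A : Mat) (u v : R4) :
    bilinOfMatrix A u v = ∑ i, ∑ j, u i * v j * A i j := by
  simp only [bilinOfMatrix, _root_.sum_apply, _root_.smul_apply,
    ContinuousLinearMap.smulRight_apply, smul_eq_mul]
  exact Finset.sum_congr rfl fun i _ => Finset.sum_congr rfl fun j _ => by
    change A i j * (u i * v j) = _; ring

/-- The field of bilinear forms whose components in the chart `e` are given. -/
def bilinOfComp (e : OpenPartialHomeomorph M R4) (A : R4 → Mat) : BilinField M := fun x =>
  let L : R4 →L[ℝ] R4 := mfderiv (𝓡 4) (𝓡 4) e x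
  (bilinOfMatrix (A (e x))).bilinearComp L L

theorem bilinOfComp_apply (A : R4 → Mat) (u v : TangentSpace (𝓡 4) x) :
    bilinOfComp e A x u v = ∑ i, ∑ j, vecComp e x u i * vecComp e x v j * A (e x) i j :=
  bilinOfMatrix_apply (A (e x)) (vecComp e x u) (vecComp e x v)

theorem bilinComp_bilinOfComp (he : e ∈ charts M) (he₀ : e₀ ∈ charts M) (hz : z ∈ e.target)
    (hz₀ : e.symm z ∈ e₀.source) (A : R4 → Mat) :
    bilinComp e (bilinOfComp e₀ A) z = (jac (transition e₀ e) z)ᵀ * A (transition e₀ e z) *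
      jac (transition e₀ e) z := by
  ext i j
  have h1 : bilinComp e (bilinOfComp e₀ A) z i j =
    bilinOfComp e₀ A (e.symm z) (frame e z i) (frame e z j) := rfl
  rw [h1, bilinOfComp_apply, pull_apply]
  simp only [vecComp_frameAt_eq_jac he he₀ hz hz₀, transition, Function.comp]

/-! ### Coordinate expressions of type D metrics -/

variable [IsManifold (𝓡 4) ∞ M]

theorem isTypeDOn (g : Metric4 M) (o : ManifoldOrientation M) {α : M → ℝ}
    (hD : IsTypeDWith g o α) (he : e ∈ charts M) :
    IsTypeDOn (metricComp g e) (frameSign o.at' e) (α ∘ e.symm) e.target where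
  toIsMetricOn := isMetricOn_metricComp g he
  sign _ hz := frameSign_eq_one_or o.at' he hz
  sign_cont := o.continuous' e he
  finrank_eq z hz := hD e he z hz

theorem chart_mem_charts (p : M) : chartAt R4 p ∈ charts M :=
  IsManifold.chart_mem_maximalAtlas p

theorem contMDiff_of_charts {f : M → ℝ}
    (hf : ∀ e ∈ charts M, ContDiffOn ℝ ∞ (f ∘ e.symm) e.target) :
    ContMDiff (𝓡 4) 𝓘(ℝ, ℝ) ∞ f := by
  intro p
  set e := chartAt R4 p
  have he : e ∈ charts M := chart_mem_charts p
  have hp : p ∈ e.source := mem_chart_source R4 p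
  have h1 : ContMDiffAt 𝓘(ℝ, R4) 𝓘(ℝ, ℝ) ∞ (f ∘ e.symm) (e p) :=
    ((hf e he).contDiffAt (e.open_target.mem_nhds (e.map_source hp))).contMDiffAt
  have h2 := h1.comp p (contMDiffAt_of_mem_maximalAtlas he hp)
  refine h2.congr_of_eventuallyEq ?_
  filter_upwards [e.open_source.mem_nhds hp] with y hy
  simp only [Function.comp, e.left_inv hy]

/-! ### Existence of the eigenform -/

theorem isPullback_transition (g : Metric4 M) (he : e ∈ charts M) (he₀ : e₀ ∈ charts M) :
    IsPullback (transition e₀ e) (metricComp g e₀) (metricComp g e)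
      e₀.target (e.target ∩ e.symm ⁻¹' e₀.source) where
  metric := isMetricOn_metricComp g he₀
  metric' :=
    { isOpen := e.symm.isOpen_inter_preimage e₀.open_source
      smooth := fun i j => (contDiffOn_metricComp g he i j).mono Set.inter_subset_left
      posDef := fun z hz => (isMetricOn_metricComp g he).posDef z hz.1 }
  smooth := contDiffOn_transition he he₀
  mapsTo _ hz := e₀.map_source hz.2
  eq _ hz := bilinComp_change he he₀ hz.1 hz.2 _

/-- The conditions are imposed in every chart, whereas the form is built in one. Covariance under
transition maps carries smoothness, the eigenvalue equation and the norm across. -/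
theorem isNormalizedEigenformOn_bilinOfComp (g : Metric4 M) (o : ManifoldOrientation M)
    {α : M → ℝ} (he₀ : e₀ ∈ charts M) {V : Set R4} {A : R4 → Mat}
    (hA : IsEigenformOn (metricComp g e₀) (frameSign o.at' e₀) (α ∘ e₀.symm) A V) :
    IsNormalizedEigenformOn g o (fun x => -2 * α x) (bilinOfComp e₀ A)
      (e₀.source ∩ e₀ ⁻¹' V) where
  smooth e he i j := by
    have hsub : e.target ∩ e.symm ⁻¹' (e₀.source ∩ e₀ ⁻¹' V) ⊆
        e.target ∩ e.symm ⁻¹' e₀.source := fun z hz => ⟨hz.1, hz.2.1⟩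
    have hJ : MatSmoothOn (jac (transition e₀ e))
        (e.target ∩ e.symm ⁻¹' (e₀.source ∩ e₀ ⁻¹' V)) := fun a b =>
      ((isPullback_transition g he he₀).jac_smooth a b).mono hsub
    have hA' : MatSmoothOn (fun z => A (transition e₀ e z))
        (e.target ∩ e.symm ⁻¹' (e₀.source ∩ e₀ ⁻¹' V)) := fun a b =>
      (hA.smooth a b).comp ((contDiffOn_transition he he₀).mono hsub) fun z hz => hz.2.2
    exact (((hJ.transpose.mul hA').mul hJ) i j).congr fun z hz => by
      rw [bilinComp_bilinOfComp he he₀ hz.1 hz.2.1]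
  eigen e he z hz hzU := by
    rw [bilinComp_bilinOfComp he he₀ hz hzU.1]
    refine (isPullback_transition g he he₀).mem_weylPlusEigenspace ⟨hz, hzU.1⟩
      (frameSign_change o.at' he he₀ hz hzU.1) ?_
    have h1 := hA.mem (transition e₀ e z) hzU.2
    have h2 : e₀.symm (transition e₀ e z) = e.symm z := e₀.left_inv hzU.1
    rwa [Function.comp, h2] at h1
  norm_sq e he z hz hzU := by
    have h1 : pair (metricComp g e z) (bilinComp e (bilinOfComp e₀ A) z)
        (bilinComp e (bilinOfComp e₀ A) z) = 2 := by
      rw [bilinComp_bilinOfComp he he₀ hz hzU.1,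
        (isPullback_transition g he he₀).eq z ⟨hz, hzU.1⟩,
        pair_pull _ _ ((isPullback_transition g he he₀).isUnit_det ⟨hz, hzU.1⟩).ne_zero]
      exact hA.norm _ hzU.2
    exact h1

theorem exists_isNormalizedEigenformOn (g : Metric4 M) (o : ManifoldOrientation M) {α : M → ℝ}
    (hD : IsTypeDWith g o α) (p : M) : ∃ U : Set M, IsOpen U ∧ p ∈ U ∧ ∃ S : BilinField M,
      IsNormalizedEigenformOn g o (fun x => -2 * α x) S U := by
  have he₀ := chart_mem_charts p
  have hp := mem_chart_source R4 p
  obtain ⟨V, hV, hpV, -, A, hA⟩ :=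
    (isTypeDOn g o hD he₀).exists_eigenform ((chartAt R4 p).map_source hp)
  exact ⟨_, (chartAt R4 p).isOpen_inter_preimage hV, ⟨hp, hpV⟩, _,
    isNormalizedEigenformOn_bilinOfComp g o he₀ hA⟩

/-! ### The conformal metric -/

set_option synthInstance.maxHeartbeats 200000 in
/-- The metric `f g` for a smooth positive function `f`. -/
def conformal (g : Metric4 M) (f : M → ℝ) (hf : ContMDiff (𝓡 4) 𝓘(ℝ, ℝ) ∞ f)
    (hpos : ∀ x, 0 < f x) : Metric4 M where
  inner x := f x • g.inner x
  symm x v w := congrArg (f x * ·) (g.symm x v w)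
  pos x v hv := mul_pos (hpos x) (g.pos x v hv)
  -- The unit ball of f g is the unit ball of g scaled by 1/√f.
  isVonNBounded x := by
    have h := (g.isVonNBounded x).image
      ((√(f x))⁻¹ • ContinuousLinearMap.id ℝ (TangentSpace (𝓡 4) x))
    refine h.subset fun v hv => ?_
    refine ⟨√(f x) • v, ?_, ?_⟩
    · have hv' : f x * g.inner x v v < 1 := hv
      have e : g.inner x (√(f x) • v) (√(f x) • v) = f x * g.inner x v v := by
        simp only [map_smul, _root_.smul_apply, smul_eq_mul]
        rw [← mul_assoc, Real.mul_self_sqrt (hpos x).le]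
      exact e.trans_lt hv'
    · change (√(f x))⁻¹ • √(f x) • v = v
      rw [inv_smul_smul₀ (Real.sqrt_pos.2 (hpos x)).ne']
  contMDiff := fun x => (hf x).smul_section (g.contMDiff x)

end Manifold

end FourGeom

/-! ### The almost complex structure and the Kähler property -/

namespace FourGeom

open Matrix Filter Topology

/-- Positivity makes the map from vectors to covectors injective, hence bijective by equality of
dimensions. -/
theorem exists_raise (g S : R4 →L[ℝ] R4 →L[ℝ] ℝ) (hg : ∀ v, v ≠ 0 → 0 < g v v) :
    ∃ J : R4 →L[ℝ] R4, ∀ u v, g (J u) v = S u v := by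
  set T : R4 →ₗ[ℝ] Module.Dual ℝ R4 := ContinuousLinearMap.coeLM ℝ ∘ₗ g.toLinearMap with hT
  have hinj : Function.Injective T := by
    rw [injective_iff_map_eq_zero]
    intro v hv
    by_contra h0
    have h1 : g v v = 0 := DFunLike.congr_fun hv v
    exact (hg v h0).ne' h1
  have hsurj : Function.Surjective T :=
    (LinearMap.injective_iff_surjective_of_finrank_eq_finrank
      (Subspace.dual_finrank_eq (K := ℝ) (V := R4)).symm).1 hinj
  set E := LinearEquiv.ofBijective T ⟨hinj, hsurj⟩
  refine ⟨LinearMap.toContinuousLinearMap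
    (E.symm.toLinearMap ∘ₗ (ContinuousLinearMap.coeLM ℝ ∘ₗ S.toLinearMap)), fun u v => ?_⟩
  exact DFunLike.congr_fun (E.apply_symm_apply (ContinuousLinearMap.coeLM ℝ (S u))) v

section Manifold

variable {M : Type*} [TopologicalSpace M] [ChartedSpace R4 M]
  {e : OpenPartialHomeomorph M R4} {z : R4} {x : M}

theorem contMDiff_abs_rpow {α : M → ℝ} (hα : ContMDiff (𝓡 4) 𝓘(ℝ, ℝ) ∞ α) (h0 : ∀ x, α x ≠ 0) (p : ℝ) :
    ContMDiff (𝓡 4) 𝓘(ℝ, ℝ) ∞ fun x => |α x| ^ p := fun x =>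
  ContDiffAt.comp_contMDiffAt
    ((contDiffAt_abs (h0 x)).rpow_const_of_ne (p := p) (abs_ne_zero.2 (h0 x))) (hα x)

variable [IsManifold (𝓡 4) ∞ M]

theorem exists_raiseField (g : Metric4 M) (S : BilinField M) :
    ∃ J : EndField M, ∀ x, ∀ u v : TangentSpace (𝓡 4) x, g.inner x (J x u) v = S x u v := by
  have h : ∀ x, ∃ J : TangentSpace (𝓡 4) x →L[ℝ] TangentSpace (𝓡 4) x,
      ∀ u v : TangentSpace (𝓡 4) x, g.inner x (J u) v = S x u v := fun x =>
    exists_raise (g.inner x) (S x) (g.pos x)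
  choose J hJ using h
  exact ⟨J, hJ⟩

/-- In components gₖᵢJⁱⱼ = Sⱼₖ, whence the transpose. This formula is also what gives the pointwise
chosen J its smoothness. -/
theorem endComp_eq (g : Metric4 M) {S : BilinField M} {J : EndField M} (he : e ∈ charts M)
    (hz : z ∈ e.target) (hJ : ∀ u v : TangentSpace (𝓡 4) (e.symm z),
      g.inner _ (J _ u) v = S _ u v) :
    endComp e J z = (metricComp g e z)⁻¹ * (bilinComp e S z)ᵀ := by
  have hx := e.map_target hz
  have h1 : metricComp g e z * endComp e J z = (bilinComp e S z)ᵀ := by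
    ext k j
    have h2 := hJ (frameAt e _ j) (frameAt e _ k)
    rw [eq_sum_frameAt he hx (J _ (frameAt e _ j)), ← bilinComp_eq S hx, e.right_inv hz] at h2
    simp only [map_sum, map_smul, _root_.sum_apply, _root_.smul_apply, smul_eq_mul] at h2
    rw [Matrix.mul_apply, Matrix.transpose_apply, ← h2]
    refine Finset.sum_congr rfl fun i _ => ?_
    have h3 : vecComp e (e.symm z) (J _ (frameAt e _ j)) i = endComp e J z i j := by
      rw [vecComp_endo he hx, e.right_inv hz, vecComp_frameAt he hx]
      simp
    rw [h3, ← bilinComp_eq g.inner hx, e.right_inv hz, mul_comm,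
      (isMetricOn_metricComp g he).symm hz]
  rw [← h1, Matrix.nonsing_inv_mul_cancel_left _ _ ((isMetricOn_metricComp g he).isUnit_det hz)]

variable {g : Metric4 M} {o : ManifoldOrientation M} {α : M → ℝ} {U : Set M} {S : BilinField M}
  {J : EndField M}

theorem IsNormalizedEigenformOn.isEigenformOn
    (hS : IsNormalizedEigenformOn g o (fun x => -2 * α x) S U) (he : e ∈ charts M) :
    IsEigenformOn (metricComp g e) (frameSign o.at' e) (α ∘ e.symm) (bilinComp e S)
      (e.target ∩ e.symm ⁻¹' U) where
  smooth := hS.smooth e he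
  mem z hz := hS.eigen e he z hz.1 hz.2
  norm z hz := hS.norm_sq e he z hz.1 hz.2

theorem IsNormalizedEigenformOn.skew (hS : IsNormalizedEigenformOn g o (fun x => -2 * α x) S U)
    (hx : x ∈ U) (u v : TangentSpace (𝓡 4) x) : S x u v = -S x v u := by
  have he := chart_mem_charts (M := M) x
  have hxe := mem_chart_source R4 x
  set e := chartAt R4 x
  have ht : e x ∈ e.target ∩ e.symm ⁻¹' U := ⟨e.map_source hxe, by
    rwa [Set.mem_preimage, e.left_inv hxe]⟩
  have h1 := (hS.isEigenformOn he).transpose_eq_neg ht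
  rw [bilin_eq_sum he hxe S u v, bilin_eq_sum he hxe S v u, Finset.sum_comm,
    ← Finset.sum_neg_distrib]
  refine Finset.sum_congr rfl fun j _ => ?_
  rw [← Finset.sum_neg_distrib]
  refine Finset.sum_congr rfl fun i _ => ?_
  have h2 : bilinComp e S (e x) i j = -bilinComp e S (e x) j i :=
    congrFun (congrFun h1 j) i
  rw [h2]
  ring

theorem IsNormalizedEigenformOn.sq_eq (hD : IsTypeDWith g o α) (hU : IsOpen U)
    (hS : IsNormalizedEigenformOn g o (fun x => -2 * α x) S U)
    (hJ : ∀ x, ∀ u v : TangentSpace (𝓡 4) x, g.inner x (J x u) v = S x u v)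
    (hx : x ∈ U) (u : TangentSpace (𝓡 4) x) : J x (J x u) = -u := by
  have he := chart_mem_charts (M := M) x
  have hxe := mem_chart_source R4 x
  set e := chartAt R4 x
  have ht : e x ∈ e.target ∩ e.symm ⁻¹' U := ⟨e.map_source hxe, by
    rwa [Set.mem_preimage, e.left_inv hxe]⟩
  have hE := hS.isEigenformOn he
  have hT := (isTypeDOn g o hD he).mono (e.symm.isOpen_inter_preimage hU) Set.inter_subset_left
  have h1 : endComp e J (e x) * endComp e J (e x) = -1 := by
    rw [endComp_eq g he ht.1 (hJ _), hE.transpose_eq_neg ht, Matrix.mul_neg, neg_mul_neg,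
      hT.inv_mul_sq hE ht]
  apply vecComp_injective he hxe
  ext i
  rw [vecComp_endo he hxe]
  simp only [vecComp_endo he hxe, Finset.mul_sum]
  rw [Finset.sum_comm]
  have h2 : ∀ j, ∑ k, endComp e J (e x) i k * (endComp e J (e x) k j * vecComp e x u j) =
      (-1 : Mat) i j * vecComp e x u j := by
    intro j
    rw [← h1, Matrix.mul_apply, Finset.sum_mul]
    exact Finset.sum_congr rfl fun _ _ => (mul_assoc _ _ _).symm
  simp only [h2, map_neg]
  simp [Matrix.one_apply]

/-- The metric `|α|^(2/3) g` is Kähler where there is a normalised eigenform. -/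
theorem IsNormalizedEigenformOn.isKahlerOn (hD : IsTypeDWith g o α) (hdiv : DivFreeWeylPlus g o)
    (hU : IsOpen U) (hS : IsNormalizedEigenformOn g o (fun x => -2 * α x) S U)
    (hJ : ∀ x, ∀ u v : TangentSpace (𝓡 4) x, g.inner x (J x u) v = S x u v)
    {gK : Metric4 M} (hK : ∀ x, gK.inner x = (|α x| ^ (2 / 3 : ℝ)) • g.inner x) :
    IsKahlerOn gK J U where
  smooth e he i j := by
    have hT := (isTypeDOn g o hD he).mono (e.symm.isOpen_inter_preimage hU) Set.inter_subset_left
    exact ((hT.inv_smooth.mul (hS.isEigenformOn he).smooth.transpose) i j).congr fun z hz => by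
      rw [endComp_eq g he hz.1 (hJ _)]
  sq x hx u := hS.sq_eq hD hU hJ hx u
  -- g(Ju, Jv) = Σ(u, Jv) = −Σ(Jv, u) = −g(J²v, u) = g(v, u), and the conformal factor multiplies
  -- both sides.
  orthogonal x hx u v := by
    have h : g.inner x (J x u) (J x v) = g.inner x u v := by
      rw [hJ, hS.skew hx, ← hJ, hS.sq_eq hD hU hJ hx, map_neg, _root_.neg_apply, neg_neg, g.symm]
    rw [hK]
    exact congrArg (|α x| ^ (2 / 3 : ℝ) * ·) h
  integrable e he z hz hzU i j k := by
    have hT := (isTypeDOn g o hD he).mono (e.symm.isOpen_inter_preimage hU) Set.inter_subset_left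
    have hzV : z ∈ e.target ∩ e.symm ⁻¹' U := ⟨hz, hzU⟩
    have h1 : endComp e J =ᶠ[𝓝 z] fun y => (metricComp g e y)⁻¹ * (bilinComp e S y)ᵀ :=
      mem_of_superset (hT.isOpen.mem_nhds hzV) fun y hy => endComp_eq g he hy.1 (hJ _)
    rw [nijenhuis_congr h1]
    exact hT.nijenhuis_eq_zero (hS.isEigenformOn he) (hdiv e he z hz) hzV i j k
  closed e he z hz hzU i j k := by
    have hT := (isTypeDOn g o hD he).mono (e.symm.isOpen_inter_preimage hU) Set.inter_subset_left
    have h1 : (bilinComp e fun x => (gK.inner x).comp (J x)) =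
        fun y => |(α ∘ e.symm) y| ^ (2 / 3 : ℝ) • bilinComp e S y := by
      funext y
      ext a b
      have h2 : gK.inner (e.symm y) (J _ (frame e y a)) (frame e y b) =
          |α (e.symm y)| ^ (2 / 3 : ℝ) * S _ (frame e y a) (frame e y b) := by
        rw [hK, ← hJ]
        rfl
      exact h2
    rw [h1]
    exact hT.extDerivTwo_eq_zero (hS.isEigenformOn he) (hdiv e he z hz) ⟨hz, hzU⟩ i j k

theorem eigenvalue_ne_zero (hD : IsTypeDWith g o α) (x : M) : α x ≠ 0 := by
  have he := chart_mem_charts (M := M) x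
  have hxe := mem_chart_source R4 x
  have h := ((isTypeDOn g o hD he).exists_coframe ((chartAt R4 x).map_source hxe)).1
  rwa [Function.comp, (chartAt R4 x).left_inv hxe] at h

theorem contMDiff_eigenvalue (hD : IsTypeDWith g o α) : ContMDiff (𝓡 4) 𝓘(ℝ, ℝ) ∞ α :=
  contMDiff_of_charts fun _ he => (isTypeDOn g o hD he).smooth_eigenvalue

end Manifold

end FourGeom

end

theorem mainTheorem1 {M : Type*} [TopologicalSpace M] [ChartedSpace FourGeom.R4 M]
    [IsManifold (𝓡 4) ∞ M] (g : FourGeom.Metric4 M) (o : FourGeom.ManifoldOrientation M)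
    (α : M → ℝ) (hD : FourGeom.IsTypeDWith g o α) (hdiv : FourGeom.DivFreeWeylPlus g o) :
    ContMDiff (𝓡 4) 𝓘(ℝ, ℝ) ∞ α ∧ (∀ x, α x ≠ 0) ∧
    ∃ gK : FourGeom.Metric4 M,
      (∀ x, gK.inner x = (|α x| ^ (2 / 3 : ℝ)) • g.inner x) ∧
      (∀ p : M, ∃ U : Set M, IsOpen U ∧ p ∈ U ∧ ∃ S : FourGeom.BilinField M,
        FourGeom.IsNormalizedEigenformOn g o (fun x => -2 * α x) S U) ∧
      (∀ U : Set M, IsOpen U → ∀ S : FourGeom.BilinField M,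
        FourGeom.IsNormalizedEigenformOn g o (fun x => -2 * α x) S U →
        ∃ J : FourGeom.EndField M,
          (∀ x ∈ U, ∀ u v : TangentSpace (𝓡 4) x, g.inner x (J x u) v = S x u v) ∧
          FourGeom.IsKahlerOn gK J U) := by
  have hα := FourGeom.contMDiff_eigenvalue hD
  have h0 := FourGeom.eigenvalue_ne_zero hD
  refine ⟨hα, h0, FourGeom.conformal g _ (FourGeom.contMDiff_abs_rpow hα h0 (2 / 3))
    (fun x => Real.rpow_pos_of_pos (abs_pos.2 (h0 x)) _), fun _ => rfl,
    FourGeom.exists_isNormalizedEigenformOn g o hD, fun U hU S hS => ?_⟩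
  -- The form is raised at every point of M; regularity and the square of J are claimed only on U.
  obtain ⟨J, hJ⟩ := FourGeom.exists_raiseField g S
  exact ⟨J, fun x _ => hJ x, hS.isKahlerOn hD hdiv hU hJ fun _ => rfl⟩
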